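/- **Setting.** Let $n\ge 2$, let $\Omega\subset\mathbb R^n$ be a bounded domain with Lipschitz boundary, let $A$ be an open set (possibly empty) with $\overline A\subset\Omega$, with Lipschitz boundary and finitely many connected components, such that $B:=\Omega\setminus\overline A$ is connected. Let $1<p,q<\infty$ and let $\sigma(x,E)\in[0,\infty]$, $x\in A\cup B$, $E\ge0$, be measurable in $x$ for every $E$ and continuous in $E$ for a.e. $x$, separately on $A$ and on $B$. For $1<s<\infty$ and an open set $U$ consider the conditions, for a.e. $x\in U$: * $G(s,U)$: there are constants $0<\underline\sigma\le\overline\sigma$, $E_0>0$ with $\underline\sigma(E/E_0)^{s-2}\le\sigma(x,E)\le\overline\sigma[1+(E/E_0)^{s-2}]$ if $s\ge2$, and $\underline\sigma(E/E_0)^{s-2}\le\sigma(x,E)\le\overline\sigma(E/E_0)^{s-2}$ if $s<2$, for all $E>0$; * $M(s,U)$: there is $\kappa>0$ such that for all $\xi_1,\xi_2\in\mathbb R^n$ the number $(\sigma(x,|\xi_2|)\xi_2-\sigma(x,|\xi_1|)\xi_1)\cdot(\xi_2-\xi_1)$ is at least $\kappa|\xi_2-\xi_1|^s$ if $s\ge2$,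 and at least $\kappa(1+|\xi_2|^2+|\xi_1|^2)^{\frac{s-2}2}|\xi_2-\xi_1|^2$ if $s<2$ (here $\sigma(x,0)\,0:=0$). Assume $G(p,B)$, $M(p,B)$ and one of the following: (i) $A=\emptyset$; (ii) $G(q,A)$ and $M(q,A)$; (iii) $\sigma=0$ on $A$ (insulator); (iv) $\sigma=+\infty$ on $A$ (perfect conductor). Let $Q_\sigma(x,E)=\int_0^E\sigma(x,\xi)\xi\,d\xi$ and $\mathbb E_\sigma(u)=\int_D Q_\sigma(x,|\nabla u|)\,dx\in[0,\infty]$, where $D=\Omega$ in cases (i), (ii) and $D=B$ in cases (iii), (iv). Let $X^p(\partial\Omega)=W^{1,p}(\Omega)/W^{1,p}_0(\Omega)$ be the space of boundary data. For $g\in X^p(\partial\Omega)$ let $u^g$ be the minimizer of $\mathbb E_\sigma(u)$ among the functions $u$ with $u=g$ on $\partial\Omega$ and, respectively, (i) $u\in W^{1,p}(\Omega)$; (ii) $u\in W^{1,p}(\Omega)\cup W^{1,q}(\Omega)$; (iii) $u\in W^{1,p}(B)$; (iv) $u\in W^{1,p}(\Omega)$ with $\nabla u=0$ a.e. in $A$.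 (Here $u=g$ on $\partial\Omega$ means $u-g\in W_0^{1,p}(\Omega)$ in (i), (iv), $u-g\in W_0^{1,p}(\Omega)\cup W^{1,q}_0(\Omega)$ in (ii), and in (iii) that $u-g$ coincides near $\partial\Omega$ with an element of $W^{1,p}_0(\Omega)$.) Let the test space $W$ be, respectively, (i) $W^{1,p}(\Omega)$; (ii) the set of $\psi\in W^{1,\min\{p,q\}}(\Omega)$ with $\psi|_B\in W^{1,p}(B)$ and $\psi|_A\in W^{1,q}(A)$; (iii) $W^{1,p}(B)$; (iv) the set of $\psi\in W^{1,p}(\Omega)$ with $\nabla\psi=0$ a.e. in $A$. **Proposition.** For every $g\in X^p(\partial\Omega)$ the minimizer $u^g$ exists, is unique a.e., and has finite energy. Every $\varphi\in X^p(\partial\Omega)$ is the boundary value of some $\psi\in W$, and for $f,\varphi\in X^p(\partial\Omega)$ the number $$\langle\Lambda_\sigma(f),\varphi\rangle:=\int_D\sigma(x,|\nabla u^f|)\,\nabla u^f\cdot\nabla\psi\,dx,\qquad \psi\in W,\ \psi=\varphi\text{ on }\partial\Omega,$$ is well defined: the integrand is integrable and the integral does not depend on the choice of $\psi$. For every $f\in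 X^p(\partial\Omega)$ (in particular for every $f$ with zero mean on $\partial\Omega$) the map $g\mapsto\mathbb E_\sigma(u^g)$ is Gâteaux differentiable at $f$ with derivative $\Lambda_\sigma(f)$: the functional $\varphi\mapsto\langle\Lambda_\sigma(f),\varphi\rangle$ is linear and bounded on $X^p(\partial\Omega)$, and $$\lim_{\varepsilon\to0}\frac{\mathbb E_\sigma(u^{f+\varepsilon\varphi})-\mathbb E_\sigma(u^f)}{\varepsilon}=\langle\Lambda_\sigma(f),\varphi\rangle\qquad\text{for all }\varphi\in X^p(\partial\Omega).$$ -/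

import Mathlib

open MeasureTheory Set
open scoped NNReal ENNReal ContDiff

noncomputable section

/-! ### Sobolev spaces on open subsets of Euclidean space -/

/-- `V` is a weak gradient of `u` on the open set `U`. -/
structure IsWeakGrad {n : ℕ} (U : Set (EuclideanSpace ℝ (Fin n)))
    (u : EuclideanSpace ℝ (Fin n) → ℝ)
    (V : EuclideanSpace ℝ (Fin n) → EuclideanSpace ℝ (Fin n)) : Prop where
  locallyIntegrable : LocallyIntegrableOn u U
  grad_locallyIntegrable : LocallyIntegrableOn V U
  integral_eq : ∀ η : EuclideanSpace ℝ (Fin n) → ℝ,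
    ContDiff ℝ ∞ η → HasCompactSupport η → tsupport η ⊆ U →
      ∫ x in U, u x • gradient η x = -∫ x in U, η x • V x

open Classical in
/-- The weak gradient of `u` on `U` (unique up to a null set; `0` if there is none). -/
def weakGrad {n : ℕ} (U : Set (EuclideanSpace ℝ (Fin n)))
    (u : EuclideanSpace ℝ (Fin n) → ℝ) :
    EuclideanSpace ℝ (Fin n) → EuclideanSpace ℝ (Fin n) :=
  if h : ∃ V, IsWeakGrad U u V then h.choose else 0

/-- `u ∈ W^{1,s}(U)`. -/
def MemW {n : ℕ} (s : ℝ) (U : Set (EuclideanSpace ℝ (Fin n)))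
    (u : EuclideanSpace ℝ (Fin n) → ℝ) : Prop :=
  MemLp u (ENNReal.ofReal s) (volume.restrict U) ∧
    ∃ V, IsWeakGrad U u V ∧ MemLp V (ENNReal.ofReal s) (volume.restrict U)

/-- The norm of `W^{1,s}(U)`. -/
def normW {n : ℕ} (s : ℝ) (U : Set (EuclideanSpace ℝ (Fin n)))
    (u : EuclideanSpace ℝ (Fin n) → ℝ) : ℝ :=
  (eLpNorm u (ENNReal.ofReal s) (volume.restrict U)).toReal +
    (eLpNorm (weakGrad U u) (ENNReal.ofReal s) (volume.restrict U)).toReal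

/-- `u ∈ W^{1,s}_0(U)`: the closure of the compactly supported `C¹` functions on `U` in the
norm of `W^{1,s}(U)`. -/
def MemW0 {n : ℕ} (s : ℝ) (U : Set (EuclideanSpace ℝ (Fin n)))
    (u : EuclideanSpace ℝ (Fin n) → ℝ) : Prop :=
  MemW s U u ∧ ∀ δ : ℝ≥0∞, 0 < δ → ∃ η : EuclideanSpace ℝ (Fin n) → ℝ,
    ContDiff ℝ 1 η ∧ HasCompactSupport η ∧ tsupport η ⊆ U ∧
      eLpNorm (u - η) (ENNReal.ofReal s) (volume.restrict U) ≤ δ ∧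
      eLpNorm (weakGrad U u - gradient η) (ENNReal.ofReal s) (volume.restrict U) ≤ δ

/-! ### Geometry -/

/-- The boundary of `U` is Lipschitz: near each boundary point, `U` is the strict epigraph of a
Lipschitz function of the component orthogonal to some direction `e`. -/
def HasLipschitzBoundary {n : ℕ} (U : Set (EuclideanSpace ℝ (Fin n))) : Prop :=
  ∀ x₀ ∈ frontier U, ∃ (ρ : ℝ) (e : EuclideanSpace ℝ (Fin n)) (K : ℝ≥0)
    (g : EuclideanSpace ℝ (Fin n) → ℝ), 0 < ρ ∧ ‖e‖ = 1 ∧ LipschitzWith K g ∧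
      ∀ y ∈ Metric.ball x₀ ρ, y ∈ U ↔ g (y - inner ℝ e y • e) < inner ℝ e y

/-- The data of the problem: the conducting region `Ω`, the region `A` of the inner material, the
growth exponents `p` (in `Ω ∖ closure A`) and `q` (in `A`), and the electrical conductivity
`σ x E`.  The conductivity takes values in `[0, ∞]`: the value `∞` occurs in a perfect conductor,
and at `E = 0` for a growth exponent smaller than `2`. -/
structure Conductor (n : ℕ) where
  Ω : Set (EuclideanSpace ℝ (Fin n))
  A : Set (EuclideanSpace ℝ (Fin n))
  p : ℝ
  q : ℝ
  σ : EuclideanSpace ℝ (Fin n) → ℝ≥0 → ℝ≥0∞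

/-- The region of the outer material. -/
def Conductor.B {n : ℕ} (M : Conductor n) : Set (EuclideanSpace ℝ (Fin n)) :=
  M.Ω \ closure M.A

/-- The standing geometric assumptions (`A` may be empty). -/
structure Conductor.Geometry {n : ℕ} (M : Conductor n) : Prop where
  isOpen : IsOpen M.Ω
  isConnected : IsConnected M.Ω
  isBounded : Bornology.IsBounded M.Ω
  lipschitz : HasLipschitzBoundary M.Ω
  inner_isOpen : IsOpen M.A
  inner_subset : closure M.A ⊆ M.Ω
  inner_lipschitz : HasLipschitzBoundary M.A
  inner_components : Finite (ConnectedComponents M.A)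
  outer_isConnected : IsConnected M.B

/-! ### Assumptions on the conductivity -/

/-- Carathéodory functions on `U × [0, ∞)`. -/
def IsCaratheodoryOn {n : ℕ} (U : Set (EuclideanSpace ℝ (Fin n)))
    (σ : EuclideanSpace ℝ (Fin n) → ℝ≥0 → ℝ≥0∞) : Prop :=
  (∀ E : ℝ≥0, AEMeasurable (fun x => σ x E) (volume.restrict U)) ∧
    ∀ᵐ x ∂(volume.restrict U), Continuous (σ x)

open Classical in
/-- Growth of `σ` on `U` with exponent `s`. -/
def HasGrowth {n : ℕ} (s : ℝ) (U : Set (EuclideanSpace ℝ (Fin n)))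
    (σ : EuclideanSpace ℝ (Fin n) → ℝ≥0 → ℝ≥0∞) : Prop :=
  ∃ lo hi E₀ : ℝ≥0, 0 < lo ∧ lo ≤ hi ∧ 0 < E₀ ∧
    ∀ᵐ x ∂(volume.restrict U), ∀ E : ℝ≥0, 0 < E →
      (lo : ℝ≥0∞) * ((E / E₀ : ℝ≥0) : ℝ≥0∞) ^ (s - 2) ≤ σ x E ∧
      σ x E ≤
        if 2 ≤ s then (hi : ℝ≥0∞) * (1 + ((E / E₀ : ℝ≥0) : ℝ≥0∞) ^ (s - 2))
        else (hi : ℝ≥0∞) * ((E / E₀ : ℝ≥0) : ℝ≥0∞) ^ (s - 2)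

/-- The vector `σ(x, |ξ|) ξ` (which is `0` for `ξ = 0`). -/
def flux {n : ℕ} (σ : EuclideanSpace ℝ (Fin n) → ℝ≥0 → ℝ≥0∞)
    (x ξ : EuclideanSpace ℝ (Fin n)) : EuclideanSpace ℝ (Fin n) :=
  (σ x ‖ξ‖₊).toReal • ξ

open Classical in
/-- Strong monotonicity of `ξ ↦ σ(x, |ξ|) ξ` on `U` with exponent `s`. -/
def IsStronglyMonotone {n : ℕ} (s : ℝ) (U : Set (EuclideanSpace ℝ (Fin n)))
    (σ : EuclideanSpace ℝ (Fin n) → ℝ≥0 → ℝ≥0∞) : Prop :=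
  ∃ κ : ℝ, 0 < κ ∧ ∀ᵐ x ∂(volume.restrict U), ∀ ξ₁ ξ₂ : EuclideanSpace ℝ (Fin n),
    (if 2 ≤ s then κ * ‖ξ₂ - ξ₁‖ ^ s
      else κ * (1 + ‖ξ₂‖ ^ 2 + ‖ξ₁‖ ^ 2) ^ ((s - 2) / 2) * ‖ξ₂ - ξ₁‖ ^ 2) ≤
      inner ℝ (flux σ x ξ₂ - flux σ x ξ₁) (ξ₂ - ξ₁)

/-- The four types of inner material. -/
inductive Regime where
  /-- there is no inner material -/
  | homogeneous
  /-- the inner material has `q`-growth -/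
  | twoPhase
  /-- the inner material is a perfect electric insulator -/
  | insulating
  /-- the inner material is a perfect electric conductor -/
  | perfect

/-- The assumption on the inner material. -/
def Conductor.InnerMaterial {n : ℕ} (M : Conductor n) : Regime → Prop
  | .homogeneous => M.A = ∅
  | .twoPhase => HasGrowth M.q M.A M.σ ∧ IsStronglyMonotone M.q M.A M.σ
  | .insulating => ∀ᵐ x ∂(volume.restrict M.A), ∀ E : ℝ≥0, M.σ x E = 0
  | .perfect => ∀ᵐ x ∂(volume.restrict M.A), ∀ E : ℝ≥0, M.σ x E = ⊤

/-! ### The variational problems -/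

/-- The region on which potentials are defined. -/
def Conductor.domain {n : ℕ} (M : Conductor n) : Regime → Set (EuclideanSpace ℝ (Fin n))
  | .homogeneous => M.Ω
  | .twoPhase => M.Ω
  | .insulating => M.B
  | .perfect => M.Ω

/-- The region over which the energy density is integrated. -/
def Conductor.energyRegion {n : ℕ} (M : Conductor n) :
    Regime → Set (EuclideanSpace ℝ (Fin n))
  | .homogeneous => M.Ω
  | .twoPhase => M.Ω
  | .insulating => M.B
  | .perfect => M.B

/-- The Dirichlet energy density `∫₀ᴱ σ(x, ξ) ξ dξ`. -/
def Conductor.density {n : ℕ} (M : Conductor n) (x : EuclideanSpace ℝ (Fin n)) (E : ℝ≥0) :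
    ℝ≥0∞ :=
  ∫⁻ ξ in Icc (0 : ℝ) E, M.σ x ξ.toNNReal * ENNReal.ofReal ξ

/-- The Dirichlet energy, with values in `[0, ∞]`. -/
def Conductor.energy {n : ℕ} (M : Conductor n) (c : Regime)
    (u : EuclideanSpace ℝ (Fin n) → ℝ) : ℝ≥0∞ :=
  ∫⁻ x in M.energyRegion c, M.density x ‖weakGrad (M.domain c) u x‖₊

/-- The class of functions among which the energy is minimised, before the boundary condition is
imposed. -/
def Conductor.Trial {n : ℕ} (M : Conductor n) (c : Regime)
    (u : EuclideanSpace ℝ (Fin n) → ℝ) : Prop :=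
  match c with
  | .homogeneous => MemW M.p M.Ω u
  | .twoPhase => MemW M.p M.Ω u ∨ MemW M.q M.Ω u
  | .insulating => MemW M.p M.B u
  | .perfect => MemW M.p M.Ω u ∧ ∀ᵐ x ∂(volume.restrict M.A), weakGrad M.Ω u x = 0

/-- `u = g` on `∂Ω`.  For an insulating inner material, `u` is defined in `B` only and no condition
is imposed on `∂A`: near `∂Ω`, the function `u - g` has to coincide with an element of
`W^{1,p}_0(Ω)`. -/
def Conductor.EqOnBoundary {n : ℕ} (M : Conductor n) (c : Regime)
    (u g : EuclideanSpace ℝ (Fin n) → ℝ) : Prop :=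
  match c with
  | .homogeneous => MemW0 M.p M.Ω (u - g)
  | .twoPhase => MemW0 M.p M.Ω (u - g) ∨ MemW0 M.q M.Ω (u - g)
  | .insulating => ∃ w : EuclideanSpace ℝ (Fin n) → ℝ, MemW0 M.p M.Ω w ∧
      ∃ K : Set (EuclideanSpace ℝ (Fin n)), IsCompact K ∧ K ⊆ M.Ω ∧
        ∀ᵐ x ∂(volume.restrict (M.B \ K)), u x - g x = w x
  | .perfect => MemW0 M.p M.Ω (u - g)

/-- `u` minimises the Dirichlet energy among the trial functions with boundary values `g`. -/
def Conductor.IsSolution {n : ℕ} (M : Conductor n) (c : Regime)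
    (g u : EuclideanSpace ℝ (Fin n) → ℝ) : Prop :=
  (M.Trial c u ∧ M.EqOnBoundary c u g) ∧
    ∀ v : EuclideanSpace ℝ (Fin n) → ℝ, M.Trial c v → M.EqOnBoundary c v g →
      M.energy c u ≤ M.energy c v

/-- The solution operator, `g ↦ u^g`. -/
def Conductor.potential {n : ℕ} (M : Conductor n) (c : Regime)
    (g : EuclideanSpace ℝ (Fin n) → ℝ) : EuclideanSpace ℝ (Fin n) → ℝ :=
  Classical.epsilon (M.IsSolution c g)

/-! ### The Dirichlet-to-Neumann operator -/

/-- The test functions of the weak formulation.  Every boundary datum in the trace space of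
`W^{1,p}(Ω)` is the boundary value of such a function. -/
def Conductor.Test {n : ℕ} (M : Conductor n) (c : Regime)
    (ψ : EuclideanSpace ℝ (Fin n) → ℝ) : Prop :=
  match c with
  | .homogeneous => MemW M.p M.Ω ψ
  | .twoPhase => (MemW M.p M.Ω ψ ∨ MemW M.q M.Ω ψ) ∧ MemW M.p M.B ψ ∧ MemW M.q M.A ψ
  | .insulating => MemW M.p M.B ψ
  | .perfect => MemW M.p M.Ω ψ ∧ ∀ᵐ x ∂(volume.restrict M.A), weakGrad M.Ω ψ x = 0

/-- The virtual power density `σ(x, |∇u|) ∇u · ∇ψ`. -/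
def Conductor.powerDensity {n : ℕ} (M : Conductor n) (c : Regime)
    (u ψ : EuclideanSpace ℝ (Fin n) → ℝ) (x : EuclideanSpace ℝ (Fin n)) : ℝ :=
  inner ℝ (flux M.σ x (weakGrad (M.domain c) u x)) (weakGrad (M.domain c) ψ x)

/-- The pairing `⟨Λ_σ(f), φ⟩` in weak form: the virtual power of `u^f` against a test function
with the boundary values `φ`. -/
def Conductor.dtn {n : ℕ} (M : Conductor n) (c : Regime)
    (f φ : EuclideanSpace ℝ (Fin n) → ℝ) : ℝ :=
  ∫ x in M.energyRegion c, M.powerDensity c (M.potential c f)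
    (Classical.epsilon fun ψ => M.Test c ψ ∧ M.EqOnBoundary c ψ φ) x

/-- `L` is the Gâteaux derivative of `G` at `f`, as a bounded linear functional, for maps on the
space of boundary data; boundary data are represented by functions in `W^{1,s}(U)`. -/
structure IsGateauxDerivAt {n : ℕ} (s : ℝ) (U : Set (EuclideanSpace ℝ (Fin n)))
    (G : (EuclideanSpace ℝ (Fin n) → ℝ) → ℝ) (f : EuclideanSpace ℝ (Fin n) → ℝ)
    (L : (EuclideanSpace ℝ (Fin n) → ℝ) → ℝ) : Prop where
  map_add : ∀ φ₁ φ₂, MemW s U φ₁ → MemW s U φ₂ → L (φ₁ + φ₂) = L φ₁ + L φ₂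
  map_smul : ∀ (t : ℝ) (φ), MemW s U φ → L (t • φ) = t * L φ
  bounded : ∃ C : ℝ, ∀ φ, MemW s U φ → |L φ| ≤ C * normW s U φ
  hasDerivAt : ∀ φ, MemW s U φ → HasDerivAt (fun ε : ℝ => G (f + ε • φ)) (L φ) 0

end

/-! The energy is a convex functional of the field `∇u`, and its formal derivative is the flux.
Monotonicity of the flux gives the subgradient inequality `flux(V) · (W - V) ≤ Q(W) - Q(V)`, which
replaces differentiation of the energy throughout. Growth makes the energy finite and coercive on
`L^s`, and strong monotonicity makes it uniformly convex (`exists_rpow_norm_sub_le`).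

The four kinds of inner material are treated at once. Up to a null set the domain consists of `B`,
where the exponent is `p`, an inner phase, which is nonempty at most in the two-phase regime and has
exponent `q`, and a rigid part, where the field vanishes. A smooth cutoff `χ`, equal to `1` near
`∂Ω` and to `0` near `closure A`, turns all four boundary conditions into `χ(u - g) ∈ W_0`, and `χ
g` is a lifting of the datum `g` that is admissible in every regime. The minimizers are then the
minimizers over an affine space `χ g + Z`.

Existence needs no weak compactness. A minimizing sequence has Cauchy fields by uniform convexity,
and the subgradient inequality at the limit shows that the limit is minimal. That the fields of `Z`
form a complete space, and that a potential in `Z` is determined by its field, both rest on a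
Poincaré inequality. It is obtained by shifting along segments. On all of `Ω` one shift moves the
set off itself; on `B`, where nothing is prescribed on `∂A`, the estimate is propagated from a point
of `∂Ω` by connectedness and compactness, and the Lipschitz graph lets one step away from `∂A`.

For the derivative let `u_ε` be the minimizer for the data `f + εφ`, and let `v = χφ`. The
subgradient inequality at `u_0` with the Euler–Lagrange equation bounds `E(u_ε) - E(u_0)` below by
`ε ⟨Λ(f), φ⟩`. The competitor `u_0 + εv` with the subgradient inequality there bounds it above by
`ε` times the power of `u_0 + εv` against `v`, which tends to `⟨Λ(f), φ⟩` by dominated convergence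
(`FieldSpace.hasDerivAt_totalEnergy`). -/

/-! ### Scalar conductivity laws: flux, energy density, growth. -/

/-- The scalar flux `E ↦ a(E) E` of a conductivity law `a`, extended by `0` to negative fields. -/
noncomputable def scalarFlux (a : ℝ≥0 → ℝ≥0∞) (E : ℝ) : ℝ := (a E.toNNReal).toReal * E.toNNReal

/-- A conductivity law of power type, with a constant `C` that is uniform in all bounds. -/
structure PowerLaw (s C : ℝ) (a : ℝ≥0 → ℝ≥0∞) : Prop where
  one_lt : 1 < s
  pos : 0 < C
  cont : Continuous a
  ne_top : ∀ E : ℝ≥0, 0 < E → a E ≠ ⊤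
  lower : ∀ E : ℝ≥0, 0 < E → (E : ℝ) ^ (s - 1) ≤ C * scalarFlux a E
  upper : ∀ E : ℝ≥0, 0 < E → scalarFlux a E ≤ C * (1 + (E : ℝ) ^ (s - 1))
  upper_zero : ∀ E : ℝ≥0, 0 < E → scalarFlux a E ≤ C * (E + (E : ℝ) ^ (s - 1))
  mono : Monotone (scalarFlux a)

/-- The energy density of a conductivity law. -/
noncomputable def lawEnergy (a : ℝ≥0 → ℝ≥0∞) (E : ℝ≥0) : ℝ≥0∞ :=
  ∫⁻ ξ in Icc (0 : ℝ) E, a ξ.toNNReal * ENNReal.ofReal ξ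

namespace PowerLaw

variable {s C : ℝ} {a : ℝ≥0 → ℝ≥0∞}

theorem scalarFlux_zero : scalarFlux a 0 = 0 := by simp [scalarFlux]

theorem scalarFlux_nonneg (E : ℝ) : 0 ≤ scalarFlux a E := by unfold scalarFlux; positivity

/-- A law may be infinite at `0`, so continuity of `a` does not settle that point. There the flux is
squeezed to `0` by the bound `upper_zero`, which, unlike `upper`, tends to `0` with the field. -/
theorem continuous_scalarFlux (h : PowerLaw s C a) : Continuous (scalarFlux a) := by
  rw [continuous_iff_continuousAt]
  intro E
  rcases lt_or_ge 0 E with hE | hE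
  · have h1 : ContinuousAt (fun E : ℝ => (a E.toNNReal).toReal) E := by
      have : ContinuousAt (fun E : ℝ => a E.toNNReal) E :=
        (h.cont.comp continuous_real_toNNReal).continuousAt
      exact (ENNReal.tendsto_toReal (h.ne_top _ (Real.toNNReal_pos.2 hE))).comp this
    exact h1.mul (NNReal.continuous_coe.comp continuous_real_toNNReal).continuousAt
  · have h0 : scalarFlux a E = 0 := by simp [scalarFlux, Real.toNNReal_of_nonpos hE]
    have hc : Continuous fun E : ℝ => C * ((E.toNNReal : ℝ) + (E.toNNReal : ℝ) ^ (s - 1)) := by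
      have : Continuous fun E : ℝ => (E.toNNReal : ℝ) :=
        NNReal.continuous_coe.comp continuous_real_toNNReal
      have h1 := h.one_lt
      exact continuous_const.mul (this.add (this.rpow_const fun _ => Or.inr (by linarith)))
    have hz : C * ((E.toNNReal : ℝ) + (E.toNNReal : ℝ) ^ (s - 1)) = 0 := by
      have h1 := h.one_lt
      simp [Real.toNNReal_of_nonpos hE, Real.zero_rpow (by linarith : s - 1 ≠ 0)]
    have ht := hc.tendsto E
    rw [hz] at ht
    rw [ContinuousAt, h0]
    refine squeeze_zero (fun t => scalarFlux_nonneg t) (fun t => ?_) ht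
    rcases lt_or_ge 0 t with htt | htt
    · have := h.upper_zero t.toNNReal (Real.toNNReal_pos.2 htt)
      rwa [Real.coe_toNNReal _ htt.le] at this ⊢
    · have h1 := h.one_lt
      simp [scalarFlux, Real.toNNReal_of_nonpos htt, Real.zero_rpow (by linarith : s - 1 ≠ 0)]

theorem lawEnergy_eq (h : PowerLaw s C a) (E : ℝ≥0) :
    lawEnergy a E = ENNReal.ofReal (∫ ξ in (0 : ℝ)..E, scalarFlux a ξ) := by
  rw [lawEnergy, intervalIntegral.integral_of_le E.coe_nonneg, ← integral_Icc_eq_integral_Ioc,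
    ofReal_integral_eq_lintegral_ofReal]
  · refine setLIntegral_congr_fun measurableSet_Icc fun ξ hξ => ?_
    rcases hξ.1.eq_or_lt with rfl | h0
    -- At `ξ = 0` the convention `⊤ * 0 = 0` absorbs a possibly infinite conductivity.
    · simp [scalarFlux]
    · have := h.ne_top ξ.toNNReal (Real.toNNReal_pos.2 h0)
      simp only [scalarFlux]
      rw [ENNReal.ofReal_mul (by positivity), ENNReal.ofReal_toReal this, Real.coe_toNNReal _ h0.le]
  · exact h.continuous_scalarFlux.integrableOn_Icc
  · exact Filter.Eventually.of_forall fun ξ => scalarFlux_nonneg ξ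

theorem lawEnergy_ne_top (h : PowerLaw s C a) (E : ℝ≥0) : lawEnergy a E ≠ ⊤ := by
  rw [h.lawEnergy_eq]; exact ENNReal.ofReal_ne_top

theorem lawEnergy_toReal (h : PowerLaw s C a) (E : ℝ≥0) :
    (lawEnergy a E).toReal = ∫ ξ in (0 : ℝ)..E, scalarFlux a ξ := by
  rw [h.lawEnergy_eq, ENNReal.toReal_ofReal]
  exact intervalIntegral.integral_nonneg E.2 fun ξ _ => scalarFlux_nonneg ξ

/-- The energy is the primitive of a monotone function, so the flux between the two fields is
compared with its value at `E₁`. All convexity and growth estimates for the energy come from this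
subgradient inequality. -/
theorem mul_le_lawEnergy_sub (h : PowerLaw s C a) (E₁ E₂ : ℝ≥0) :
    scalarFlux a E₁ * (E₂ - E₁) ≤ (lawEnergy a E₂).toReal - (lawEnergy a E₁).toReal := by
  have hi : ∀ x y : ℝ, IntervalIntegrable (scalarFlux a) volume x y := fun x y =>
    h.continuous_scalarFlux.intervalIntegrable x y
  rw [h.lawEnergy_toReal, h.lawEnergy_toReal, intervalIntegral.integral_interval_sub_left
    (hi _ _) (hi _ _)]
  rcases le_total (E₁ : ℝ) E₂ with hle | hle
  · have := intervalIntegral.integral_mono_on hle (intervalIntegrable_const (μ := volume))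
      (hi _ _) (fun x hx => h.mono hx.1)
    simpa [mul_comm] using this
  · have := intervalIntegral.integral_mono_on hle (hi _ _)
      (intervalIntegrable_const (μ := volume) (c := scalarFlux a E₁)) (fun x hx => h.mono hx.2)
    rw [intervalIntegral.integral_symm]
    simp only [intervalIntegral.integral_const, smul_eq_mul] at this
    linarith

theorem lawEnergy_zero : lawEnergy a 0 = 0 := by simp [lawEnergy]

theorem lawEnergy_le (h : PowerLaw s C a) (E : ℝ≥0) :
    (lawEnergy a E).toReal ≤ 2 * C * (1 + (E : ℝ) ^ s) := by
  rcases eq_or_ne E 0 with rfl | hE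
  · have := h.pos
    rw [lawEnergy_zero]; simp; positivity
  have hE : 0 < E := pos_iff_ne_zero.2 hE
  -- Tested against the field `0`: the energy is at most the flux times `E`.
  have h1 := h.mul_le_lawEnergy_sub E 0
  rw [lawEnergy_zero] at h1
  simp only [NNReal.coe_zero, zero_sub, ENNReal.toReal_zero] at h1
  have h2 := h.upper E hE
  have hE' : (0 : ℝ) < E := hE
  have h3 : (E : ℝ) ^ s = E ^ (s - 1) * E := by
    rw [← Real.rpow_add_one hE'.ne']; ring_nf
  have h5 : (E : ℝ) ≤ 1 + (E : ℝ) ^ s := by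
    rcases le_total (E : ℝ) 1 with h6 | h6
    · have : 0 ≤ (E : ℝ) ^ s := by positivity
      linarith
    · have := Real.rpow_le_rpow_of_exponent_le h6 h.one_lt.le
      rw [Real.rpow_one] at this
      linarith
  have h7 := mul_le_mul_of_nonneg_right h2 hE'.le
  have h8 := h.pos
  nlinarith [mul_le_mul_of_nonneg_left h5 h8.le]

theorem rpow_le_lawEnergy (h : PowerLaw s C a) (E : ℝ≥0) :
    (E : ℝ) ^ s ≤ 2 ^ s * C * (lawEnergy a E).toReal := by
  rcases eq_or_ne E 0 with rfl | hE
  · have := h.one_lt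
    rw [lawEnergy_zero]; simp [Real.zero_rpow (by linarith : s ≠ 0)]
  have hE : 0 < E := pos_iff_ne_zero.2 hE
  have hE' : (0 : ℝ) < E := hE
  -- Based at half the field: the energy is at least the flux at `E / 2` times `E / 2`. This is the
  -- origin of the factor `2 ^ s`.
  have h1 := h.mul_le_lawEnergy_sub (E / 2) E
  have h2 := h.lower (E / 2) (by positivity)
  have h3 : 0 ≤ (lawEnergy a (E / 2)).toReal := by positivity
  have hc : ((E / 2 : ℝ≥0) : ℝ) = E / 2 := by push_cast; ring
  rw [hc] at h1 h2
  have h4 : (E : ℝ) ^ s = 2 ^ s * ((E / 2 : ℝ) ^ (s - 1) * (E / 2)) := by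
    rw [← Real.rpow_add_one (by positivity), sub_add_cancel,
      ← Real.mul_rpow (by norm_num) (by positivity)]
    congr 1; ring
  rw [h4, mul_assoc]
  refine mul_le_mul_of_nonneg_left ?_ (by positivity)
  have h5 := h.pos
  have h6 : scalarFlux a (E / 2) * (E / 2) ≤ (lawEnergy a E).toReal := by
    have : (E : ℝ) - E / 2 = E / 2 := by ring
    rw [this] at h1; linarith
  calc _ ≤ C * scalarFlux a (E / 2) * (E / 2) := by gcongr
    _ = C * (scalarFlux a (E / 2) * (E / 2)) := by ring
    _ ≤ _ := by gcongr

end PowerLaw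

/-! ### Laws acting on vectors: convexity and uniform convexity. -/

section Vector

variable {F : Type*} [NormedAddCommGroup F] {s C : ℝ} {a : ℝ≥0 → ℝ≥0∞}

/-- The energy density at a vector, as a real number. -/
noncomputable def vecEnergy (a : ℝ≥0 → ℝ≥0∞) (ξ : F) : ℝ := (lawEnergy a ‖ξ‖₊).toReal

theorem vecEnergy_nonneg (ξ : F) : 0 ≤ vecEnergy a ξ := ENNReal.toReal_nonneg

theorem PowerLaw.vecEnergy_le (h : PowerLaw s C a) (ξ : F) : vecEnergy a ξ ≤ 2 * C * (1 + ‖ξ‖ ^ s) :=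
  h.lawEnergy_le ‖ξ‖₊

theorem PowerLaw.rpow_le_vecEnergy (h : PowerLaw s C a) (ξ : F) :
    ‖ξ‖ ^ s ≤ 2 ^ s * C * vecEnergy a ξ :=
  h.rpow_le_lawEnergy ‖ξ‖₊

variable [InnerProductSpace ℝ F]

/-- The vector flux `a(|ξ|) ξ`. -/
noncomputable def vecFlux (a : ℝ≥0 → ℝ≥0∞) (ξ : F) : F := (a ‖ξ‖₊).toReal • ξ

theorem norm_vecFlux (ξ : F) : ‖vecFlux a ξ‖ = scalarFlux a ‖ξ‖ := by
  simp [vecFlux, scalarFlux, norm_smul]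

namespace PowerLaw

theorem norm_vecFlux_le (h : PowerLaw s C a) (ξ : F) :
    ‖vecFlux a ξ‖ ≤ C * (1 + ‖ξ‖ ^ (s - 1)) := by
  rw [norm_vecFlux]
  rcases eq_or_ne ξ 0 with rfl | hξ
  · have := h.pos
    simp only [norm_zero, scalarFlux_zero]; positivity
  · exact h.upper ‖ξ‖₊ (by simpa using hξ)

theorem continuous_vecFlux (h : PowerLaw s C a) : Continuous (vecFlux a : F → F) := by
  rw [continuous_iff_continuousAt]
  intro ξ
  rcases eq_or_ne ξ 0 with rfl | hξ
  · have h0 : vecFlux a (0 : F) = 0 := by simp [vecFlux]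
    rw [ContinuousAt, h0, tendsto_zero_iff_norm_tendsto_zero]
    simp only [norm_vecFlux]
    have := (h.continuous_scalarFlux.comp (continuous_norm (E := F))).tendsto 0
    simpa [scalarFlux_zero, Function.comp_def] using this
  · have h1 : ContinuousAt (fun ξ : F => (a ‖ξ‖₊).toReal) ξ := by
      have : ContinuousAt (fun ξ : F => a ‖ξ‖₊) ξ := (h.cont.comp continuous_nnnorm).continuousAt
      exact (ENNReal.tendsto_toReal (h.ne_top _ (by simpa using hξ))).comp this
    exact h1.smul continuousAt_id

/-- The energy is radial, so Cauchy–Schwarz reduces the claim to the scalar subgradient inequality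
for the norms. -/
theorem inner_vecFlux_le (h : PowerLaw s C a) (ξ₁ ξ₂ : F) :
    inner ℝ (vecFlux a ξ₁) (ξ₂ - ξ₁) ≤ vecEnergy a ξ₂ - vecEnergy a ξ₁ := by
  refine le_trans ?_ (h.mul_le_lawEnergy_sub ‖ξ₁‖₊ ‖ξ₂‖₊)
  simp only [vecFlux, scalarFlux, Real.toNNReal_coe]
  rw [inner_smul_left, inner_sub_right, real_inner_self_eq_norm_sq]
  simp only [conj_trivial, coe_nnnorm]
  rw [mul_assoc]
  refine mul_le_mul_of_nonneg_left ?_ (by positivity)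
  nlinarith [real_inner_le_norm ξ₁ ξ₂]

/-- Two applications of the subgradient inequality on both halves of a segment. -/
theorem inner_quarter_le (h : PowerLaw s C a) (ξ₁ ξ₂ : F) :
    inner ℝ (vecFlux a ((1 / 4 : ℝ) • ξ₁ + (3 / 4 : ℝ) • ξ₂) -
        vecFlux a ((3 / 4 : ℝ) • ξ₁ + (1 / 4 : ℝ) • ξ₂)) ((1 / 4 : ℝ) • (ξ₂ - ξ₁)) ≤
      vecEnergy a ξ₁ + vecEnergy a ξ₂ - 2 * vecEnergy a ((1 / 2 : ℝ) • (ξ₁ + ξ₂)) := by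
  -- `α` and `β` are the midpoints of the two halves of the segment. In the sum of the four
  -- inequalities the flux terms at the midpoint `ζ` cancel.
  set α := (3 / 4 : ℝ) • ξ₁ + (1 / 4 : ℝ) • ξ₂ with hα
  set β := (1 / 4 : ℝ) • ξ₁ + (3 / 4 : ℝ) • ξ₂ with hβ
  set ζ := (1 / 2 : ℝ) • (ξ₁ + ξ₂) with hζ
  have h1 := h.inner_vecFlux_le α ξ₁
  have h2 := h.inner_vecFlux_le ζ α
  have h3 := h.inner_vecFlux_le β ξ₂
  have h4 := h.inner_vecFlux_le ζ β
  have e1 : ξ₁ - α = -((1 / 4 : ℝ) • (ξ₂ - ξ₁)) := by rw [hα]; module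
  have e2 : α - ζ = -((1 / 4 : ℝ) • (ξ₂ - ξ₁)) := by rw [hα, hζ]; module
  have e3 : ξ₂ - β = (1 / 4 : ℝ) • (ξ₂ - ξ₁) := by rw [hβ]; module
  have e4 : β - ζ = (1 / 4 : ℝ) • (ξ₂ - ξ₁) := by rw [hβ, hζ]; module
  rw [e1, inner_neg_right] at h1
  rw [e2, inner_neg_right] at h2
  rw [e3] at h3
  rw [e4] at h4
  rw [inner_sub_left]
  linarith

end PowerLaw

open Classical in
/-- Strong monotonicity of a conductivity law. -/
def StronglyMonotoneLaw (F : Type*) [NormedAddCommGroup F] [InnerProductSpace ℝ F]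
    (s κ : ℝ) (a : ℝ≥0 → ℝ≥0∞) : Prop :=
  ∀ ξ₁ ξ₂ : F, (if 2 ≤ s then κ * ‖ξ₂ - ξ₁‖ ^ s
      else κ * (1 + ‖ξ₂‖ ^ 2 + ‖ξ₁‖ ^ 2) ^ ((s - 2) / 2) * ‖ξ₂ - ξ₁‖ ^ 2) ≤
      inner ℝ (vecFlux a ξ₂ - vecFlux a ξ₁) (ξ₂ - ξ₁)

/-- Either `D ≤ η √T`, and the first term dominates, or `D ^ (s - 2) ≤ (η √T) ^ (s - 2)` because the
exponent is negative. This converts the degenerate quadratic monotonicity for `s < 2` into an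
estimate of `D ^ s` with a small remainder. -/
theorem rpow_le_young {D T s η : ℝ} (hs : s < 2) (hs1 : 1 < s) (hη : 0 < η) (hD : 0 ≤ D)
    (hT : 0 < T) : D ^ s ≤ η ^ s * T ^ (s / 2) + η ^ (s - 2) * (T ^ ((s - 2) / 2) * D ^ 2) := by
  have hpow : ∀ r : ℝ, (T ^ (1 / 2 : ℝ)) ^ r = T ^ (r / 2) := fun r => by
    rw [← Real.rpow_mul hT.le]; congr 1; ring
  have hR : 0 < T ^ (1 / 2 : ℝ) := by positivity
  rw [← hpow s, ← hpow (s - 2)]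
  generalize T ^ (1 / 2 : ℝ) = R at hR
  rcases le_or_gt D (η * R) with h | h
  · have h1 : D ^ s ≤ (η * R) ^ s := Real.rpow_le_rpow hD h (by linarith)
    rw [Real.mul_rpow hη.le hR.le] at h1
    have : 0 ≤ η ^ (s - 2) * (R ^ (s - 2) * D ^ 2) := by positivity
    linarith
  · have hD' : 0 < D := lt_trans (by positivity) h
    have h1 : D ^ (s - 2) ≤ (η * R) ^ (s - 2) :=
      Real.rpow_le_rpow_of_nonpos (by positivity) h.le (by linarith)
    rw [Real.mul_rpow hη.le hR.le] at h1
    have h2 : D ^ s = D ^ (s - 2) * D ^ 2 := by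
      rw [← Real.rpow_natCast D 2, ← Real.rpow_add hD']; norm_num
    have : 0 ≤ η ^ s * R ^ s := by positivity
    rw [h2]
    nlinarith [mul_le_mul_of_nonneg_right h1 (sq_nonneg D)]

theorem one_add_sq_rpow_le {x y s : ℝ} (hs : s < 2) (hs1 : 1 < s) :
    (1 + x ^ 2 + y ^ 2) ^ (s / 2) ≤ 1 + |x| ^ s + |y| ^ s := by
  have key : ∀ x : ℝ, (x ^ 2) ^ (s / 2) = |x| ^ s := fun x => by
    rw [← sq_abs, ← Real.rpow_natCast, ← Real.rpow_mul (abs_nonneg x)]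
    congr 1; push_cast; ring
  have h1 := Real.rpow_add_le_add_rpow (p := s / 2) (a := 1 + x ^ 2) (b := y ^ 2) (by positivity) (by positivity)
    (by linarith) (by linarith)
  have h2 := Real.rpow_add_le_add_rpow (p := s / 2) (a := 1) (b := x ^ 2) (by positivity) (by positivity)
    (by linarith) (by linarith)
  rw [key] at h1 h2
  rw [Real.one_rpow] at h2
  linarith

/-- Uniform convexity of the energy density, in additive form. -/
theorem exists_rpow_norm_sub_le {s κ : ℝ} (C : ℝ) (hs : 1 < s) (hκ : 0 < κ) (hC : 0 < C) {δ : ℝ}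
    (hδ : 0 < δ) :
    ∃ K : ℝ, 0 < K ∧ ∀ a : ℝ≥0 → ℝ≥0∞, PowerLaw s C a → StronglyMonotoneLaw F s κ a →
      ∀ ξ₁ ξ₂ : F, ‖ξ₁ - ξ₂‖ ^ s ≤ δ * (1 + vecEnergy a ξ₁ + vecEnergy a ξ₂) +
        K * (vecEnergy a ξ₁ + vecEnergy a ξ₂ - 2 * vecEnergy a ((1 / 2 : ℝ) • (ξ₁ + ξ₂))) := by
  have hdiff : ∀ ξ₁ ξ₂ : F, ((1 / 4 : ℝ) • ξ₁ + (3 / 4 : ℝ) • ξ₂) -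
      ((3 / 4 : ℝ) • ξ₁ + (1 / 4 : ℝ) • ξ₂) = (1 / 2 : ℝ) • (ξ₂ - ξ₁) := fun ξ₁ ξ₂ => by module
  have hhalf : ∀ ξ₁ ξ₂ : F, (1 / 2 : ℝ) • (ξ₂ - ξ₁) = (2 : ℝ) • (1 / 4 : ℝ) • (ξ₂ - ξ₁) :=
    fun ξ₁ ξ₂ => by module
  have hnorm : ∀ ξ₁ ξ₂ : F, ‖(1 / 2 : ℝ) • (ξ₂ - ξ₁)‖ = ‖ξ₁ - ξ₂‖ / 2 := fun ξ₁ ξ₂ => by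
    rw [norm_smul, norm_sub_rev]; norm_num; ring
  have hpos : ∀ (a : ℝ≥0 → ℝ≥0∞) (ξ₁ ξ₂ : F),
      0 ≤ 1 + vecEnergy a ξ₁ + vecEnergy a ξ₂ := fun a ξ₁ ξ₂ => by
    have := vecEnergy_nonneg (a := a) ξ₁
    have := vecEnergy_nonneg (a := a) ξ₂
    positivity
  rcases le_or_gt 2 s with h2 | h2
  -- The points compared differ by half of `ξ₂ - ξ₁`, whence `2 ^ s`, and that difference is twice
  -- the vector of `inner_quarter_le`, whence the last factor.
  · refine ⟨2 ^ s * κ⁻¹ * 2, by positivity, fun a ha hm ξ₁ ξ₂ => ?_⟩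
    have h3 := ha.inner_quarter_le ξ₁ ξ₂
    have h4 := hm ((3 / 4 : ℝ) • ξ₁ + (1 / 4 : ℝ) • ξ₂) ((1 / 4 : ℝ) • ξ₁ + (3 / 4 : ℝ) • ξ₂)
    rw [if_pos h2, hdiff, hnorm, hhalf, inner_smul_right,
      Real.div_rpow (norm_nonneg _) (by norm_num)] at h4
    set G := vecEnergy a ξ₁ + vecEnergy a ξ₂ - 2 * vecEnergy a ((1 / 2 : ℝ) • (ξ₁ + ξ₂))
    have h5 : κ * (‖ξ₁ - ξ₂‖ ^ s / 2 ^ s) ≤ 2 * G := by linarith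
    have h6 : 0 ≤ δ * (1 + vecEnergy a ξ₁ + vecEnergy a ξ₂) := mul_nonneg hδ.le (hpos a ξ₁ ξ₂)
    have h7 : ‖ξ₁ - ξ₂‖ ^ s = 2 ^ s * κ⁻¹ * (κ * (‖ξ₁ - ξ₂‖ ^ s / 2 ^ s)) := by
      field_simp
    have h8 : 2 ^ s * κ⁻¹ * (κ * (‖ξ₁ - ξ₂‖ ^ s / 2 ^ s)) ≤ 2 ^ s * κ⁻¹ * (2 * G) := by gcongr
    linarith
  -- The term `η ^ s * T ^ (s / 2)` of the Young inequality is to contribute exactly the remainder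
  -- with `δ`; the factor `1 + 2 ^ s * C` bounds `T ^ (s / 2)` by the energies.
  · obtain ⟨η, hη, hηδ⟩ : ∃ η : ℝ, 0 < η ∧ η ^ s * (1 + 2 ^ s * C) = δ := by
      refine ⟨(δ / (1 + 2 ^ s * C)) ^ s⁻¹, by positivity, ?_⟩
      rw [← Real.rpow_mul (by positivity), inv_mul_cancel₀ (by linarith), Real.rpow_one]
      field_simp
    refine ⟨η ^ (s - 2) * κ⁻¹ * 8, by positivity, fun a ha hm ξ₁ ξ₂ => ?_⟩
    have h3 := ha.inner_quarter_le ξ₁ ξ₂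
    set α := (3 / 4 : ℝ) • ξ₁ + (1 / 4 : ℝ) • ξ₂ with hα
    set β := (1 / 4 : ℝ) • ξ₁ + (3 / 4 : ℝ) • ξ₂ with hβ
    have h4 := hm α β
    rw [if_neg (by linarith), hdiff, hnorm, hhalf, inner_smul_right] at h4
    set G := vecEnergy a ξ₁ + vecEnergy a ξ₂ - 2 * vecEnergy a ((1 / 2 : ℝ) • (ξ₁ + ξ₂))
    set D := ‖ξ₁ - ξ₂‖
    set T := 1 + ‖ξ₁‖ ^ 2 + ‖ξ₂‖ ^ 2 with hT
    have hTpos : 0 < T := by positivity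
    -- Moving inward along the segment does not increase the sum of squares. As the exponent is
    -- negative, the weight at the inner points dominates the one at the end points.
    have h5 : 1 + ‖β‖ ^ 2 + ‖α‖ ^ 2 ≤ T := by
      have a1 : ‖α‖ ≤ 3 / 4 * ‖ξ₁‖ + 1 / 4 * ‖ξ₂‖ := by
        refine (norm_add_le _ _).trans_eq ?_
        rw [norm_smul, norm_smul]; norm_num
      have a2 : ‖β‖ ≤ 1 / 4 * ‖ξ₁‖ + 3 / 4 * ‖ξ₂‖ := by
        refine (norm_add_le _ _).trans_eq ?_
        rw [norm_smul, norm_smul]; norm_num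
      have a3 := pow_le_pow_left₀ (norm_nonneg _) a1 2
      have a4 := pow_le_pow_left₀ (norm_nonneg _) a2 2
      nlinarith [sq_nonneg (‖ξ₁‖ - ‖ξ₂‖)]
    have h6 : T ^ ((s - 2) / 2) ≤ (1 + ‖β‖ ^ 2 + ‖α‖ ^ 2) ^ ((s - 2) / 2) :=
      Real.rpow_le_rpow_of_nonpos (by positivity) h5 (by linarith)
    have h7 : κ * T ^ ((s - 2) / 2) * (D / 2) ^ 2 ≤ 2 * G := by
      refine le_trans ?_ (h4.trans (by linarith))
      gcongr
    have h8 : T ^ ((s - 2) / 2) * D ^ 2 ≤ κ⁻¹ * 8 * G := by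
      have : T ^ ((s - 2) / 2) * D ^ 2 = κ⁻¹ * 4 * (κ * T ^ ((s - 2) / 2) * (D / 2) ^ 2) := by
        field_simp; ring
      rw [this]
      have := mul_le_mul_of_nonneg_left h7 (by positivity : 0 ≤ κ⁻¹ * 4)
      linarith
    have h9 : T ^ (s / 2) ≤ (1 + 2 ^ s * C) * (1 + vecEnergy a ξ₁ + vecEnergy a ξ₂) := by
      have := one_add_sq_rpow_le (x := ‖ξ₁‖) (y := ‖ξ₂‖) h2 hs
      rw [abs_norm, abs_norm, ← hT] at this
      have b1 := ha.rpow_le_vecEnergy ξ₁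
      have b2 := ha.rpow_le_vecEnergy ξ₂
      have b3 := vecEnergy_nonneg (a := a) ξ₁
      have b4 := vecEnergy_nonneg (a := a) ξ₂
      have b5 : 0 < 2 ^ s * C := by positivity
      nlinarith
    calc D ^ s ≤ η ^ s * T ^ (s / 2) + η ^ (s - 2) * (T ^ ((s - 2) / 2) * D ^ 2) :=
          rpow_le_young h2 hs hη (norm_nonneg _) hTpos
      _ ≤ η ^ s * ((1 + 2 ^ s * C) * (1 + vecEnergy a ξ₁ + vecEnergy a ξ₂)) +
          η ^ (s - 2) * (κ⁻¹ * 8 * G) := by gcongr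
      _ = _ := by rw [← hηδ]; ring

end Vector

/-! ### Measurability of Carathéodory compositions. -/

section Caratheodory

variable {X : Type*} [MeasurableSpace X] {μ : Measure X}

/-- On a measurable null set the law is replaced by `0`; off it, the law is continuous and agrees
with measurable functions at a countable dense set of fields. Continuity then gives measurability at
every field, and hence joint measurability. -/
theorem exists_measurable_uncurry_ae_eq {σ : X → ℝ≥0 → ℝ≥0∞}
    (hm : ∀ E, AEMeasurable (fun x => σ x E) μ) (hc : ∀ᵐ x ∂μ, Continuous (σ x)) :
    ∃ τ : X → ℝ≥0 → ℝ≥0∞, Measurable (fun z : ℝ≥0 × X => τ z.2 z.1) ∧ ∀ᵐ x ∂μ, σ x = τ x := by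
  classical
  let d : ℕ → ℝ≥0 := TopologicalSpace.denseSeq ℝ≥0
  have hd : DenseRange d := TopologicalSpace.denseRange_denseSeq ℝ≥0
  have hgood : ∀ᵐ x ∂μ, Continuous (σ x) ∧ ∀ k, σ x (d k) = (hm (d k)).mk _ x :=
    hc.and (ae_all_iff.2 fun k => (hm (d k)).ae_eq_mk)
  set S := {x | ¬ (Continuous (σ x) ∧ ∀ k, σ x (d k) = (hm (d k)).mk _ x)} with hS
  have hS0 : μ (toMeasurable μ S) = 0 := by rw [measure_toMeasurable]; exact hgood
  have hN : MeasurableSet (toMeasurable μ S) := measurableSet_toMeasurable μ S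
  set N := toMeasurable μ S with hNdef
  have hnot : ∀ x, x ∉ N → Continuous (σ x) ∧ ∀ k, σ x (d k) = (hm (d k)).mk _ x := fun x hx => by
    by_contra h
    exact hx (subset_toMeasurable μ S h)
  let τ : X → ℝ≥0 → ℝ≥0∞ := fun x => if x ∈ N then fun _ => 0 else σ x
  have hτc : ∀ x, Continuous (τ x) := fun x => by
    by_cases hx : x ∈ N
    · simp only [τ, hx, if_true]; exact continuous_const
    · simp only [τ, hx, if_false]; exact (hnot x hx).1
  have hτd : ∀ k, Measurable fun x => τ x (d k) := fun k => by
    have : (fun x => τ x (d k)) = fun x => if x ∈ N then 0 else (hm (d k)).mk _ x := by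
      funext x
      by_cases hx : x ∈ N
      · simp [τ, hx]
      · simp [τ, hx, (hnot x hx).2 k]
    rw [this]
    exact Measurable.ite hN measurable_const (hm (d k)).measurable_mk
  have hτm : ∀ E, Measurable fun x => τ x E := fun E => by
    obtain ⟨u, hu, huE⟩ := mem_closure_iff_seq_limit.1 (hd E)
    refine measurable_of_tendsto_metrizable (f := fun k x => τ x (u k)) (fun k => ?_) ?_
    · obtain ⟨j, hj⟩ := hu k
      rw [← hj]; exact hτd j
    · rw [tendsto_pi_nhds]
      exact fun x => ((hτc x).tendsto E).comp huE
  refine ⟨τ, measurable_uncurry_of_continuous_of_measurable (u := fun E x => τ x E) hτc hτm, ?_⟩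
  have : ∀ᵐ x ∂μ, x ∉ N := measure_eq_zero_iff_ae_notMem.1 hS0
  filter_upwards [this] with x hx
  simp [τ, hx]

variable {F : Type*} [NormedAddCommGroup F]

theorem aemeasurable_lawEnergy {σ : X → ℝ≥0 → ℝ≥0∞}
    (hm : ∀ E, AEMeasurable (fun x => σ x E) μ) (hc : ∀ᵐ x ∂μ, Continuous (σ x)) {V : X → F}
    (hV : AEStronglyMeasurable V μ) : AEMeasurable (fun x => lawEnergy (σ x) ‖V x‖₊) μ := by
  obtain ⟨τ, hτ, hστ⟩ := exists_measurable_uncurry_ae_eq hm hc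
  have h1 : Measurable fun z : X × ℝ≥0 => lawEnergy (τ z.1) z.2 := by
    have h2 : ∀ z : X × ℝ≥0, lawEnergy (τ z.1) z.2 = ∫⁻ ξ : ℝ,
        {w : (X × ℝ≥0) × ℝ | 0 ≤ w.2 ∧ w.2 ≤ w.1.2}.indicator
          (fun w => τ w.1.1 w.2.toNNReal * ENNReal.ofReal w.2) (z, ξ) := fun z => by
      rw [lawEnergy, ← lintegral_indicator measurableSet_Icc]
      rfl
    simp_rw [h2]
    refine Measurable.lintegral_prod_right' (ν := (volume : Measure ℝ)) (Measurable.indicator ?_ ?_)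
    · have : Measurable fun w : (X × ℝ≥0) × ℝ => τ w.1.1 w.2.toNNReal :=
        hτ.comp ((measurable_snd.real_toNNReal).prodMk (measurable_fst.comp measurable_fst))
      exact this.mul measurable_snd.ennreal_ofReal
    · exact (measurableSet_le measurable_const measurable_snd).inter
        (measurableSet_le measurable_snd
          (measurable_coe_nnreal_real.comp (measurable_snd.comp measurable_fst)))
  have h3 : AEMeasurable (fun x => lawEnergy (τ x) ‖V x‖₊) μ :=
    h1.comp_aemeasurable (aemeasurable_id.prodMk hV.nnnorm.aemeasurable)
  refine h3.congr ?_
  filter_upwards [hστ] with x hx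
  rw [hx]

theorem aestronglyMeasurable_vecFlux [InnerProductSpace ℝ F] {σ : X → ℝ≥0 → ℝ≥0∞}
    (hm : ∀ E, AEMeasurable (fun x => σ x E) μ) (hc : ∀ᵐ x ∂μ, Continuous (σ x)) {V : X → F}
    (hV : AEStronglyMeasurable V μ) : AEStronglyMeasurable (fun x => vecFlux (σ x) (V x)) μ := by
  obtain ⟨τ, hτ, hστ⟩ := exists_measurable_uncurry_ae_eq hm hc
  have h3 : AEMeasurable (fun x => (τ x ‖V x‖₊).toReal) μ :=
    (hτ.comp_aemeasurable (hV.nnnorm.aemeasurable.prodMk aemeasurable_id)).ennreal_toReal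
  refine (h3.aestronglyMeasurable.smul hV).congr ?_
  filter_upwards [hστ] with x hx
  rw [vecFlux, hx]
  rfl

end Caratheodory

/-! ### Integral functionals of one phase: energy and virtual power. -/

/-- A material of power type: a Carathéodory family of conductivity laws with uniform bounds. -/
structure PowerMaterial {X : Type*} [MeasurableSpace X] (μ : Measure X) (F : Type*)
    [NormedAddCommGroup F] [InnerProductSpace ℝ F] (s C κ : ℝ) (σ : X → ℝ≥0 → ℝ≥0∞) : Prop where
  one_lt : 1 < s
  pos : 0 < C
  mono_pos : 0 < κ
  meas : ∀ E, AEMeasurable (fun x => σ x E) μ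
  law : ∀ᵐ x ∂μ, PowerLaw s C (σ x)
  mono : ∀ᵐ x ∂μ, StronglyMonotoneLaw F s κ (σ x)

/-- The energy of a vector field in a material. -/
noncomputable def matEnergy {X : Type*} [MeasurableSpace X] (μ : Measure X) {F : Type*}
    [NormedAddCommGroup F] (σ : X → ℝ≥0 → ℝ≥0∞) (V : X → F) : ℝ :=
  ∫ x, vecEnergy (σ x) (V x) ∂μ

/-- The virtual power of a vector field against another one. -/
noncomputable def matPower {X : Type*} [MeasurableSpace X] (μ : Measure X) {F : Type*}
    [NormedAddCommGroup F] [InnerProductSpace ℝ F] (σ : X → ℝ≥0 → ℝ≥0∞) (V W : X → F) : ℝ :=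
  ∫ x, inner ℝ (vecFlux (σ x) (V x)) (W x) ∂μ

theorem matEnergy_nonneg {X : Type*} [MeasurableSpace X] {μ : Measure X} {F : Type*}
    [NormedAddCommGroup F] {σ : X → ℝ≥0 → ℝ≥0∞} (V : X → F) : 0 ≤ matEnergy μ σ V :=
  integral_nonneg fun _ => vecEnergy_nonneg _

namespace PowerMaterial

variable {X : Type*} [MeasurableSpace X] {μ : Measure X} {F : Type*}
    [NormedAddCommGroup F] [InnerProductSpace ℝ F] {s C κ : ℝ} {σ : X → ℝ≥0 → ℝ≥0∞}

theorem exponent_pos (h : PowerMaterial μ F s C κ σ) : 0 < s := zero_lt_one.trans h.one_lt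

theorem exponent_ne_zero (h : PowerMaterial μ F s C κ σ) : ENNReal.ofReal s ≠ 0 := by
  simpa using h.exponent_pos

theorem continuous_ae (h : PowerMaterial μ F s C κ σ) : ∀ᵐ x ∂μ, Continuous (σ x) :=
  h.law.mono fun _ hx => hx.cont

theorem matPower_smul (V W : X → F) (t : ℝ) :
    matPower μ σ V (t • W) = t * matPower μ σ V W := by
  simp only [matPower, Pi.smul_apply, inner_smul_right]
  exact integral_const_mul _ _

theorem integrable_norm_rpow (h : PowerMaterial μ F s C κ σ) {G : Type*} [NormedAddCommGroup G]
    {V : X → G} (hV : MemLp V (ENNReal.ofReal s) μ) : Integrable (fun x => ‖V x‖ ^ s) μ := by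
  have := hV.integrable_norm_rpow h.exponent_ne_zero ENNReal.ofReal_ne_top
  rwa [ENNReal.toReal_ofReal h.exponent_pos.le] at this

theorem aestronglyMeasurable_vecEnergy (h : PowerMaterial μ F s C κ σ) {V : X → F}
    (hV : AEStronglyMeasurable V μ) : AEStronglyMeasurable (fun x => vecEnergy (σ x) (V x)) μ :=
  (aemeasurable_lawEnergy h.meas h.continuous_ae hV).ennreal_toReal.aestronglyMeasurable

/-- By coercivity `|V| ^ s` is dominated by the energy density. In this way a trial function of
finite energy acquires the integrability of each phase. -/
theorem memLp_of_lintegral_ne_top (h : PowerMaterial μ F s C κ σ) {V : X → F}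
    (hV : AEStronglyMeasurable V μ) (hf : ∫⁻ x, lawEnergy (σ x) ‖V x‖₊ ∂μ ≠ ⊤) :
    MemLp V (ENNReal.ofReal s) μ := by
  rw [← integrable_norm_rpow_iff hV h.exponent_ne_zero ENNReal.ofReal_ne_top,
    ENNReal.toReal_ofReal h.exponent_pos.le]
  have h1 : Integrable (fun x => vecEnergy (σ x) (V x)) μ :=
    integrable_toReal_of_lintegral_ne_top (aemeasurable_lawEnergy h.meas h.continuous_ae hV) hf
  refine Integrable.mono' (h1.const_mul (2 ^ s * C))
    ((hV.norm.aemeasurable.pow_const s).aestronglyMeasurable) ?_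
  filter_upwards [h.law] with x hx
  rw [Real.norm_of_nonneg (by positivity)]
  exact hx.rpow_le_vecEnergy _

theorem aestronglyMeasurable_vecFlux (h : PowerMaterial μ F s C κ σ) {V : X → F}
    (hV : AEStronglyMeasurable V μ) : AEStronglyMeasurable (fun x => vecFlux (σ x) (V x)) μ :=
  _root_.aestronglyMeasurable_vecFlux h.meas h.continuous_ae hV

variable [IsFiniteMeasure μ]

theorem integrable_vecEnergy (h : PowerMaterial μ F s C κ σ) {V : X → F}
    (hV : MemLp V (ENNReal.ofReal s) μ) : Integrable (fun x => vecEnergy (σ x) (V x)) μ := by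
  refine Integrable.mono' (((integrable_const 1).add (h.integrable_norm_rpow hV)).const_mul (2 * C))
    (h.aestronglyMeasurable_vecEnergy hV.1) ?_
  filter_upwards [h.law] with x hx
  rw [Real.norm_of_nonneg (vecEnergy_nonneg _)]
  exact hx.vecEnergy_le _

theorem lintegral_lawEnergy (h : PowerMaterial μ F s C κ σ) {V : X → F}
    (hV : MemLp V (ENNReal.ofReal s) μ) :
    ∫⁻ x, lawEnergy (σ x) ‖V x‖₊ ∂μ = ENNReal.ofReal (matEnergy μ σ V) := by
  rw [matEnergy, ofReal_integral_eq_lintegral_ofReal (h.integrable_vecEnergy hV)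
    (Filter.Eventually.of_forall fun x => vecEnergy_nonneg _)]
  refine lintegral_congr_ae ?_
  filter_upwards [h.law] with x hx
  rw [vecEnergy, ENNReal.ofReal_toReal (hx.lawEnergy_ne_top _)]

/-- The flux is bounded by `1 + |V| ^ (s - 1)`, and `|V| ^ (s - 1)` lies in the dual space `L^(s /
(s - 1))`; the measure being finite, so does the constant. -/
theorem memLp_vecFlux (h : PowerMaterial μ F s C κ σ) {V : X → F}
    (hV : MemLp V (ENNReal.ofReal s) μ) :
    MemLp (fun x => vecFlux (σ x) (V x)) (ENNReal.ofReal s.conjExponent) μ := by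
  have h1 := hV.norm_rpow_div (ENNReal.ofReal (s - 1))
  have hs := h.one_lt
  rw [ENNReal.toReal_ofReal (by linarith), ← ENNReal.ofReal_div_of_pos (by linarith)] at h1
  refine MemLp.of_le_mul (c := C) ((memLp_const (1 : ℝ)).add h1)
    (h.aestronglyMeasurable_vecFlux hV.1) ?_
  filter_upwards [h.law] with x hx
  rw [Pi.add_apply, Real.norm_of_nonneg (by positivity)]
  exact hx.norm_vecFlux_le _

theorem eLpNorm_inner_vecFlux_le (h : PowerMaterial μ F s C κ σ) {V W : X → F}
    (hV : MemLp V (ENNReal.ofReal s) μ) (hW : MemLp W (ENNReal.ofReal s) μ) :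
    eLpNorm (fun x => inner ℝ (vecFlux (σ x) (V x)) (W x)) 1 μ ≤
      eLpNorm (fun x => vecFlux (σ x) (V x)) (ENNReal.ofReal s.conjExponent) μ *
        eLpNorm W (ENNReal.ofReal s) μ := by
  have := (Real.HolderConjugate.conjExponent h.one_lt).symm.ennrealOfReal
  have h1 := eLpNorm_le_eLpNorm_mul_eLpNorm_of_nnnorm (p := ENNReal.ofReal s.conjExponent)
    (q := ENNReal.ofReal s) (r := 1) (h.memLp_vecFlux hV).1 hW.1 (fun a b => inner ℝ a b) 1
    (Filter.Eventually.of_forall fun x => by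
      rw [one_mul]; exact nnnorm_inner_le_nnnorm _ _)
  simpa using h1

theorem integrable_inner_vecFlux (h : PowerMaterial μ F s C κ σ) {V W : X → F}
    (hV : MemLp V (ENNReal.ofReal s) μ) (hW : MemLp W (ENNReal.ofReal s) μ) :
    Integrable (fun x => inner ℝ (vecFlux (σ x) (V x)) (W x)) μ := by
  rw [← memLp_one_iff_integrable]
  refine ⟨(h.memLp_vecFlux hV).1.inner hW.1, (h.eLpNorm_inner_vecFlux_le hV hW).trans_lt ?_⟩
  exact ENNReal.mul_lt_top (h.memLp_vecFlux hV).2 hW.2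

theorem abs_matPower_le (h : PowerMaterial μ F s C κ σ) {V W : X → F}
    (hV : MemLp V (ENNReal.ofReal s) μ) (hW : MemLp W (ENNReal.ofReal s) μ) :
    |matPower μ σ V W| ≤
      (eLpNorm (fun x => vecFlux (σ x) (V x)) (ENNReal.ofReal s.conjExponent) μ).toReal *
        (eLpNorm W (ENNReal.ofReal s) μ).toReal := by
  have h1 := h.integrable_inner_vecFlux hV hW
  rw [matPower, ← Real.norm_eq_abs, ← ENNReal.toReal_mul]
  refine (norm_integral_le_integral_norm _).trans ?_
  rw [integral_norm_eq_lintegral_enorm h1.1, ← eLpNorm_one_eq_lintegral_enorm]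
  exact ENNReal.toReal_mono (ENNReal.mul_lt_top (h.memLp_vecFlux hV).2 hW.2).ne
    (h.eLpNorm_inner_vecFlux_le hV hW)

theorem matPower_add (h : PowerMaterial μ F s C κ σ) {V W₁ W₂ : X → F}
    (hV : MemLp V (ENNReal.ofReal s) μ) (h₁ : MemLp W₁ (ENNReal.ofReal s) μ)
    (h₂ : MemLp W₂ (ENNReal.ofReal s) μ) :
    matPower μ σ V (W₁ + W₂) = matPower μ σ V W₁ + matPower μ σ V W₂ := by
  simp only [matPower, Pi.add_apply, inner_add_right]
  exact integral_add (h.integrable_inner_vecFlux hV h₁) (h.integrable_inner_vecFlux hV h₂)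

theorem matPower_sub_le (h : PowerMaterial μ F s C κ σ) {V W : X → F}
    (hV : MemLp V (ENNReal.ofReal s) μ) (hW : MemLp W (ENNReal.ofReal s) μ) :
    matPower μ σ V (W - V) ≤ matEnergy μ σ W - matEnergy μ σ V := by
  rw [matEnergy, matEnergy, ← integral_sub (h.integrable_vecEnergy hW) (h.integrable_vecEnergy hV)]
  refine integral_mono_ae (h.integrable_inner_vecFlux hV (hW.sub hV))
    ((h.integrable_vecEnergy hW).sub (h.integrable_vecEnergy hV)) ?_
  filter_upwards [h.law] with x hx
  exact hx.inner_vecFlux_le _ _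

/-- The integrated form of uniform convexity. Along fields of bounded energy, a vanishing midpoint
gap forces the distance in `L^s` to vanish, because `δ` is arbitrary. -/
theorem exists_integral_norm_sub_le (h : PowerMaterial μ F s C κ σ) {δ : ℝ} (hδ : 0 < δ) :
    ∃ K : ℝ, 0 < K ∧ ∀ V W : X → F, MemLp V (ENNReal.ofReal s) μ → MemLp W (ENNReal.ofReal s) μ →
      ∫ x, ‖V x - W x‖ ^ s ∂μ ≤ δ * (μ.real univ + matEnergy μ σ V + matEnergy μ σ W) +
        K * (matEnergy μ σ V + matEnergy μ σ W - 2 * matEnergy μ σ ((1 / 2 : ℝ) • (V + W))) := by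
  obtain ⟨K, hK, hb⟩ := exists_rpow_norm_sub_le (F := F) C h.one_lt h.mono_pos h.pos hδ
  refine ⟨K, hK, fun V W hV hW => ?_⟩
  have iV := h.integrable_vecEnergy hV
  have iW := h.integrable_vecEnergy hW
  have iM := h.integrable_vecEnergy ((hV.add hW).const_smul (1 / 2 : ℝ))
  have i1 : Integrable (fun x => δ * (1 + vecEnergy (σ x) (V x) + vecEnergy (σ x) (W x))) μ :=
    (((integrable_const (1 : ℝ)).add iV).add iW).const_mul δ
  have i2 : Integrable (fun x => K * (vecEnergy (σ x) (V x) + vecEnergy (σ x) (W x) -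
      2 * vecEnergy (σ x) ((1 / 2 : ℝ) • (V x + W x)))) μ :=
    ((iV.add iW).sub (iM.const_mul 2)).const_mul K
  have h1 : ∫ x, ‖V x - W x‖ ^ s ∂μ ≤ _ :=
    integral_mono_ae (h.integrable_norm_rpow (hV.sub hW)) (i1.add i2) (by
      filter_upwards [h.law, h.mono] with x hx hm
      exact hb _ hx hm _ _)
  refine h1.trans_eq ?_
  have e1 : ∫ x, (vecEnergy (σ x) (V x) + vecEnergy (σ x) (W x) -
      2 * vecEnergy (σ x) ((1 / 2 : ℝ) • (V x + W x))) ∂μ =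
      matEnergy μ σ V + matEnergy μ σ W - 2 * matEnergy μ σ ((1 / 2 : ℝ) • (V + W)) := by
    refine (integral_sub (iV.add iW) (iM.const_mul 2)).trans ?_
    rw [integral_const_mul]
    exact congrArg (· - _) (integral_add iV iW)
  have e2 : ∫ x, (1 + vecEnergy (σ x) (V x) + vecEnergy (σ x) (W x)) ∂μ =
      μ.real univ + matEnergy μ σ V + matEnergy μ σ W := by
    refine (integral_add ((integrable_const (1 : ℝ)).add iV) iW).trans ?_
    refine congrArg (· + _) ((integral_add (integrable_const (1 : ℝ)) iV).trans ?_)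
    simp [matEnergy]
  simp only [Pi.add_apply]
  rw [integral_add i1 i2, integral_const_mul, integral_const_mul, e1, e2]

/-- Dominated convergence: for `|ε| ≤ 1` the growth bound at `|V| + |W|` majorizes the integrand.
This is the only continuity of the flux used in the Euler–Lagrange equation and in the derivative of
the energy. -/
theorem tendsto_matPower (h : PowerMaterial μ F s C κ σ) {V W : X → F}
    (hV : MemLp V (ENNReal.ofReal s) μ) (hW : MemLp W (ENNReal.ofReal s) μ) :
    Filter.Tendsto (fun ε : ℝ => matPower μ σ (V + ε • W) W) (nhds 0) (nhds (matPower μ σ V W)) := by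
  have hs := h.one_lt
  refine tendsto_integral_filter_of_dominated_convergence
    (fun x => C * (1 + 2 * ‖‖V x‖ + ‖W x‖‖ ^ s)) ?_ ?_ ?_ ?_
  · refine Filter.Eventually.of_forall fun ε => ?_
    exact (h.aestronglyMeasurable_vecFlux (hV.add (hW.const_smul ε)).1).inner hW.1
  · filter_upwards [Metric.ball_mem_nhds (0 : ℝ) one_pos] with ε hε
    filter_upwards [h.law] with x hx
    have hε : |ε| ≤ 1 := by simpa using (Metric.mem_ball.1 hε).le
    have h1 : ‖V x + ε • W x‖ ≤ ‖V x‖ + ‖W x‖ := by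
      refine (norm_add_le _ _).trans ?_
      rw [norm_smul, Real.norm_eq_abs]
      have := mul_le_mul_of_nonneg_right hε (norm_nonneg (W x))
      linarith
    rw [Real.norm_of_nonneg (by positivity : 0 ≤ ‖V x‖ + ‖W x‖)]
    set t := ‖V x‖ + ‖W x‖ with ht
    have htn : 0 ≤ t := by positivity
    have h2 : ‖vecFlux (σ x) (V x + ε • W x)‖ ≤ C * (1 + t ^ (s - 1)) := by
      refine (hx.norm_vecFlux_le _).trans ?_
      have := h.pos
      gcongr
    have hWt : ‖W x‖ ≤ t := by rw [ht]; linarith [norm_nonneg (V x)]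
    have h3 : ‖inner ℝ (vecFlux (σ x) (V x + ε • W x)) (W x)‖ ≤ C * (1 + t ^ (s - 1)) * t := by
      refine (norm_inner_le_norm _ _).trans ?_
      have := h.pos
      gcongr
    refine h3.trans ?_
    have h4 : (1 + t ^ (s - 1)) * t ≤ 1 + 2 * t ^ s := by
      rcases htn.eq_or_lt with h0 | h0
      · rw [← h0]; simp [h.exponent_pos.ne']
      have e : t ^ (s - 1) * t = t ^ s := by rw [← Real.rpow_add_one h0.ne']; ring_nf
      have h5 : t ≤ 1 + t ^ s := by
        rcases le_total t 1 with h6 | h6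
        · have : 0 ≤ t ^ s := by positivity
          linarith
        · have := Real.rpow_le_rpow_of_exponent_le h6 hs.le
          rw [Real.rpow_one] at this
          linarith
      rw [add_mul, e]; linarith
    rw [mul_assoc]
    exact mul_le_mul_of_nonneg_left h4 h.pos.le
  · exact ((integrable_const (1 : ℝ)).add
      ((h.integrable_norm_rpow (hV.norm.add hW.norm)).const_mul 2)).const_mul C
  · filter_upwards [h.law] with x hx
    have h1 : Continuous fun ε : ℝ => inner ℝ (vecFlux (σ x) (V x + ε • W x)) (W x) :=
      (hx.continuous_vecFlux.comp (by fun_prop)).inner continuous_const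
    simpa using h1.tendsto 0

end PowerMaterial

/-! ### Power laws from the growth and monotonicity assumptions. -/

/-- On the ray through a unit vector `e`, the vector flux is the scalar flux times `e`, so
monotonicity in space restricts to monotonicity in the field strength. -/
theorem StronglyMonotoneLaw.monotone_scalarFlux {F : Type*} [NormedAddCommGroup F]
    [InnerProductSpace ℝ F] [Nontrivial F] {s κ : ℝ} {a : ℝ≥0 → ℝ≥0∞} (hκ : 0 < κ)
    (h : StronglyMonotoneLaw F s κ a) : Monotone (scalarFlux a) := by
  obtain ⟨e, he⟩ := exists_norm_eq F zero_le_one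
  have hn : ∀ E : ℝ≥0, ‖(E : ℝ) • e‖₊ = E := fun E => by
    ext; simp [norm_smul, he]
  have hv : ∀ E : ℝ, vecFlux a ((E.toNNReal : ℝ) • e) = scalarFlux a E • e := fun E => by
    rw [vecFlux, hn, scalarFlux, smul_smul]
  intro E₁ E₂ hE
  have hE' : (E₁.toNNReal : ℝ) ≤ E₂.toNNReal := by exact_mod_cast Real.toNNReal_le_toNNReal hE
  have h1 := h ((E₁.toNNReal : ℝ) • e) ((E₂.toNNReal : ℝ) • e)
  have h2 : 0 ≤ inner ℝ (vecFlux a ((E₂.toNNReal : ℝ) • e) - vecFlux a ((E₁.toNNReal : ℝ) • e))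
      ((E₂.toNNReal : ℝ) • e - (E₁.toNNReal : ℝ) • e) := by
    refine le_trans ?_ h1
    split_ifs <;> positivity
  rw [hv, hv, ← sub_smul, ← sub_smul, inner_smul_left, inner_smul_right,
    real_inner_self_eq_norm_sq, he] at h2
  rcases hE'.eq_or_lt with h3 | h3
  · have : E₁.toNNReal = E₂.toNNReal := by exact_mod_cast h3
    rw [scalarFlux, scalarFlux, this]
  · simp only [conj_trivial, one_pow, mul_one] at h2
    nlinarith

/-- The growth bounds in terms of the scalar flux. -/
theorem powerLaw_of_growth {s : ℝ} (hs : 1 < s) {lo hi E₀ : ℝ≥0} (hlo : 0 < lo) (hle : lo ≤ hi)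
    (hE₀ : 0 < E₀) {a : ℝ≥0 → ℝ≥0∞} (hc : Continuous a) (hm : Monotone (scalarFlux a))
    (h₁ : ∀ E : ℝ≥0, 0 < E → (lo : ℝ≥0∞) * ((E / E₀ : ℝ≥0) : ℝ≥0∞) ^ (s - 2) ≤ a E)
    (h₂ : 2 ≤ s → ∀ E : ℝ≥0, 0 < E →
      a E ≤ (hi : ℝ≥0∞) * (1 + ((E / E₀ : ℝ≥0) : ℝ≥0∞) ^ (s - 2)))
    (h₃ : ¬ 2 ≤ s → ∀ E : ℝ≥0, 0 < E → a E ≤ (hi : ℝ≥0∞) * ((E / E₀ : ℝ≥0) : ℝ≥0∞) ^ (s - 2)) :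
    PowerLaw s ((E₀ : ℝ) ^ (s - 2) / lo + hi * (1 + 1 / (E₀ : ℝ) ^ (s - 2))) a := by
  have hhi : 0 < hi := hlo.trans_le hle
  have hE₀' : (0 : ℝ) < E₀ := hE₀
  have hlo' : (0 : ℝ) < lo := hlo
  have hhi' : (0 : ℝ) < hi := hhi
  set R : ℝ := (E₀ : ℝ) ^ (s - 2) with hR
  have hRpos : 0 < R := by positivity
  have hpow : ∀ E : ℝ≥0, 0 < E →
      ((E / E₀ : ℝ≥0) : ℝ≥0∞) ^ (s - 2) = (((E / E₀) ^ (s - 2) : ℝ≥0) : ℝ≥0∞) := fun E hE =>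
    (ENNReal.coe_rpow_of_ne_zero (div_pos hE hE₀).ne' _).symm
  have hpowr : ∀ E : ℝ≥0, 0 < E →
      (((E / E₀) ^ (s - 2) : ℝ≥0) : ℝ) * E = (E : ℝ) ^ (s - 1) / R := fun E hE => by
    have hE' : (0 : ℝ) < E := hE
    rw [NNReal.coe_rpow, NNReal.coe_div, Real.div_rpow hE'.le hE₀'.le, ← hR, div_mul_eq_mul_div,
      ← Real.rpow_add_one hE'.ne']
    congr 2; ring
  have hsf : ∀ E : ℝ≥0, scalarFlux a E = (a E).toReal * E := fun E => by
    rw [scalarFlux, Real.toNNReal_coe]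
  -- For `s < 2` the bound is weakened by the summand `1`, so that a single estimate covers both
  -- ranges.
  have up : ∀ E : ℝ≥0, 0 < E → a E ≤ ((hi * (1 + (E / E₀) ^ (s - 2)) : ℝ≥0) : ℝ≥0∞) := by
    intro E hE
    by_cases h2 : 2 ≤ s
    · have := h₂ h2 E hE
      rw [hpow E hE] at this
      exact_mod_cast this
    · refine (h₃ h2 E hE).trans ?_
      rw [hpow E hE]
      norm_cast
      gcongr
      exact le_add_self
  have hnt : ∀ E : ℝ≥0, 0 < E → a E ≠ ⊤ := fun E hE => ne_top_of_le_ne_top ENNReal.coe_ne_top (up E hE)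
  have up0 : ∀ E : ℝ≥0, 0 < E → scalarFlux a E ≤ hi * E + hi * ((E : ℝ) ^ (s - 1) / R) := by
    intro E hE
    have h := ENNReal.toReal_mono ENNReal.coe_ne_top (up E hE)
    rw [ENNReal.coe_toReal] at h
    push_cast at h
    rw [hsf, ← hpowr E hE]
    have := mul_le_mul_of_nonneg_right h E.2
    refine this.trans_eq ?_
    push_cast
    simp only [NNReal.val_eq_coe]
    ring
  -- The constant is a sum: `R / lo` serves the lower bound, and `hi * (1 + 1 / R)` both upper
  -- bounds.
  refine ⟨hs, by positivity, hc, hnt, fun E hE => ?_, fun E hE => ?_, fun E hE => ?_, hm⟩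
  · have h := h₁ E hE
    rw [hpow E hE] at h
    have h := ENNReal.toReal_mono (hnt E hE) h
    rw [ENNReal.toReal_mul, ENNReal.coe_toReal, ENNReal.coe_toReal] at h
    have h := mul_le_mul_of_nonneg_right h E.2
    simp only [NNReal.val_eq_coe] at h
    rw [mul_assoc, hpowr E hE, ← hsf] at h
    have h0 := PowerLaw.scalarFlux_nonneg (a := a) E
    have h4 : (E : ℝ) ^ (s - 1) = R / lo * (lo * ((E : ℝ) ^ (s - 1) / R)) := by
      field_simp
    rw [h4, add_mul]
    have h5 : 0 ≤ hi * (1 + 1 / R) * scalarFlux a E := by positivity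
    have h6 := mul_le_mul_of_nonneg_left h (by positivity : 0 ≤ R / lo)
    linarith
  · have hX : 0 ≤ (E : ℝ) ^ (s - 1) := by positivity
    have hE' : (0 : ℝ) < E := hE
    have key : scalarFlux a E ≤ hi * (1 + 1 / R) * (1 + (E : ℝ) ^ (s - 1)) := by
      by_cases h2 : 2 ≤ s
      · refine (up0 E hE).trans ?_
        have h5 : (E : ℝ) ≤ 1 + (E : ℝ) ^ (s - 1) := by
          rcases le_total (E : ℝ) 1 with h6 | h6
          · linarith
          · have := Real.rpow_le_rpow_of_exponent_le h6 (by linarith : 1 ≤ s - 1)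
            rw [Real.rpow_one] at this
            linarith
        have h6 : 0 ≤ 1 / R := by positivity
        have h7 := mul_le_mul_of_nonneg_left h5 hhi'.le
        have h8 : hi * ((E : ℝ) ^ (s - 1) / R) = hi * (1 / R) * (E : ℝ) ^ (s - 1) := by ring
        have h9 : 0 ≤ hi * (1 / R) := by positivity
        rw [h8]
        nlinarith
      -- For `s < 2` the linear term of `up0` is not controlled by `1 + E ^ (s - 1)` at large
      -- fields, so the sharp growth bound is used again.
      · have h := h₃ h2 E hE
        rw [hpow E hE] at h
        have h := ENNReal.toReal_mono (by finiteness) h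
        rw [ENNReal.toReal_mul, ENNReal.coe_toReal, ENNReal.coe_toReal] at h
        have h := mul_le_mul_of_nonneg_right h E.2
        simp only [NNReal.val_eq_coe] at h
        rw [mul_assoc, hpowr E hE, ← hsf] at h
        refine h.trans ?_
        have h8 : hi * ((E : ℝ) ^ (s - 1) / R) = hi * (1 / R) * (E : ℝ) ^ (s - 1) := by ring
        have h9 : 0 ≤ hi * (1 / R) := by positivity
        rw [h8]
        nlinarith [mul_nonneg hhi'.le hX]
    refine key.trans ?_
    gcongr
    exact le_add_of_nonneg_left (by positivity)
  · have hX : 0 ≤ (E : ℝ) ^ (s - 1) := by positivity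
    have hE' : (0 : ℝ) < E := hE
    refine (up0 E hE).trans ?_
    have h8 : hi * ((E : ℝ) ^ (s - 1) / R) = hi * (1 / R) * (E : ℝ) ^ (s - 1) := by ring
    have h9 : 0 ≤ hi * (1 / R) := by positivity
    have h10 : 0 ≤ R / lo := by positivity
    rw [h8]
    have a1 := mul_nonneg h10 hX
    have a2 := mul_nonneg h10 hE'.le
    have a3 := mul_nonneg hhi'.le hX
    have a4 := mul_nonneg h9 hE'.le
    nlinarith

theorem exists_powerMaterial {n : ℕ} (hn : 0 < n) {s : ℝ} (hs : 1 < s)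
    {U : Set (EuclideanSpace ℝ (Fin n))} {σ : EuclideanSpace ℝ (Fin n) → ℝ≥0 → ℝ≥0∞}
    (h₁ : IsCaratheodoryOn U σ) (h₂ : HasGrowth s U σ) (h₃ : IsStronglyMonotone s U σ) :
    ∃ C κ : ℝ, PowerMaterial (volume.restrict U) (EuclideanSpace ℝ (Fin n)) s C κ σ := by
  obtain ⟨lo, hi, E₀, hlo, hle, hE₀, hg⟩ := h₂
  obtain ⟨κ, hκ, hm⟩ := h₃
  have : Nonempty (Fin n) := ⟨⟨0, hn⟩⟩
  have hlaw : ∀ᵐ x ∂(volume.restrict U), PowerLaw s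
      ((E₀ : ℝ) ^ (s - 2) / lo + hi * (1 + 1 / (E₀ : ℝ) ^ (s - 2))) (σ x) := by
    filter_upwards [hg, hm, h₁.2] with x hgx hmx hcx
    have hmx : StronglyMonotoneLaw (EuclideanSpace ℝ (Fin n)) s κ (σ x) := hmx
    refine powerLaw_of_growth hs hlo hle hE₀ hcx (hmx.monotone_scalarFlux hκ)
      (fun E hE => (hgx E hE).1) (fun h2 E hE => ?_) (fun h2 E hE => ?_)
    · have := (hgx E hE).2
      rwa [if_pos h2] at this
    · have := (hgx E hE).2
      rwa [if_neg h2] at this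
  refine ⟨_, κ, hs, ?_, hκ, h₁.1, hlaw, hm⟩
  have : (0 : ℝ) < E₀ := hE₀
  have : (0 : ℝ) < lo := hlo
  positivity

/-- Euclidean space. -/
abbrev Euc (n : ℕ) := EuclideanSpace ℝ (Fin n)

/-! ### Calculus of gradients and weak gradients. -/

section Gradient

variable {n : ℕ}

theorem continuous_gradient {η : Euc n → ℝ} {k : WithTop ℕ∞} (h : ContDiff ℝ k η) (hk : k ≠ 0) :
    Continuous (gradient η) :=
  (InnerProductSpace.toDual ℝ (Euc n)).symm.continuous.comp (h.continuous_fderiv hk)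

theorem hasCompactSupport_gradient {η : Euc n → ℝ} (h : HasCompactSupport η) :
    HasCompactSupport (gradient η) :=
  (h.fderiv ℝ).comp_left (g := (InnerProductSpace.toDual ℝ (Euc n)).symm) (map_zero _)

theorem tsupport_gradient_subset (η : Euc n → ℝ) : tsupport (gradient η) ⊆ tsupport η := by
  refine (closure_mono ?_).trans (tsupport_fderiv_subset ℝ (f := η))
  intro x hx
  contrapose! hx
  rw [Function.notMem_support] at hx ⊢
  simp [gradient, hx]

theorem gradient_mul {χ η : Euc n → ℝ} {x : Euc n} (h₁ : DifferentiableAt ℝ χ x)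
    (h₂ : DifferentiableAt ℝ η x) :
    gradient (χ * η) x = χ x • gradient η x + η x • gradient χ x := by
  simp only [gradient]
  rw [fderiv_mul h₁ h₂, map_add, map_smul, map_smul]

theorem gradient_sub {χ η : Euc n → ℝ} {x : Euc n} (h₁ : DifferentiableAt ℝ χ x)
    (h₂ : DifferentiableAt ℝ η x) :
    gradient (χ - η) x = gradient χ x - gradient η x := by
  simp only [gradient]
  rw [fderiv_sub h₁ h₂, map_sub]

theorem gradient_add {χ η : Euc n → ℝ} {x : Euc n} (h₁ : DifferentiableAt ℝ χ x)
    (h₂ : DifferentiableAt ℝ η x) :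
    gradient (χ + η) x = gradient χ x + gradient η x := by
  simp only [gradient]
  rw [fderiv_add h₁ h₂, map_add]

theorem gradient_const_smul (t : ℝ) {η : Euc n → ℝ} {x : Euc n}
    (h : DifferentiableAt ℝ η x) : gradient (t • η) x = t • gradient η x := by
  simp only [gradient]
  rw [fderiv_const_smul h, map_smul]

end Gradient

section LocalIntegrability

variable {n : ℕ} {U : Set (Euc n)}

theorem MeasureTheory.LocallyIntegrableOn.integrable_smul {G : Type*} [NormedAddCommGroup G]
    [NormedSpace ℝ G] {f : Euc n → G} (hf : LocallyIntegrableOn f U) {φ : Euc n → ℝ}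
    (hφ : Continuous φ) (hc : HasCompactSupport φ) (hs : tsupport φ ⊆ U) :
    Integrable (fun x => φ x • f x) := by
  have h := (hf.integrableOn_compact_subset hs hc).continuousOn_smul hφ.continuousOn hc
  refine (integrableOn_iff_integrable_of_support_subset ?_).1 h
  exact (Function.support_smul_subset_left _ _).trans (subset_tsupport _)

theorem MeasureTheory.LocallyIntegrableOn.integrable_smul_right {G : Type*} [NormedAddCommGroup G]
    [NormedSpace ℝ G] {f : Euc n → ℝ} (hf : LocallyIntegrableOn f U) {φ : Euc n → G}
    (hφ : Continuous φ) (hc : HasCompactSupport φ) (hs : tsupport φ ⊆ U) :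
    Integrable (fun x => f x • φ x) := by
  have h := (hf.integrableOn_compact_subset hs hc).smul_continuousOn hφ.continuousOn hc
  refine (integrableOn_iff_integrable_of_support_subset ?_).1 h
  exact (Function.support_smul_subset_right _ _).trans (subset_tsupport _)

theorem MeasureTheory.MemLp.locallyIntegrableOn {G : Type*} [NormedAddCommGroup G] {f : Euc n → G}
    {r : ℝ≥0∞} (hf : MemLp f r (volume.restrict U)) (hr : 1 ≤ r) :
    LocallyIntegrableOn f U :=
  locallyIntegrableOn_of_locallyIntegrable_restrict (hf.locallyIntegrable hr)

/-- Both sides of the weak identity only see the support of the test function. With integrals over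
the whole space, restriction to smaller sets and linear operations become immediate. -/
theorem setIntegral_smul_gradient (u : Euc n → ℝ) {η : Euc n → ℝ} (hs : tsupport η ⊆ U) :
    ∫ x in U, u x • gradient η x = ∫ x, u x • gradient η x := by
  refine setIntegral_eq_integral_of_forall_compl_eq_zero fun x hx => ?_
  have : gradient η x = 0 :=
    image_eq_zero_of_notMem_tsupport fun h => hx (hs (tsupport_gradient_subset η h))
  rw [this, smul_zero]

theorem setIntegral_test_smul {G : Type*} [NormedAddCommGroup G] [NormedSpace ℝ G]
    (V : Euc n → G) {η : Euc n → ℝ} (hs : tsupport η ⊆ U) :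
    ∫ x in U, η x • V x = ∫ x, η x • V x := by
  refine setIntegral_eq_integral_of_forall_compl_eq_zero fun x hx => ?_
  rw [image_eq_zero_of_notMem_tsupport fun h => hx (hs h), zero_smul]

end LocalIntegrability

namespace IsWeakGrad

variable {n : ℕ} {U : Set (Euc n)} {u u₁ u₂ : Euc n → ℝ} {V V₁ V₂ : Euc n → Euc n}

theorem integral_smul_gradient (h : IsWeakGrad U u V) {η : Euc n → ℝ} (h₁ : ContDiff ℝ ∞ η)
    (h₂ : HasCompactSupport η) (h₃ : tsupport η ⊆ U) :
    ∫ x, u x • gradient η x = -∫ x, η x • V x := by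
  rw [← setIntegral_smul_gradient u h₃, ← setIntegral_test_smul V h₃, h.integral_eq η h₁ h₂ h₃]

theorem of_integral (h₁ : LocallyIntegrableOn u U) (h₂ : LocallyIntegrableOn V U)
    (h : ∀ η : Euc n → ℝ, ContDiff ℝ ∞ η → HasCompactSupport η → tsupport η ⊆ U →
      ∫ x, u x • gradient η x = -∫ x, η x • V x) : IsWeakGrad U u V := by
  refine ⟨h₁, h₂, fun η a b c => ?_⟩
  rw [setIntegral_smul_gradient u c, setIntegral_test_smul V c, h η a b c]

theorem mono (h : IsWeakGrad U u V) {U' : Set (Euc n)} (hU : U' ⊆ U) : IsWeakGrad U' u V :=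
  of_integral (h.1.mono_set hU) (h.2.mono_set hU) fun _ a b c =>
    h.integral_smul_gradient a b (c.trans hU)

/-- The fundamental lemma of the calculus of variations, applied to the difference of the two
gradients. -/
theorem unique (hU : IsOpen U) (h₁ : IsWeakGrad U u V₁) (h₂ : IsWeakGrad U u V₂) :
    V₁ =ᵐ[volume.restrict U] V₂ := by
  have h := hU.ae_eq_zero_of_integral_contDiff_smul_eq_zero (f := V₁ - V₂) (μ := volume)
    (h₁.2.sub h₂.2) (fun η a b c => by
      have e₁ := h₁.integral_smul_gradient a b c
      have e₂ := h₂.integral_smul_gradient a b c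
      simp only [Pi.sub_apply, smul_sub]
      rw [integral_sub (h₁.2.integrable_smul a.continuous b c)
        (h₂.2.integrable_smul a.continuous b c), sub_eq_zero]
      exact neg_injective (e₁.symm.trans e₂))
  rw [Filter.EventuallyEq, ae_restrict_iff' hU.measurableSet]
  filter_upwards [h] with x hx hxU
  exact sub_eq_zero.1 (hx hxU)

theorem congr (h : IsWeakGrad U u₁ V₁) (hu : u₁ =ᵐ[volume.restrict U] u₂)
    (hV : V₁ =ᵐ[volume.restrict U] V₂) : IsWeakGrad U u₂ V₂ := by
  refine ⟨h.1.congr hu, h.2.congr hV, fun η a b c => ?_⟩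
  have e := h.integral_eq η a b c
  have e₁ : ∫ x in U, u₁ x • gradient η x = ∫ x in U, u₂ x • gradient η x :=
    integral_congr_ae (by filter_upwards [hu] with x hx; rw [hx])
  have e₂ : ∫ x in U, η x • V₁ x = ∫ x in U, η x • V₂ x :=
    integral_congr_ae (by filter_upwards [hV] with x hx; rw [hx])
  rw [← e₁, ← e₂, e]

theorem add (h₁ : IsWeakGrad U u₁ V₁) (h₂ : IsWeakGrad U u₂ V₂) :
    IsWeakGrad U (u₁ + u₂) (V₁ + V₂) := by
  refine of_integral (h₁.1.add h₂.1) (h₁.2.add h₂.2) fun η a b c => ?_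
  simp only [Pi.add_apply, add_smul, smul_add]
  have hg := continuous_gradient a (by simp)
  have hgc := hasCompactSupport_gradient b
  have hgs := (tsupport_gradient_subset η).trans c
  rw [integral_add (h₁.1.integrable_smul_right hg hgc hgs) (h₂.1.integrable_smul_right hg hgc hgs),
    integral_add (h₁.2.integrable_smul a.continuous b c) (h₂.2.integrable_smul a.continuous b c),
    h₁.integral_smul_gradient a b c, h₂.integral_smul_gradient a b c, neg_add]

theorem const_smul (h : IsWeakGrad U u V) (t : ℝ) : IsWeakGrad U (t • u) (t • V) := by
  refine of_integral (h.1.smul t) (h.2.smul t) fun η a b c => ?_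
  simp only [Pi.smul_apply, smul_assoc, smul_comm (_ : ℝ) t]
  rw [integral_smul, integral_smul, h.integral_smul_gradient a b c, smul_neg]

theorem sub (h₁ : IsWeakGrad U u₁ V₁) (h₂ : IsWeakGrad U u₂ V₂) :
    IsWeakGrad U (u₁ - u₂) (V₁ - V₂) := by
  have := h₁.add (h₂.const_smul (-1))
  simpa [sub_eq_add_neg] using this

theorem zero : IsWeakGrad U (0 : Euc n → ℝ) 0 :=
  of_integral locallyIntegrableOn_zero locallyIntegrableOn_zero fun _ _ _ _ => by simp

/-- The product with a smooth function. -/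
theorem mul_smooth (hU : IsOpen U) (h : IsWeakGrad U u V) {χ : Euc n → ℝ} (hχ : ContDiff ℝ ∞ χ) :
    IsWeakGrad U (χ * u) (fun x => χ x • V x + u x • gradient χ x) := by
  have hχg := continuous_gradient hχ (by simp)
  have i₁ : LocallyIntegrableOn (χ * u) U :=
    h.1.continuousOn_smul hU.isLocallyClosed hχ.continuous.continuousOn
  have i₂ : LocallyIntegrableOn (fun x => χ x • V x) U :=
    h.2.continuousOn_smul hU.isLocallyClosed hχ.continuous.continuousOn
  have i₃ : LocallyIntegrableOn (fun x => u x • gradient χ x) U :=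
    h.1.smul_continuousOn hU.isLocallyClosed hχg.continuousOn
  refine of_integral i₁ (i₂.add i₃) fun η a b c => ?_
  have hηg := continuous_gradient a (by simp)
  have hgc := hasCompactSupport_gradient b
  have hgs := (tsupport_gradient_subset η).trans c
  have c' : tsupport (χ * η) ⊆ U :=
    (closure_mono (Function.support_mul_subset_right _ _)).trans c
  -- Tested with `χ * η`, the product rule gives the claimed identity up to the term `η u ∇χ`, which
  -- is moved to the other side.
  have e := h.integral_smul_gradient (hχ.mul a) b.mul_left c'
  have e₁ : ∀ x, u x • gradient (χ * η) x =
      (χ * u) x • gradient η x + η x • (u x • gradient χ x) := fun x => by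
    rw [gradient_mul (hχ.differentiable (by simp) x) (a.differentiable (by simp) x), smul_add,
      smul_smul, smul_comm (u x) (η x), Pi.mul_apply, mul_comm]
  change ∫ x, u x • gradient (χ * η) x = _ at e
  simp_rw [e₁] at e
  rw [integral_add (i₁.integrable_smul_right hηg hgc hgs) (i₃.integrable_smul a.continuous b c)] at e
  simp_rw [smul_add]
  rw [integral_add (i₂.integrable_smul a.continuous b c) (i₃.integrable_smul a.continuous b c)]
  have e₂ : ∫ x, (χ * η) x • V x = ∫ x, η x • χ x • V x := by
    refine integral_congr_ae (Filter.Eventually.of_forall fun x => ?_)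
    simp only [Pi.mul_apply, smul_smul, mul_comm]
  change _ = -∫ x, (χ * η) x • V x at e
  rw [e₂] at e
  rw [neg_add, ← e]
  abel

end IsWeakGrad

/-- Compactly supported `C¹` functions are weakly differentiable. -/
theorem isWeakGrad_of_contDiff {n : ℕ} (U : Set (Euc n)) {η : Euc n → ℝ} (h : ContDiff ℝ 1 η) :
    IsWeakGrad U η (gradient η) := by
  have hg := continuous_gradient h (by simp)
  refine .of_integral (h.continuous.locallyIntegrable.locallyIntegrableOn U)
    (hg.locallyIntegrable.locallyIntegrableOn U) fun θ a b _ => ?_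
  have hθg := continuous_gradient a (by simp)
  have i₁ : Integrable fun x => η x • gradient θ x :=
    (h.continuous.smul hθg).integrable_of_hasCompactSupport (hasCompactSupport_gradient b).smul_left
  have i₂ : Integrable fun x => θ x • gradient η x :=
    (a.continuous.smul hg).integrable_of_hasCompactSupport b.smul_right
  -- Tested against each direction `v`, the claim is classical integration by parts for directional
  -- derivatives.
  refine ext_inner_left ℝ fun v => ?_
  rw [inner_neg_right, ← integral_inner i₁, ← integral_inner i₂]
  have hd : Continuous fun x => fderiv ℝ η x v :=
    (h.continuous_fderiv (by simp)).clm_apply continuous_const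
  have hd' : Continuous fun x => fderiv ℝ θ x v :=
    (a.continuous_fderiv (by simp)).clm_apply continuous_const
  have hc' : HasCompactSupport fun x => fderiv ℝ θ x v :=
    (b.fderiv ℝ).comp_left (g := fun L : Euc n →L[ℝ] ℝ => L v) rfl
  have := integral_mul_fderiv_eq_neg_fderiv_mul_of_integrable (μ := (volume : Measure (Euc n)))
    (f := η) (g := θ) (v := v)
    ((hd.mul a.continuous).integrable_of_hasCompactSupport b.mul_left)
    ((h.continuous.mul hd').integrable_of_hasCompactSupport hc'.mul_left)
    ((h.continuous.mul a.continuous).integrable_of_hasCompactSupport b.mul_left)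
    (fun x _ => h.differentiable (by simp) x) (fun x _ => a.differentiable (by simp) x)
  simpa [inner_smul_right, mul_comm] using this

/-! ### Limits in `L^p`: pairings and completeness. -/

section Limits

variable {X : Type*} [MeasurableSpace X] {μ : Measure X}

/-- Continuity of the integral pairing of `L^p` and `L^q`, scalar times vector. -/
theorem tendsto_integral_smul {G : Type*} [NormedAddCommGroup G] [NormedSpace ℝ G]
    {p q : ℝ≥0∞} [hpq : p.HolderConjugate q] {f : ℕ → X → ℝ} {f₀ : X → ℝ} {g : X → G}
    (hf : ∀ k, MemLp (f k) p μ) (hf₀ : MemLp f₀ p μ) (hg : MemLp g q μ)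
    (h : Filter.Tendsto (fun k => eLpNorm (f k - f₀) p μ) Filter.atTop (nhds 0)) :
    Filter.Tendsto (fun k => ∫ x, f k x • g x ∂μ) Filter.atTop (nhds (∫ x, f₀ x • g x ∂μ)) := by
  have hi : ∀ {f : X → ℝ}, MemLp f p μ → Integrable (fun x => f x • g x) μ := fun hf =>
    memLp_one_iff_integrable.1 (hg.smul (r := 1) hf)
  refine tendsto_integral_of_L1' _ (hi hf₀).1 (Filter.Eventually.of_forall fun k => hi (hf k)) ?_
  refine tendsto_of_tendsto_of_tendsto_of_le_of_le tendsto_const_nhds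
    (h := fun k => eLpNorm (f k - f₀) p μ * eLpNorm g q μ) ?_ (fun _ => zero_le) fun k => ?_
  · have := ENNReal.Tendsto.mul_const h (Or.inr hg.2.ne)
    rwa [zero_mul] at this
  · have e : (fun x => f k x • g x) - (fun x => f₀ x • g x) = (f k - f₀) • g := by
      ext x; simp [sub_smul]
    change eLpNorm ((fun x => f k x • g x) - (fun x => f₀ x • g x)) 1 μ ≤ _
    rw [e]
    exact eLpNorm_smul_le_mul_eLpNorm hg.1 ((hf k).sub hf₀).1

/-- Continuity of the integral pairing of `L^p` and `L^q`, vector times scalar. -/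
theorem tendsto_integral_smul' {G : Type*} [NormedAddCommGroup G] [NormedSpace ℝ G]
    {p q : ℝ≥0∞} [hpq : p.HolderConjugate q] {f : ℕ → X → G} {f₀ : X → G} {g : X → ℝ}
    (hf : ∀ k, MemLp (f k) p μ) (hf₀ : MemLp f₀ p μ) (hg : MemLp g q μ)
    (h : Filter.Tendsto (fun k => eLpNorm (f k - f₀) p μ) Filter.atTop (nhds 0)) :
    Filter.Tendsto (fun k => ∫ x, g x • f k x ∂μ) Filter.atTop (nhds (∫ x, g x • f₀ x ∂μ)) := by
  have : q.HolderConjugate p := hpq.symm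
  have hi : ∀ {f : X → G}, MemLp f p μ → Integrable (fun x => g x • f x) μ := fun hf =>
    memLp_one_iff_integrable.1 (hf.smul (r := 1) hg)
  refine tendsto_integral_of_L1' _ (hi hf₀).1 (Filter.Eventually.of_forall fun k => hi (hf k)) ?_
  refine tendsto_of_tendsto_of_tendsto_of_le_of_le tendsto_const_nhds
    (h := fun k => eLpNorm g q μ * eLpNorm (f k - f₀) p μ) ?_ (fun _ => zero_le) fun k => ?_
  · have := ENNReal.Tendsto.const_mul h (Or.inr hg.2.ne)
    rwa [mul_zero] at this
  · have e : (fun x => g x • f k x) - (fun x => g x • f₀ x) = g • (f k - f₀) := by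
      ext x; simp [smul_sub]
    change eLpNorm ((fun x => g x • f k x) - (fun x => g x • f₀ x)) 1 μ ≤ _
    rw [e]
    exact eLpNorm_smul_le_mul_eLpNorm ((hf k).sub hf₀).1 hg.1

theorem exists_eLpNorm_tendsto {G : Type*} [NormedAddCommGroup G] [CompleteSpace G] {p : ℝ≥0∞}
    (hp : 1 ≤ p) {f : ℕ → X → G} (hf : ∀ k, MemLp (f k) p μ)
    (hc : Filter.Tendsto (fun z : ℕ × ℕ => eLpNorm (f z.1 - f z.2) p μ) Filter.atTop (nhds 0)) :
    ∃ f₀, MemLp f₀ p μ ∧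
      Filter.Tendsto (fun k => eLpNorm (f k - f₀) p μ) Filter.atTop (nhds 0) := by
  have : Fact (1 ≤ p) := ⟨hp⟩
  have h1 : CauchySeq fun k => (hf k).toLp (f k) := by
    rw [Lp.cauchySeq_Lp_iff_cauchySeq_eLpNorm]
    refine hc.congr fun z => eLpNorm_congr_ae ?_
    exact ((hf z.1).coeFn_toLp.sub (hf z.2).coeFn_toLp).symm
  obtain ⟨F, hF⟩ := cauchySeq_tendsto_of_complete h1
  refine ⟨F, Lp.memLp F, ?_⟩
  rw [Lp.tendsto_Lp_iff_tendsto_eLpNorm'] at hF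
  refine hF.congr fun k => eLpNorm_congr_ae ?_
  exact (hf k).coeFn_toLp.sub .rfl

end Limits

/-! ### The spaces `W` and `W_0`. -/

section Sobolev

variable {n : ℕ} {U : Set (Euc n)}

/-- Weak gradients are stable under `L^s` convergence. -/
theorem IsWeakGrad.of_tendsto {s : ℝ} (hs : 1 < s) {u : ℕ → Euc n → ℝ}
    {V : ℕ → Euc n → Euc n} {u₀ : Euc n → ℝ} {V₀ : Euc n → Euc n}
    (h : ∀ k, IsWeakGrad U (u k) (V k))
    (hu : ∀ k, MemLp (u k) (ENNReal.ofReal s) (volume.restrict U))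
    (hV : ∀ k, MemLp (V k) (ENNReal.ofReal s) (volume.restrict U))
    (hu₀ : MemLp u₀ (ENNReal.ofReal s) (volume.restrict U))
    (hV₀ : MemLp V₀ (ENNReal.ofReal s) (volume.restrict U))
    (htu : Filter.Tendsto (fun k => eLpNorm (u k - u₀) (ENNReal.ofReal s) (volume.restrict U))
      Filter.atTop (nhds 0))
    (htV : Filter.Tendsto (fun k => eLpNorm (V k - V₀) (ENNReal.ofReal s) (volume.restrict U))
      Filter.atTop (nhds 0)) : IsWeakGrad U u₀ V₀ := by
  have hs' : 1 ≤ ENNReal.ofReal s := by simpa using hs.le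
  have := (Real.HolderConjugate.conjExponent hs).ennrealOfReal
  refine ⟨hu₀.locallyIntegrableOn hs', hV₀.locallyIntegrableOn hs', fun η a b c => ?_⟩
  have hg := continuous_gradient a (by simp)
  have hgc := hasCompactSupport_gradient b
  have t₁ := tendsto_integral_smul (q := ENNReal.ofReal s.conjExponent) hu hu₀
    (hg.memLp_of_hasCompactSupport hgc) htu
  have t₂ := tendsto_integral_smul' (q := ENNReal.ofReal s.conjExponent) hV hV₀
    (a.continuous.memLp_of_hasCompactSupport b) htV
  -- Both sides of the weak identity converge by Hölder's inequality, since test functions and their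
  -- gradients lie in the dual space.
  refine tendsto_nhds_unique t₁ (t₂.neg.congr fun k => ?_)
  rw [(h k).integral_eq η a b c]

theorem isWeakGrad_weakGrad {u : Euc n → ℝ} (h : ∃ V, IsWeakGrad U u V) :
    IsWeakGrad U u (weakGrad U u) := by
  rw [weakGrad, dif_pos h]
  exact h.choose_spec

theorem IsWeakGrad.weakGrad_ae_eq (hU : IsOpen U) {u : Euc n → ℝ} {V : Euc n → Euc n}
    (h : IsWeakGrad U u V) : weakGrad U u =ᵐ[volume.restrict U] V :=
  (isWeakGrad_weakGrad ⟨V, h⟩).unique hU h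

theorem weakGrad_mono_ae_eq {U' : Set (Euc n)} (hU' : IsOpen U') (hs : U' ⊆ U) {u : Euc n → ℝ}
    (h : ∃ V, IsWeakGrad U u V) : weakGrad U' u =ᵐ[volume.restrict U'] weakGrad U u :=
  ((isWeakGrad_weakGrad h).mono hs).weakGrad_ae_eq hU'

namespace MemW

variable {s : ℝ} {u v : Euc n → ℝ}

theorem isWeakGrad (h : MemW s U u) : IsWeakGrad U u (weakGrad U u) :=
  isWeakGrad_weakGrad (h.2.imp fun _ hV => hV.1)

theorem memLp_weakGrad (hU : IsOpen U) (h : MemW s U u) :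
    MemLp (weakGrad U u) (ENNReal.ofReal s) (volume.restrict U) := by
  obtain ⟨V, hV, hVs⟩ := h.2
  exact hVs.ae_eq (hV.weakGrad_ae_eq hU).symm

theorem weakGrad_add (hU : IsOpen U) (hu : MemW s U u) (hv : MemW s U v) :
    weakGrad U (u + v) =ᵐ[volume.restrict U] weakGrad U u + weakGrad U v :=
  (hu.isWeakGrad.add hv.isWeakGrad).weakGrad_ae_eq hU

theorem weakGrad_sub (hU : IsOpen U) (hu : MemW s U u) (hv : MemW s U v) :
    weakGrad U (u - v) =ᵐ[volume.restrict U] weakGrad U u - weakGrad U v :=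
  (hu.isWeakGrad.sub hv.isWeakGrad).weakGrad_ae_eq hU

theorem weakGrad_smul (hU : IsOpen U) (hu : MemW s U u) (t : ℝ) :
    weakGrad U (t • u) =ᵐ[volume.restrict U] t • weakGrad U u :=
  (hu.isWeakGrad.const_smul t).weakGrad_ae_eq hU

theorem add (hU : IsOpen U) (hu : MemW s U u) (hv : MemW s U v) : MemW s U (u + v) :=
  ⟨hu.1.add hv.1, _, hu.isWeakGrad.add hv.isWeakGrad,
    (hu.memLp_weakGrad hU).add (hv.memLp_weakGrad hU)⟩

theorem sub (hU : IsOpen U) (hu : MemW s U u) (hv : MemW s U v) : MemW s U (u - v) :=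
  ⟨hu.1.sub hv.1, _, hu.isWeakGrad.sub hv.isWeakGrad,
    (hu.memLp_weakGrad hU).sub (hv.memLp_weakGrad hU)⟩

theorem smul (hU : IsOpen U) (hu : MemW s U u) (t : ℝ) : MemW s U (t • u) :=
  ⟨hu.1.const_smul t, _, hu.isWeakGrad.const_smul t, (hu.memLp_weakGrad hU).const_smul t⟩

theorem zero : MemW s U (0 : Euc n → ℝ) := ⟨MemLp.zero, 0, IsWeakGrad.zero, MemLp.zero⟩

theorem mono {U' : Set (Euc n)} (hU : IsOpen U) (hs : U' ⊆ U) (h : MemW s U u) : MemW s U' u :=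
  ⟨h.1.mono_measure (Measure.restrict_mono hs le_rfl), _, h.isWeakGrad.mono hs,
    (h.memLp_weakGrad hU).mono_measure (Measure.restrict_mono hs le_rfl)⟩

theorem congr (hU : IsOpen U) (hu : MemW s U u) (h : u =ᵐ[volume.restrict U] v) : MemW s U v :=
  ⟨hu.1.ae_eq h, _, hu.isWeakGrad.congr h .rfl, hu.memLp_weakGrad hU⟩

theorem mono_exponent (hU : IsOpen U) (hfin : volume U ≠ ⊤) {r : ℝ} (hr : r ≤ s)
    (h : MemW s U u) : MemW r U u := by
  have : IsFiniteMeasure (volume.restrict U) := ⟨by simpa using hfin.lt_top⟩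
  exact ⟨h.1.mono_exponent (ENNReal.ofReal_le_ofReal hr), _, h.isWeakGrad,
    (h.memLp_weakGrad hU).mono_exponent (ENNReal.ofReal_le_ofReal hr)⟩

end MemW

theorem MemW.of_contDiff (s : ℝ) {η : Euc n → ℝ} (h : ContDiff ℝ 1 η) (hc : HasCompactSupport η) :
    MemW s U η :=
  ⟨h.continuous.memLp_of_hasCompactSupport hc, _, isWeakGrad_of_contDiff U h,
    (continuous_gradient h (by simp)).memLp_of_hasCompactSupport (hasCompactSupport_gradient hc)⟩

namespace MemW0

variable {s : ℝ} {u v : Euc n → ℝ}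

theorem of_contDiff (hU : IsOpen U) (s : ℝ) {η : Euc n → ℝ} (h : ContDiff ℝ 1 η)
    (hc : HasCompactSupport η) (hs : tsupport η ⊆ U) : MemW0 s U η := by
  refine ⟨.of_contDiff s h hc, fun δ _ => ⟨η, h, hc, hs, by simp, ?_⟩⟩
  have : weakGrad U η - gradient η =ᵐ[volume.restrict U] 0 := by
    filter_upwards [(isWeakGrad_of_contDiff U h).weakGrad_ae_eq hU] with x hx
    simp [hx]
  rw [eLpNorm_congr_ae this]
  simp

theorem zero (hU : IsOpen U) (s : ℝ) : MemW0 s U (0 : Euc n → ℝ) :=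
  of_contDiff hU s contDiff_const HasCompactSupport.zero (by simp [tsupport])

/-- `W_0` is closed in `W`. -/
theorem of_approx (hU : IsOpen U) (hs : 1 ≤ s) (hu : MemW s U u)
    (h : ∀ δ : ℝ≥0∞, 0 < δ → ∃ w, MemW0 s U w ∧
      eLpNorm (u - w) (ENNReal.ofReal s) (volume.restrict U) ≤ δ ∧
      eLpNorm (weakGrad U u - weakGrad U w) (ENNReal.ofReal s) (volume.restrict U) ≤ δ) :
    MemW0 s U u := by
  have hs' : 1 ≤ ENNReal.ofReal s := by simpa using hs
  refine ⟨hu, fun δ hδ => ?_⟩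
  have hδ2 : 0 < δ / 2 := ENNReal.half_pos hδ.ne'
  obtain ⟨w, hw, h₁, h₂⟩ := h _ hδ2
  obtain ⟨η, a, b, c, h₃, h₄⟩ := hw.2 _ hδ2
  have hη : MemW s U η := .of_contDiff s a b
  refine ⟨η, a, b, c, ?_, ?_⟩
  · have e : u - η = (u - w) + (w - η) := by abel
    rw [e, ← ENNReal.add_halves δ]
    exact (eLpNorm_add_le (hu.1.sub hw.1.1).1 (hw.1.1.sub hη.1).1 hs').trans (add_le_add h₁ h₃)
  · have e : weakGrad U u - gradient η =
        (weakGrad U u - weakGrad U w) + (weakGrad U w - gradient η) := by abel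
    rw [e, ← ENNReal.add_halves δ]
    exact (eLpNorm_add_le ((hu.memLp_weakGrad hU).sub (hw.1.memLp_weakGrad hU)).1
      ((hw.1.memLp_weakGrad hU).1.sub (continuous_gradient a (by simp)).aestronglyMeasurable)
      hs').trans (add_le_add h₂ h₄)

theorem add (hU : IsOpen U) (hs : 1 ≤ s) (hu : MemW0 s U u) (hv : MemW0 s U v) :
    MemW0 s U (u + v) := by
  have hs' : 1 ≤ ENNReal.ofReal s := by simpa using hs
  refine ⟨hu.1.add hU hv.1, fun δ hδ => ?_⟩
  have hδ2 : 0 < δ / 2 := ENNReal.half_pos hδ.ne'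
  obtain ⟨η, a, b, c, h₁, h₂⟩ := hu.2 _ hδ2
  obtain ⟨θ, a', b', c', h₃, h₄⟩ := hv.2 _ hδ2
  refine ⟨η + θ, a.add a', b.add b', ?_, ?_, ?_⟩
  · exact (tsupport_add η θ).trans (union_subset c c')
  · have e : u + v - (η + θ) = (u - η) + (v - θ) := by abel
    rw [e, ← ENNReal.add_halves δ]
    exact (eLpNorm_add_le (hu.1.1.1.sub a.continuous.aestronglyMeasurable)
      (hv.1.1.1.sub a'.continuous.aestronglyMeasurable) hs').trans (add_le_add h₁ h₃)
  · have e : weakGrad U (u + v) - gradient (η + θ) =ᵐ[volume.restrict U]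
        (weakGrad U u - gradient η) + (weakGrad U v - gradient θ) := by
      filter_upwards [hu.1.weakGrad_add hU hv.1] with x hx
      simp only [Pi.sub_apply, Pi.add_apply] at hx ⊢
      rw [hx, gradient_add (a.differentiable (by simp) x) (a'.differentiable (by simp) x)]
      abel
    rw [eLpNorm_congr_ae e, ← ENNReal.add_halves δ]
    exact (eLpNorm_add_le
      ((hu.1.memLp_weakGrad hU).1.sub (continuous_gradient a (by simp)).aestronglyMeasurable)
      ((hv.1.memLp_weakGrad hU).1.sub (continuous_gradient a' (by simp)).aestronglyMeasurable)
      hs').trans (add_le_add h₂ h₄)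

theorem smul (hU : IsOpen U) (hu : MemW0 s U u) (t : ℝ) : MemW0 s U (t • u) := by
  refine ⟨hu.1.smul hU t, fun δ hδ => ?_⟩
  -- The summand `1` admits `t = 0`.
  have hδ2 : 0 < δ / (‖t‖ₑ + 1) := ENNReal.div_pos hδ.ne' (by finiteness)
  have hle : ‖t‖ₑ * (δ / (‖t‖ₑ + 1)) ≤ δ := by
    calc ‖t‖ₑ * (δ / (‖t‖ₑ + 1)) ≤ (‖t‖ₑ + 1) * (δ / (‖t‖ₑ + 1)) := by gcongr; exact le_self_add
      _ ≤ δ := ENNReal.mul_div_le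
  obtain ⟨η, a, b, c, h₁, h₂⟩ := hu.2 _ hδ2
  refine ⟨t • η, a.const_smul t, b.smul_left (f := fun _ => t), ?_, ?_, ?_⟩
  · exact (closure_mono (Function.support_const_smul_subset t η)).trans c
  · rw [← smul_sub, eLpNorm_const_smul]
    exact (mul_le_mul_right h₁ _).trans hle
  · have e : weakGrad U (t • u) - gradient (t • η) =ᵐ[volume.restrict U]
        t • (weakGrad U u - gradient η) := by
      filter_upwards [hu.1.weakGrad_smul hU t] with x hx
      simp only [Pi.sub_apply, Pi.smul_apply] at hx ⊢
      rw [hx, gradient_const_smul t (a.differentiable (by simp) x), smul_sub]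
    rw [eLpNorm_congr_ae e, eLpNorm_const_smul]
    exact (mul_le_mul_right h₂ _).trans hle

theorem sub (hU : IsOpen U) (hs : 1 ≤ s) (hu : MemW0 s U u) (hv : MemW0 s U v) :
    MemW0 s U (u - v) := by
  have := hu.add hU hs (hv.smul hU (-1))
  simpa [sub_eq_add_neg] using this

theorem congr (hU : IsOpen U) (hu : MemW0 s U u) (h : u =ᵐ[volume.restrict U] v) :
    MemW0 s U v := by
  have hv := hu.1.congr hU h
  have hg : weakGrad U v =ᵐ[volume.restrict U] weakGrad U u :=
    (hu.1.isWeakGrad.congr h .rfl).weakGrad_ae_eq hU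
  refine ⟨hv, fun δ hδ => ?_⟩
  obtain ⟨η, a, b, c, h₁, h₂⟩ := hu.2 δ hδ
  refine ⟨η, a, b, c, ?_, ?_⟩
  · rwa [eLpNorm_congr_ae (h.symm.sub .rfl)]
  · rwa [eLpNorm_congr_ae (hg.sub .rfl)]

theorem mono_exponent (hU : IsOpen U) (hfin : volume U ≠ ⊤) {r : ℝ} (hr1 : 1 ≤ r) (hr : r ≤ s)
    (h : MemW0 s U u) : MemW0 r U u := by
  have : IsFiniteMeasure (volume.restrict U) := ⟨by simpa using hfin.lt_top⟩
  refine ⟨h.1.mono_exponent hU hfin hr, fun δ hδ => ?_⟩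
  set M := (volume.restrict U) univ ^
    (1 / (ENNReal.ofReal r).toReal - 1 / (ENNReal.ofReal s).toReal) with hM
  have hMtop : M ≠ ⊤ := by
    refine ENNReal.rpow_ne_top_of_nonneg ?_ (measure_ne_top _ _)
    rw [ENNReal.toReal_ofReal (by linarith), ENNReal.toReal_ofReal (by linarith), sub_nonneg]
    exact one_div_le_one_div_of_le (by linarith) hr
  obtain ⟨η, a, b, c, h₁, h₂⟩ := h.2 (δ / (M + 1)) (ENNReal.div_pos hδ.ne' (by finiteness))
  have hle : δ / (M + 1) * M ≤ δ := by
    calc δ / (M + 1) * M ≤ δ / (M + 1) * (M + 1) := by gcongr; exact le_self_add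
      _ ≤ δ := by rw [mul_comm]; exact ENNReal.mul_div_le
  refine ⟨η, a, b, c, ?_, ?_⟩
  · exact (eLpNorm_le_eLpNorm_mul_rpow_measure_univ (ENNReal.ofReal_le_ofReal hr)
      (h.1.1.1.sub a.continuous.aestronglyMeasurable)).trans ((mul_le_mul_left h₁ _).trans hle)
  · exact (eLpNorm_le_eLpNorm_mul_rpow_measure_univ (ENNReal.ofReal_le_ofReal hr)
      ((h.1.memLp_weakGrad hU).1.sub
        (continuous_gradient a (by simp)).aestronglyMeasurable)).trans
          ((mul_le_mul_left h₂ _).trans hle)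

/-- Approximating functions supported in `U` are weakly differentiable on the whole space, and their
distances to the zero extensions are the distances measured in `U`. So the weak identity passes to
the limit without any regularity of `∂U`. -/
theorem isWeakGrad_indicator (hU : IsOpen U) (hs : 1 < s) (h : MemW0 s U u) :
    IsWeakGrad univ (U.indicator u) (U.indicator (weakGrad U u)) := by
  have key : ∀ {G : Type} [NormedAddCommGroup G] (f g : Euc n → G), Function.support g ⊆ U →
      eLpNorm (g - U.indicator f) (ENNReal.ofReal s) (volume.restrict univ) =
        eLpNorm (f - g) (ENNReal.ofReal s) (volume.restrict U) := by
    intro G _ f g hg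
    have e : g - U.indicator f = U.indicator (g - f) := by
      ext x
      by_cases hx : x ∈ U
      · simp [hx]
      · have : g x = 0 := by
          by_contra h0
          exact hx (hg h0)
        simp [hx, this]
    rw [Measure.restrict_univ, e, eLpNorm_indicator_eq_eLpNorm_restrict hU.measurableSet,
      eLpNorm_sub_comm]
  have hδ : ∀ k : ℕ, (0 : ℝ≥0∞) < ((k : ℝ≥0∞) + 1)⁻¹ := fun k => by
    rw [ENNReal.inv_pos]; finiteness
  choose η a b c h₁ h₂ using fun k : ℕ => h.2 _ (hδ k)
  have hlim : Filter.Tendsto (fun k : ℕ => ((k : ℝ≥0∞) + 1)⁻¹) Filter.atTop (nhds 0) := by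
    have := (Filter.tendsto_add_atTop_iff_nat 1).2 ENNReal.tendsto_inv_nat_nhds_zero
    simpa using this
  refine IsWeakGrad.of_tendsto hs (fun k => isWeakGrad_of_contDiff univ (a k))
    (fun k => (MemW.of_contDiff s (a k) (b k)).1)
    (fun k => (continuous_gradient (a k) (by simp)).memLp_of_hasCompactSupport
      (hasCompactSupport_gradient (b k))) ?_ ?_ ?_ ?_
  · rw [Measure.restrict_univ, memLp_indicator_iff_restrict hU.measurableSet]
    exact h.1.1
  · rw [Measure.restrict_univ, memLp_indicator_iff_restrict hU.measurableSet]
    exact h.1.memLp_weakGrad hU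
  · refine tendsto_of_tendsto_of_tendsto_of_le_of_le tendsto_const_nhds hlim (fun _ => zero_le)
      fun k => ?_
    dsimp only
    rw [key u (η k) ((subset_tsupport _).trans (c k))]
    exact h₁ k
  · refine tendsto_of_tendsto_of_tendsto_of_le_of_le tendsto_const_nhds hlim (fun _ => zero_le)
      fun k => ?_
    dsimp only
    rw [key (weakGrad U u) (gradient (η k))
      ((subset_tsupport _).trans ((tsupport_gradient_subset _).trans (c k)))]
    exact h₂ k

end MemW0

end Sobolev

/-! ### Averages, translations and mollification in `L^s`. -/

section Minkowski

variable {X T G : Type*} [MeasurableSpace X] [MeasurableSpace T] [NormedAddCommGroup G]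
  [NormedSpace ℝ G] {μ : Measure X} {ν : Measure T}

/-- Averages over a probability space do not increase the `L^s` norm. -/
theorem eLpNorm_integral_le [SFinite μ] [IsProbabilityMeasure ν] {s : ℝ} (hs : 1 ≤ s)
    {F : X → T → G} (hF : AEStronglyMeasurable (fun z : X × T => F z.1 z.2) (μ.prod ν)) {C : ℝ≥0∞}
    (hC : ∀ᵐ t ∂ν, eLpNorm (fun x => F x t) (ENNReal.ofReal s) μ ≤ C) :
    eLpNorm (fun x => ∫ t, F x t ∂ν) (ENNReal.ofReal s) μ ≤ C := by
  have hs0 : 0 < s := by linarith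
  have e0 : ENNReal.ofReal s ≠ 0 := by simpa using hs0
  have hr : (ENNReal.ofReal s).toReal = s := ENNReal.toReal_ofReal hs0.le
  -- Jensen's inequality, in the form that the `L^1` norm is at most the `L^s` norm on a probability
  -- space. Tonelli's theorem then exchanges the integrals.
  have hpt : ∀ᵐ x ∂μ, ‖∫ t, F x t ∂ν‖ₑ ^ s ≤ ∫⁻ t, ‖F x t‖ₑ ^ s ∂ν := by
    filter_upwards [hF.prodMk_left] with x hx
    have h1 := eLpNorm_le_eLpNorm_of_exponent_le (p := 1) (q := ENNReal.ofReal s)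
      (by simpa using hs) hx
    rw [eLpNorm_one_eq_lintegral_enorm,
      eLpNorm_eq_lintegral_rpow_enorm_toReal e0 ENNReal.ofReal_ne_top, hr] at h1
    refine (ENNReal.rpow_le_rpow ((enorm_integral_le_lintegral_enorm _).trans h1) hs0.le).trans_eq ?_
    rw [← ENNReal.rpow_mul, one_div, inv_mul_cancel₀ hs0.ne', ENNReal.rpow_one]
  rw [eLpNorm_eq_lintegral_rpow_enorm_toReal e0 ENNReal.ofReal_ne_top, hr, one_div,
    ENNReal.rpow_inv_le_iff hs0]
  refine (lintegral_mono_ae hpt).trans ?_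
  rw [lintegral_lintegral_swap (hF.enorm.pow_const s)]
  calc ∫⁻ t, ∫⁻ x, ‖F x t‖ₑ ^ s ∂μ ∂ν ≤ ∫⁻ _, C ^ s ∂ν := by
        refine lintegral_mono_ae ?_
        filter_upwards [hC] with t ht
        rwa [eLpNorm_eq_lintegral_rpow_enorm_toReal e0 ENNReal.ofReal_ne_top, hr, one_div,
          ENNReal.rpow_inv_le_iff hs0] at ht
    _ = C ^ s := by simp

end Minkowski

section Translation

variable {n : ℕ} {G : Type*} [NormedAddCommGroup G]

theorem eLpNorm_comp_sub_right {f : Euc n → G} (hf : AEStronglyMeasurable f) (p : ℝ≥0∞)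
    (t : Euc n) : eLpNorm (fun x => f (x - t)) p volume = eLpNorm f p volume :=
  eLpNorm_comp_measurePreserving (g := f) (f := fun x => x - t) hf
    (measurePreserving_sub_right volume t)

theorem MeasureTheory.LocallyIntegrable.comp_sub_left {f : Euc n → G} (hf : LocallyIntegrable f)
    (x : Euc n) : LocallyIntegrable fun y => f (x - y) := by
  have h := (locallyIntegrable_map_homeomorph (Homeomorph.subLeft x) (f := f)
    (μ := (volume : Measure (Euc n)))).1 (by
      have : Measure.map (Homeomorph.subLeft x) (volume : Measure (Euc n)) = volume :=
        (volume.measurePreserving_sub_left x).map_eq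
      rwa [this])
  exact h

variable [NormedSpace ℝ G]

/-- Continuity of translations in `L^p`. -/
theorem exists_eLpNorm_translate_sub_le {p : ℝ≥0∞} (hp : 1 ≤ p) (hp' : p ≠ ⊤) {f : Euc n → G}
    (hf : MemLp f p) {δ : ℝ≥0∞} (hδ : 0 < δ) :
    ∃ r : ℝ, 0 < r ∧ ∀ t : Euc n, ‖t‖ < r → eLpNorm (fun x => f (x - t) - f x) p volume ≤ δ := by
  wlog hδt : δ ≠ ⊤ generalizing δ
  · obtain ⟨r, hr, h⟩ := this one_pos (by simp)
    exact ⟨r, hr, fun t ht => (h t ht).trans (by rw [not_not.1 hδt]; exact le_top)⟩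
  have hδ4 : δ / 4 ≠ 0 := (ENNReal.div_pos hδ.ne' (by simp)).ne'
  -- The error `f - g` enters twice, translated and untranslated, with `δ / 4` each; uniform
  -- continuity of `g` accounts for the other `δ / 2`.
  obtain ⟨g, hgc, hfg, hg, hgp⟩ := hf.exists_hasCompactSupport_eLpNorm_sub_le hp' hδ4
  -- The unit thickening contains the supports of all translates by vectors shorter than `1`, so the
  -- sup bound is integrated over one set of finite measure.
  set K := Metric.cthickening 1 (tsupport g) with hK
  have hKc : IsCompact K := hgc.isCompact.cthickening
  have hKm : volume K ≠ ⊤ := hKc.measure_lt_top.ne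
  set M := volume K ^ p.toReal⁻¹ with hM
  have hMt : M ≠ ⊤ := ENNReal.rpow_ne_top_of_nonneg (by positivity) hKm
  have hb : 0 < δ / 2 / (M + 1) :=
    ENNReal.div_pos (ENNReal.half_pos hδ.ne').ne' (by finiteness)
  have hbt : δ / 2 / (M + 1) ≠ ⊤ :=
    ENNReal.div_ne_top (ENNReal.div_ne_top hδt (by simp)) (by simp)
  obtain ⟨r, hr, hu⟩ := Metric.uniformContinuous_iff.1 (hgc.uniformContinuous_of_continuous hg)
    (δ / 2 / (M + 1)).toReal (ENNReal.toReal_pos hb.ne' hbt)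
  refine ⟨min r 1, by positivity, fun t ht => ?_⟩
  have h1 : eLpNorm (fun x => g (x - t) - g x) p volume ≤ δ / 2 := by
    have hsupp : Function.support (fun x => g (x - t) - g x) ⊆ K := by
      intro x hx
      by_contra hxK
      have hx1 : x ∉ tsupport g := fun h => hxK (Metric.self_subset_cthickening _ h)
      have hx2 : x - t ∉ tsupport g := fun h => hxK (by
        refine Metric.mem_cthickening_of_dist_le x (x - t) 1 _ h ?_
        rw [dist_eq_norm, sub_sub_cancel]
        exact (ht.trans_le (min_le_right _ _)).le)
      exact hx (by simp [image_eq_zero_of_notMem_tsupport hx1, image_eq_zero_of_notMem_tsupport hx2])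
    rw [← eLpNorm_restrict_eq_of_support_subset hsupp]
    refine (eLpNorm_le_of_ae_bound (C := (δ / 2 / (M + 1)).toReal)
      (Filter.Eventually.of_forall fun x => ?_)).trans ?_
    · rw [← dist_eq_norm]
      refine (hu ?_).le
      rw [dist_eq_norm, sub_sub_cancel_left, norm_neg]
      exact ht.trans_le (min_le_left _ _)
    · rw [ENNReal.ofReal_toReal hbt, Measure.restrict_apply_univ, ← hM]
      calc M * (δ / 2 / (M + 1)) ≤ (M + 1) * (δ / 2 / (M + 1)) := by gcongr; exact le_self_add
        _ ≤ δ / 2 := ENNReal.mul_div_le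
  have e : (fun x => f (x - t) - f x) =
      (fun x => (f - g) (x - t)) + ((fun x => g (x - t) - g x) - (f - g)) := by
    ext x; simp only [Pi.add_apply, Pi.sub_apply]; abel
  have hfgm : AEStronglyMeasurable (f - g) volume := hf.1.sub hgp.1
  have hgm : AEStronglyMeasurable (fun x => g (x - t) - g x) volume :=
    ((hg.comp (continuous_id.sub continuous_const)).sub hg).aestronglyMeasurable
  have hfgt : AEStronglyMeasurable (fun x => (f - g) (x - t)) volume :=
    hfgm.comp_measurePreserving (measurePreserving_sub_right volume t)
  rw [e]
  refine (eLpNorm_add_le hfgt (hgm.sub hfgm) hp).trans ?_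
  rw [eLpNorm_comp_sub_right hfgm]
  calc _ ≤ δ / 4 + (δ / 2 + δ / 4) := by
        gcongr
        exact (eLpNorm_sub_le hgm hfgm hp).trans (add_le_add h1 hfg)
    _ = δ := by
        have : δ / 4 = δ / 2 / 2 := by
          rw [ENNReal.div_eq_inv_mul, ENNReal.div_eq_inv_mul, ENNReal.div_eq_inv_mul, ← mul_assoc,
            ← ENNReal.mul_inv (by simp) (by simp)]
          norm_num
        rw [this, add_comm, add_assoc, ENNReal.add_halves, ENNReal.add_halves]

end Translation

section Mollification

variable {n : ℕ} {G : Type*} [NormedAddCommGroup G] [NormedSpace ℝ G]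

/-- The average of a function with respect to a normalised bump function. -/
noncomputable def bumpAverage (φ : ContDiffBump (0 : Euc n)) (f : Euc n → G) (x : Euc n) : G :=
  ∫ t, φ.normed volume t • f (x - t)

theorem bumpAverage_congr (φ : ContDiffBump (0 : Euc n)) {f g : Euc n → G} (h : f =ᵐ[volume] g)
    (x : Euc n) : bumpAverage φ f x = bumpAverage φ g x := by
  refine integral_congr_ae ?_
  filter_upwards [(quasiMeasurePreserving_sub_left volume x).ae_eq_comp h] with t ht
  simp only [Function.comp_apply] at ht
  rw [ht]

/-- The probability measure of a normalised bump function. -/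
noncomputable def bumpMeasure (φ : ContDiffBump (0 : Euc n)) : Measure (Euc n) :=
  volume.withDensity fun t => ((φ.normed volume t).toNNReal : ℝ≥0∞)

theorem isProbabilityMeasure_bumpMeasure (φ : ContDiffBump (0 : Euc n)) :
    IsProbabilityMeasure (bumpMeasure φ) := by
  refine ⟨?_⟩
  rw [bumpMeasure, withDensity_apply _ MeasurableSet.univ, Measure.restrict_univ]
  change ∫⁻ t, ENNReal.ofReal (φ.normed volume t) = 1
  rw [← ofReal_integral_eq_lintegral_ofReal φ.integrable_normed
    (Filter.Eventually.of_forall fun t => φ.nonneg_normed t), φ.integral_normed, ENNReal.ofReal_one]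

theorem integral_bumpMeasure (φ : ContDiffBump (0 : Euc n)) (f : Euc n → G) :
    ∫ t, f t ∂(bumpMeasure φ) = ∫ t, φ.normed volume t • f t := by
  rw [bumpMeasure, integral_withDensity_eq_integral_smul
    (φ.continuous_normed.measurable.real_toNNReal)]
  refine integral_congr_ae (Filter.Eventually.of_forall fun t => ?_)
  simp only [NNReal.smul_def, Real.coe_toNNReal _ (φ.nonneg_normed t)]

theorem ae_bumpMeasure_norm_lt (φ : ContDiffBump (0 : Euc n)) :
    ∀ᵐ t ∂(bumpMeasure φ), ‖t‖ < φ.rOut := by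
  rw [bumpMeasure, ae_withDensity_iff
    (φ.continuous_normed.measurable.real_toNNReal.coe_nnreal_ennreal)]
  refine Filter.Eventually.of_forall fun t ht => ?_
  have : t ∈ Function.support (φ.normed volume) := fun h => ht (by simp [h])
  rw [φ.support_normed_eq] at this
  simpa using this

/-- Mollification converges in `L^s`. -/
theorem eLpNorm_bumpAverage_sub_le [CompleteSpace G] {s : ℝ} (hs : 1 ≤ s) {f : Euc n → G}
    (hf : MemLp f (ENNReal.ofReal s)) {δ : ℝ≥0∞} {r : ℝ}
    (h : ∀ t : Euc n, ‖t‖ < r → eLpNorm (fun x => f (x - t) - f x) (ENNReal.ofReal s) volume ≤ δ)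
    (φ : ContDiffBump (0 : Euc n)) (hφ : φ.rOut ≤ r) :
    eLpNorm (bumpAverage φ f - f) (ENNReal.ofReal s) volume ≤ δ := by
  have hs' : 1 ≤ ENNReal.ofReal s := by simpa using hs
  -- A strongly measurable representative makes `f (x - t)` measurable in both variables, as needed
  -- for averaging.
  wlog hfm : StronglyMeasurable f generalizing f
  · have hfae := hf.1.ae_eq_mk
    have e : bumpAverage φ f - f =ᵐ[volume] bumpAverage φ (hf.1.mk f) - hf.1.mk f := by
      filter_upwards [hfae] with x hx
      simp only [Pi.sub_apply]
      rw [bumpAverage_congr φ hfae, hx]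
    rw [eLpNorm_congr_ae e]
    refine this (hf.ae_eq hfae) (fun t ht => ?_) hf.1.stronglyMeasurable_mk
    refine le_of_eq_of_le (eLpNorm_congr_ae ?_) (h t ht)
    filter_upwards [hfae, (measurePreserving_sub_right volume t).quasiMeasurePreserving.ae_eq_comp
      hfae] with x h1 h2
    simp only [Function.comp_apply] at h2
    rw [← h1, ← h2]
  have := isProbabilityMeasure_bumpMeasure φ
  have hint : ∀ x, Integrable (fun t => f (x - t)) (bumpMeasure φ) := fun x => by
    rw [bumpMeasure, integrable_withDensity_iff_integrable_smul
      φ.continuous_normed.measurable.real_toNNReal]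
    have hloc : LocallyIntegrable (fun t => f (x - t)) volume :=
      (hf.locallyIntegrable hs').comp_sub_left x
    refine (hloc.integrable_smul_left_of_hasCompactSupport (φ.continuous_normed (μ := volume))
      φ.hasCompactSupport_normed).congr (Filter.Eventually.of_forall fun t => ?_)
    simp only [NNReal.smul_def, Real.coe_toNNReal _ (φ.nonneg_normed t)]
  have e : bumpAverage φ f - f = fun x => ∫ t, (f (x - t) - f x) ∂(bumpMeasure φ) := by
    ext x
    rw [integral_sub (hint x) (integrable_const _), integral_bumpMeasure]
    simp [bumpAverage]
  rw [e]
  refine eLpNorm_integral_le hs ?_ ?_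
  · have h1 : StronglyMeasurable fun z : Euc n × Euc n => f (z.1 - z.2) :=
      hfm.comp_measurable (measurable_fst.sub measurable_snd)
    have h2 : StronglyMeasurable fun z : Euc n × Euc n => f z.1 := hfm.comp_measurable measurable_fst
    exact (h1.sub h2).aestronglyMeasurable
  · filter_upwards [ae_bumpMeasure_norm_lt φ] with t ht
    exact h t (ht.trans_le hφ)

theorem contDiff_bumpAverage (φ : ContDiffBump (0 : Euc n)) {u : Euc n → ℝ}
    (hu : LocallyIntegrable u) : ContDiff ℝ 1 (bumpAverage φ u) :=
  φ.hasCompactSupport_normed.contDiff_convolution_left (ContinuousLinearMap.lsmul ℝ ℝ)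
    (n := 1) φ.contDiff_normed hu

/-- The reflected bump `y ↦ ρ (x - y)` is itself a test function on the whole space, so the
derivative of the convolution can be moved from the bump onto `u`. -/
theorem gradient_bumpAverage (φ : ContDiffBump (0 : Euc n)) {u : Euc n → ℝ}
    {V : Euc n → Euc n} (h : IsWeakGrad univ u V) (x : Euc n) :
    gradient (bumpAverage φ u) x = bumpAverage φ V x := by
  have hu : LocallyIntegrable u := locallyIntegrableOn_univ.1 h.1
  have hV : LocallyIntegrable V := locallyIntegrableOn_univ.1 h.2
  set ρ : Euc n → ℝ := φ.normed volume with hρ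
  have hρs : ContDiff ℝ ∞ ρ := φ.contDiff_normed
  have hρc : HasCompactSupport ρ := φ.hasCompactSupport_normed
  set η : Euc n → ℝ := fun y => ρ (x - y) with hη
  have hηs : ContDiff ℝ ∞ η := hρs.comp (contDiff_const.sub contDiff_id)
  have hηc : HasCompactSupport η := hρc.comp_homeomorph (Homeomorph.subLeft x)
  have hgrad : ∀ y, gradient η y = -gradient ρ (x - y) := fun y => by
    have h1 : HasFDerivAt (fun y : Euc n => x - y) (-ContinuousLinearMap.id ℝ (Euc n)) y := by
      simpa using (hasFDerivAt_id y).const_sub x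
    have h2 : HasFDerivAt η ((fderiv ℝ ρ (x - y)).comp (-ContinuousLinearMap.id ℝ (Euc n))) y :=
      (hρs.differentiable (by simp) (x - y)).hasFDerivAt.comp y h1
    rw [gradient, h2.fderiv, gradient, ← map_neg]
    congr 1
    ext v; simp
  have hw := h.integral_smul_gradient hηs hηc (subset_univ _)
  have e1 : bumpAverage φ V x = ∫ y, η y • V y := by
    rw [bumpAverage, ← integral_sub_left_eq_self (fun y => η y • V y) volume x]
    refine integral_congr_ae (Filter.Eventually.of_forall fun t => ?_)
    simp [hη, hρ]
  have e2 : ∫ y, u y • gradient η y = -∫ y, u (x - y) • gradient ρ y := by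
    rw [← integral_sub_left_eq_self (fun y => u y • gradient η y) volume x, ← integral_neg]
    refine integral_congr_ae (Filter.Eventually.of_forall fun t => ?_)
    simp [hgrad]
  have e3 : bumpAverage φ V x = ∫ y, u (x - y) • gradient ρ y := by
    rw [e1, ← neg_inj, ← hw, e2]
  rw [e3]
  have hd := hρc.hasFDerivAt_convolution_left (ContinuousLinearMap.lsmul ℝ ℝ)
    (hρs.of_le (by simp)) hu x
  have hd' : fderiv ℝ (bumpAverage φ u) x = _ := hd.fderiv
  refine ext_inner_left ℝ fun v => ?_
  have i₁ : Integrable fun y => u (x - y) • gradient ρ y :=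
    (hu.comp_sub_left x).integrable_smul_right_of_hasCompactSupport
      (continuous_gradient hρs (by simp)) (hasCompactSupport_gradient hρc)
  rw [← integral_inner i₁, inner_gradient_right, hd', convolution_def,
    ContinuousLinearMap.integral_apply]
  · simp only [conj_trivial]
    refine integral_congr_ae (Filter.Eventually.of_forall fun t => ?_)
    simp [inner_smul_right, ContinuousLinearMap.precompL_apply, mul_comm]
  · exact (hρc.fderiv ℝ).convolutionExists_left _ (hρs.continuous_fderiv (by simp)) hu x

end Mollification

/-! ### Sobolev functions of compact support lie in `W_0`. -/

section CompactSupport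

variable {n : ℕ} {U : Set (Euc n)}

theorem exists_smooth_cutoff {K : Set (Euc n)} (hK : IsCompact K) (hU : IsOpen U) (hKU : K ⊆ U) :
    ∃ θ : Euc n → ℝ, ContDiff ℝ ∞ θ ∧ HasCompactSupport θ ∧ tsupport θ ⊆ U ∧
      ∀ᶠ x in nhdsSet K, θ x = 1 := by
  obtain ⟨K', hK', hKK', hK'U⟩ := exists_compact_between hK hU hKU
  obtain ⟨θ, h1, h0, -⟩ := exists_contMDiffMap_one_nhds_of_subset_interior
    (modelWithCornersSelf ℝ (Euc n)) (n := ⊤) hK.isClosed hKK'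
  have hs : tsupport θ ⊆ K' := by
    refine closure_minimal (fun x hx => ?_) hK'.isClosed
    by_contra h
    exact hx (h0 x h)
  exact ⟨θ, θ.contMDiff.contDiff, hK'.of_isClosed_subset (isClosed_tsupport _) hs,
    hs.trans hK'U, h1⟩

/-- A Sobolev function with compact support in `U`, extended by zero. -/
theorem exists_isWeakGrad_univ_of_support_subset {s : ℝ} (hU : IsOpen U) {u : Euc n → ℝ}
    (hu : MemW s U u) {K : Set (Euc n)} (hK : IsCompact K) (hKU : K ⊆ U)
    (h0 : ∀ x, x ∉ K → u x = 0) :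
    ∃ W, IsWeakGrad univ u W ∧ MemLp W (ENNReal.ofReal s) ∧ W =ᵐ[volume.restrict U] weakGrad U u := by
  obtain ⟨θ, hθ, hθc, hθU, hθ1⟩ := exists_smooth_cutoff hK hU hKU
  have hθK : ∀ x ∈ K, θ x = 1 ∧ gradient θ x = 0 := fun x hx => by
    have h1 : θ =ᶠ[nhds x] fun _ => 1 := hθ1.filter_mono (nhds_le_nhdsSet hx)
    exact ⟨h1.eq_of_nhds, by rw [h1.gradient_eq, gradient_fun_const]⟩
  have hθg := continuous_gradient hθ (by simp)
  set V := weakGrad U u with hV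
  have hVw := hu.isWeakGrad
  have hVs := hu.memLp_weakGrad hU
  have hθV : MemLp (fun x => θ x • V x) (ENNReal.ofReal s) (volume.restrict U) := by
    obtain ⟨C, hC⟩ := hθc.exists_bound_of_continuous hθ.continuous
    refine MemLp.of_le_mul hVs (hθ.continuous.aestronglyMeasurable.smul hVs.1) (c := C) ?_
    refine Filter.Eventually.of_forall fun x => ?_
    rw [norm_smul]
    exact mul_le_mul_of_nonneg_right (hC x) (norm_nonneg _)
  have hind : U.indicator (fun x => θ x • V x) = fun x => θ x • V x := by
    refine indicator_eq_self.2 ?_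
    exact (Function.support_smul_subset_left _ _).trans ((subset_tsupport _).trans hθU)
  have hindu : U.indicator u = u := by
    refine indicator_eq_self.2 fun x hx => hKU ?_
    by_contra h
    exact hx (h0 x h)
  have hθu : ∀ x, θ x * u x = u x ∧ u x • gradient θ x = 0 := fun x => by
    by_cases hx : x ∈ K
    · rw [(hθK x hx).1, (hθK x hx).2]; simp
    · rw [h0 x hx]; simp
  have hlocu : LocallyIntegrable u := by
    have h1 : IntegrableOn u K := hu.isWeakGrad.1.integrableOn_compact_subset hKU hK
    refine ((integrableOn_iff_integrable_of_support_subset fun x hx => ?_).1 h1).locallyIntegrable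
    by_contra h
    exact hx (h0 x h)
  -- Replacing a test function `η` by `θ * η`, which is supported in `U`, changes nothing: `u`
  -- vanishes wherever `θ ≠ 1` or `∇θ ≠ 0`.
  refine ⟨fun x => θ x • V x, ?_, ?_, ?_⟩
  · refine .of_integral (hlocu.locallyIntegrableOn univ)
      ((hVw.2.integrable_smul hθ.continuous hθc hθU).locallyIntegrable.locallyIntegrableOn univ)
      fun η a b _ => ?_
    have c' : tsupport (θ * η) ⊆ U :=
      (closure_mono (Function.support_mul_subset_left _ _)).trans hθU
    have e := hVw.integral_smul_gradient (hθ.mul a) b.mul_left c'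
    have e1 : ∫ x, u x • gradient (θ * η) x = ∫ x, u x • gradient η x := by
      refine integral_congr_ae (Filter.Eventually.of_forall fun x => ?_)
      dsimp only
      rw [gradient_mul (hθ.differentiable (by simp) x) (a.differentiable (by simp) x), smul_add,
        smul_smul, smul_comm (u x) (η x), (hθu x).2, smul_zero, add_zero, mul_comm, (hθu x).1]
    have e2 : ∫ x, (θ * η) x • V x = ∫ x, η x • θ x • V x := by
      refine integral_congr_ae (Filter.Eventually.of_forall fun x => ?_)
      simp only [Pi.mul_apply, smul_smul, mul_comm]
    change ∫ x, u x • gradient (θ * η) x = -∫ x, (θ * η) x • V x at e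
    rw [← e1, e, e2]
  · rw [← hind, memLp_indicator_iff_restrict hU.measurableSet]
    exact hθV
  · have h1 := hVw.mul_smooth hU hθ
    have h2 : θ * u = u := funext fun x => (hθu x).1
    rw [h2] at h1
    filter_upwards [h1.weakGrad_ae_eq hU] with x hx
    rw [(hθu x).2, add_zero] at hx
    exact hx.symm

/-- Sobolev functions with compact support in `U` belong to `W_0`. -/
theorem MemW0.of_ae_eq_zero {s : ℝ} (hU : IsOpen U) (hs : 1 ≤ s) {u : Euc n → ℝ}
    (hu : MemW s U u) {K : Set (Euc n)} (hK : IsCompact K) (hKU : K ⊆ U)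
    (h0 : ∀ᵐ x ∂(volume.restrict (U \ K)), u x = 0) : MemW0 s U u := by
  have hs' : 1 ≤ ENNReal.ofReal s := by simpa using hs
  wlog hz : ∀ x, x ∉ K → u x = 0 generalizing u
  · have e : u =ᵐ[volume.restrict U] K.indicator u := by
      rw [ae_restrict_iff' (hU.measurableSet.diff hK.measurableSet)] at h0
      rw [Filter.EventuallyEq, ae_restrict_iff' hU.measurableSet]
      filter_upwards [h0] with x hx hxU
      by_cases hxK : x ∈ K
      · simp [hxK]
      · simp [hxK, hx ⟨hxU, hxK⟩]
    refine (this (hu.congr hU e) ?_ fun x hx => by simp [hx]).congr hU e.symm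
    rw [ae_restrict_iff' (hU.measurableSet.diff hK.measurableSet)]
    exact Filter.Eventually.of_forall fun x hx => by simp [hx.2]
  obtain ⟨W, hW, hWs, hWU⟩ := exists_isWeakGrad_univ_of_support_subset hU hu hK hKU hz
  have hus : MemLp u (ENNReal.ofReal s) := by
    have : U.indicator u = u := by
      refine indicator_eq_self.2 fun x hx => hKU ?_
      by_contra h
      exact hx (hz x h)
    rw [← this, memLp_indicator_iff_restrict hU.measurableSet]
    exact hu.1
  have hul : LocallyIntegrable u := hus.locallyIntegrable hs'
  refine ⟨hu, fun δ hδ => ?_⟩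
  -- The radius `r₀` keeps the mollified support inside `U`; `r₁` and `r₂` make the errors of the
  -- function and of its gradient small.
  obtain ⟨r₀, hr₀, hKr⟩ := hK.exists_cthickening_subset_open hU hKU
  obtain ⟨r₁, hr₁, h₁⟩ := exists_eLpNorm_translate_sub_le hs' ENNReal.ofReal_ne_top hus hδ
  obtain ⟨r₂, hr₂, h₂⟩ := exists_eLpNorm_translate_sub_le hs' ENNReal.ofReal_ne_top hWs hδ
  set r := min r₀ (min r₁ r₂) with hr
  have hrpos : 0 < r := by positivity
  let φ : ContDiffBump (0 : Euc n) := ⟨r / 2, r, by positivity, by linarith⟩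
  have hsupp : tsupport (bumpAverage φ u) ⊆ Metric.cthickening r₀ K := by
    refine closure_minimal (fun x hx => ?_) Metric.isClosed_cthickening
    by_contra hxK
    refine hx ?_
    rw [bumpAverage]
    refine integral_eq_zero_of_ae (Filter.Eventually.of_forall fun t => ?_)
    by_cases ht : t ∈ Function.support (φ.normed volume)
    · rw [φ.support_normed_eq] at ht
      have h3 : x - t ∉ K := fun h => hxK (by
        refine Metric.mem_cthickening_of_dist_le x (x - t) r₀ _ h ?_
        rw [dist_eq_norm, sub_sub_cancel]
        have : ‖t‖ < r := by simpa using ht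
        exact this.le.trans (min_le_left _ _))
      simp [hz _ h3]
    · rw [Function.notMem_support] at ht
      simp [ht]
  refine ⟨bumpAverage φ u, contDiff_bumpAverage φ hul,
    hK.cthickening.of_isClosed_subset (isClosed_tsupport _) hsupp, hsupp.trans hKr, ?_, ?_⟩
  · rw [eLpNorm_sub_comm]
    exact (eLpNorm_mono_measure _ Measure.restrict_le_self).trans
      (eLpNorm_bumpAverage_sub_le hs hus h₁ φ ((min_le_right _ _).trans (min_le_left _ _)))
  · have e : weakGrad U u - gradient (bumpAverage φ u) =ᵐ[volume.restrict U]
        -(bumpAverage φ W - W) := by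
      filter_upwards [hWU] with x hx
      simp [gradient_bumpAverage φ hW, hx]
    rw [eLpNorm_congr_ae e, eLpNorm_neg]
    exact (eLpNorm_mono_measure _ Measure.restrict_le_self).trans
      (eLpNorm_bumpAverage_sub_le hs hWs h₂ φ ((min_le_right _ _).trans (min_le_right _ _)))

end CompactSupport

/-! ### Differences along segments and the weak gradient. -/

section Shift

variable {n : ℕ}

theorem measurePreserving_shear (h : Euc n) :
    MeasurePreserving (fun z : ℝ × Euc n => (z.1, z.2 + z.1 • h))
      ((volume.restrict (Icc (0 : ℝ) 1)).prod volume)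
      ((volume.restrict (Icc (0 : ℝ) 1)).prod volume) :=
  (MeasurePreserving.id _).skew_product (g := fun t y => y + t • h) (by fun_prop)
    (Filter.Eventually.of_forall fun t => (measurePreserving_add_right volume (t • h)).map_eq)

theorem test_shift_sub {η : Euc n → ℝ} (hη : ContDiff ℝ ∞ η) (h x : Euc n) :
    η (x - h) - η x = ∫ t in Icc (0 : ℝ) 1, -inner ℝ (gradient η (x - t • h)) h := by
  have hg := continuous_gradient hη (by simp)
  have hd : ∀ t ∈ uIcc (0 : ℝ) 1, HasDerivAt (fun t : ℝ => η (x - t • h))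
      (-inner ℝ (gradient η (x - t • h)) h) t := fun t _ => by
    have h1 : HasDerivAt (fun t : ℝ => x - t • h) (-h) t := by
      simpa using ((hasDerivAt_id t).smul_const h).const_sub x
    have h2 := (hη.differentiable (by simp) (x - t • h)).hasFDerivAt.comp_hasDerivAt t h1
    simpa [Function.comp_def] using h2
  have := intervalIntegral.integral_eq_sub_of_hasDerivAt hd
    (Continuous.intervalIntegrable (by fun_prop) _ _)
  rw [intervalIntegral.integral_of_le zero_le_one, ← integral_Icc_eq_integral_Ioc] at this
  simpa using this.symm

variable {W : Set (Euc n)} {v : Euc n → ℝ} {V : Euc n → Euc n}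

theorem integrable_shift (hV : Integrable V) (h : Euc n) :
    Integrable (fun z : ℝ × Euc n => inner ℝ (V (z.2 + z.1 • h)) h)
      ((volume.restrict (Icc (0 : ℝ) 1)).prod volume) := by
  have h1 : Integrable (fun z : ℝ × Euc n => V z.2)
      ((volume.restrict (Icc (0 : ℝ) 1)).prod volume) := hV.comp_snd _
  exact ((measurePreserving_shear h).integrable_comp_of_integrable h1).inner_const h

/-- The fundamental theorem of calculus in weak form. After Fubini, the weak identity is tested for
each fixed `t` with the translate `η (· - t • h)`; the condition on segments keeps its support in
`W`. -/
theorem integral_shift_sub_mul (hv : Integrable v) (hV : Integrable V)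
    (hw : IsWeakGrad W v V) {h : Euc n} {η : Euc n → ℝ} (hη : ContDiff ℝ ∞ η)
    (hc : HasCompactSupport η) (hs : ∀ y ∈ tsupport η, ∀ t ∈ Icc (0 : ℝ) 1, y + t • h ∈ W) :
    ∫ x, v x * (η (x - h) - η x) =
      ∫ y, η y * ∫ t in Icc (0 : ℝ) 1, inner ℝ (V (y + t • h)) h := by
  have hg := continuous_gradient hη (by simp)
  obtain ⟨C, hC⟩ := (hasCompactSupport_gradient hc).exists_bound_of_continuous hg
  obtain ⟨D, hD⟩ := hc.exists_bound_of_continuous hη.continuous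
  simp_rw [test_shift_sub hη, ← integral_const_mul]
  have hA : Integrable (Function.uncurry fun (x : Euc n) (t : ℝ) =>
      v x * -inner ℝ (gradient η (x - t • h)) h)
      (volume.prod (volume.restrict (Icc (0 : ℝ) 1))) := by
    have h1 : Integrable (fun z : Euc n × ℝ => v z.1)
        (volume.prod (volume.restrict (Icc (0 : ℝ) 1))) := hv.comp_fst _
    have h2 : Continuous fun z : Euc n × ℝ => -inner ℝ (gradient η (z.1 - z.2 • h)) h := by
      fun_prop
    refine h1.mul_bdd (c := C * ‖h‖) h2.aestronglyMeasurable
      (Filter.Eventually.of_forall fun z => ?_)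
    rw [norm_neg]
    exact (norm_inner_le_norm _ _).trans
      (mul_le_mul_of_nonneg_right (hC _) (norm_nonneg _))
  have hB : Integrable (Function.uncurry fun (y : Euc n) (t : ℝ) =>
      η y * inner ℝ (V (y + t • h)) h) (volume.prod (volume.restrict (Icc (0 : ℝ) 1))) := by
    have h1 := (integrable_shift hV h).swap
    exact h1.bdd_mul (c := D) (hη.continuous.comp continuous_fst).aestronglyMeasurable
      (Filter.Eventually.of_forall fun z => hD z.1)
  rw [integral_integral_swap hA, integral_integral_swap hB]
  refine setIntegral_congr_fun measurableSet_Icc fun t ht => ?_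
  set θ : Euc n → ℝ := fun x => η (x - t • h) with hθ
  have hθs : ContDiff ℝ ∞ θ := hη.comp (contDiff_id.sub contDiff_const)
  have hθc : HasCompactSupport θ := hc.comp_homeomorph (Homeomorph.subRight (t • h))
  have hθW : tsupport θ ⊆ W := by
    intro x hx
    have h1 : x - t • h ∈ tsupport η :=
      (tsupport_comp_subset_preimage η (continuous_id.sub continuous_const)) hx
    simpa using hs _ h1 t ht
  have hgrad : ∀ x, gradient θ x = gradient η (x - t • h) := fun x => by
    rw [gradient, gradient, hθ, fderiv_comp_sub]
  have e := congrArg (fun z => inner ℝ z h) (hw.integral_smul_gradient hθs hθc hθW)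
  have i₁ : Integrable fun x => v x • gradient θ x :=
    hw.1.integrable_smul_right (continuous_gradient hθs (by simp)) (hasCompactSupport_gradient hθc)
      ((tsupport_gradient_subset θ).trans hθW)
  have i₂ : Integrable fun x => θ x • V x := hw.2.integrable_smul hθs.continuous hθc hθW
  simp only [real_inner_comm h, inner_neg_right] at e
  rw [← integral_inner i₁, ← integral_inner i₂] at e
  calc ∫ x, v x * -inner ℝ (gradient η (x - t • h)) h
      = -∫ x, inner ℝ h (v x • gradient θ x) := by
        rw [← integral_neg]
        refine integral_congr_ae (Filter.Eventually.of_forall fun x => ?_)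
        simp only [hgrad, inner_smul_right, real_inner_comm h]
        ring
    _ = ∫ x, inner ℝ h (θ x • V x) := by rw [e, neg_neg]
    _ = ∫ y, η y * inner ℝ (V (y + t • h)) h := by
        rw [← integral_add_right_eq_self (fun x => inner ℝ h (θ x • V x)) (t • h)]
        refine integral_congr_ae (Filter.Eventually.of_forall fun y => ?_)
        simp [hθ, inner_smul_right, real_inner_comm h]

/-- The fundamental theorem of calculus along segments, for weakly differentiable functions. -/
theorem ae_shift_sub_eq (hW : MeasurableSet W) (hv : IntegrableOn v W) (hV : Integrable V)
    (hw : IsWeakGrad W v V) {h : Euc n} {U : Set (Euc n)} (hU : IsOpen U)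
    (hUW : ∀ y ∈ U, ∀ t ∈ Icc (0 : ℝ) 1, y + t • h ∈ W) :
    ∀ᵐ y ∂(volume.restrict U),
      v (y + h) - v y = ∫ t in Icc (0 : ℝ) 1, inner ℝ (V (y + t • h)) h := by
  set v₀ := W.indicator v with hv₀
  have hvi : Integrable v₀ := (integrable_indicator_iff hW).2 hv
  have hw₀ : IsWeakGrad W v₀ V := hw.congr (indicator_ae_eq_restrict hW).symm .rfl
  have hvs : Integrable fun y => v₀ (y + h) := hvi.comp_add_right h
  have hI : Integrable fun y => ∫ t in Icc (0 : ℝ) 1, inner ℝ (V (y + t • h)) h :=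
    (integrable_shift hV h).integral_prod_right
  set f : Euc n → ℝ := fun y =>
    v₀ (y + h) - v₀ y - ∫ t in Icc (0 : ℝ) 1, inner ℝ (V (y + t • h)) h with hf
  have hfi : Integrable f := (hvs.sub hvi).sub hI
  have key := hU.ae_eq_zero_of_integral_contDiff_smul_eq_zero
    (hfi.locallyIntegrable.locallyIntegrableOn U) (fun η a b c => by
      obtain ⟨D, hD⟩ := b.exists_bound_of_continuous a.continuous
      have hb : ∀ {g : Euc n → ℝ}, Integrable g → Integrable fun y => η y * g y := fun hg =>
        hg.bdd_mul (c := D) a.continuous.aestronglyMeasurable (Filter.Eventually.of_forall hD)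
      have e := integral_shift_sub_mul hvi hV hw₀ a b (h := h) (fun y hy => hUW y (c hy))
      have a' : Continuous fun x => η (x - h) := a.continuous.comp (by fun_prop)
      have hbs : Integrable fun x => v₀ x * η (x - h) :=
        hvi.mul_bdd (c := D) a'.aestronglyMeasurable (Filter.Eventually.of_forall fun x => hD _)
      have hbs' : Integrable fun x => v₀ x * η x :=
        hvi.mul_bdd (c := D) a.continuous.aestronglyMeasurable (Filter.Eventually.of_forall hD)
      have e1 : ∫ x, v₀ x * η (x - h) = ∫ y, η y * v₀ (y + h) := by
        rw [← integral_add_right_eq_self _ h]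
        refine integral_congr_ae (Filter.Eventually.of_forall fun y => ?_)
        simp [mul_comm]
      simp_rw [mul_sub] at e
      rw [integral_sub hbs hbs', e1] at e
      simp only [hf, smul_eq_mul, mul_sub]
      refine (integral_sub ((hb hvs).sub (hb hvi)) (hb hI)).trans ?_
      refine (congrArg (· - _) (integral_sub (hb hvs) (hb hvi))).trans ?_
      rw [← e]
      simp [mul_comm])
  rw [ae_restrict_iff' hU.measurableSet]
  filter_upwards [key] with y hy hyU
  have h0 := hUW y hyU 0 (by simp)
  have h1 := hUW y hyU 1 (by simp)
  simp only [zero_smul, add_zero, one_smul] at h0 h1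
  have := hy hyU
  rw [hf] at this
  simp only [hv₀, indicator_of_mem h0, indicator_of_mem h1] at this
  linarith

/-- Difference quotients are controlled by the weak gradient in `L^s`. -/
theorem eLpNorm_shift_sub_le {s : ℝ} (hs : 1 ≤ s) (hW : MeasurableSet W) (hv : IntegrableOn v W)
    (hV : IntegrableOn V W) (hw : IsWeakGrad W v V) {h : Euc n} {U : Set (Euc n)} (hU : IsOpen U)
    (hUW : ∀ y ∈ U, ∀ t ∈ Icc (0 : ℝ) 1, y + t • h ∈ W) :
    eLpNorm (fun y => v (y + h) - v y) (ENNReal.ofReal s) (volume.restrict U) ≤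
      ‖h‖ₑ * eLpNorm V (ENNReal.ofReal s) (volume.restrict W) := by
  have hVi : Integrable (W.indicator V) := (integrable_indicator_iff hW).2 hV
  -- A representative that is strongly measurable on the whole space makes `V' (y + t • h)` jointly
  -- measurable, so the average over `t` can be estimated in `L^s`.
  set V' := hVi.1.mk _ with hV'
  have hVV' : W.indicator V =ᵐ[volume] V' := hVi.1.ae_eq_mk
  have hV'm : StronglyMeasurable V' := hVi.1.stronglyMeasurable_mk
  have hVV'W : V =ᵐ[volume.restrict W] V' :=
    (indicator_ae_eq_restrict hW).symm.trans (ae_restrict_of_ae hVV')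
  have := ae_shift_sub_eq hW hv (hVi.congr hVV') (hw.congr .rfl hVV'W) hU hUW
  rw [eLpNorm_congr_ae this, eLpNorm_congr_ae hVV'W]
  have : IsProbabilityMeasure (volume.restrict (Icc (0 : ℝ) 1)) := ⟨by simp⟩
  refine eLpNorm_integral_le hs ?_ ?_
  · have h1 : StronglyMeasurable fun z : Euc n × ℝ => V' (z.1 + z.2 • h) :=
      hV'm.comp_measurable (by fun_prop)
    exact (h1.inner stronglyMeasurable_const).aestronglyMeasurable
  · refine (ae_restrict_iff' measurableSet_Icc).2 (Filter.Eventually.of_forall fun t ht => ?_)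
    have hmp := measurePreserving_add_right (volume : Measure (Euc n)) (t • h)
    calc eLpNorm (fun y => inner ℝ (V' (y + t • h)) h) (ENNReal.ofReal s) (volume.restrict U)
        ≤ ENNReal.ofReal ‖h‖ *
          eLpNorm (fun y => V' (y + t • h)) (ENNReal.ofReal s) (volume.restrict U) := by
          refine eLpNorm_le_mul_eLpNorm_of_ae_le_mul (Filter.Eventually.of_forall fun y => ?_) _
          rw [mul_comm]
          exact norm_inner_le_norm _ _
      _ ≤ ‖h‖ₑ * eLpNorm V' (ENNReal.ofReal s) (volume.restrict W) := by
          rw [ofReal_norm]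
          refine mul_le_mul_right ?_ _
          have h2 := (hmp.restrict_preimage hW)
          rw [← eLpNorm_comp_measurePreserving hV'm.aestronglyMeasurable h2]
          refine eLpNorm_mono_measure _ (Measure.restrict_mono (fun y hy => ?_) le_rfl)
          exact hUW y hy t ht

end Shift

/-! ### Poincaré's inequality in `W_0`. -/

section Poincare

variable {n : ℕ}

theorem exists_norm_eq_one (hn : 0 < n) : ∃ e : Euc n, ‖e‖ = 1 := by
  have : Nonempty (Fin n) := ⟨⟨0, hn⟩⟩
  exact exists_norm_eq (Euc n) zero_le_one

theorem MemW.integrableOn {s : ℝ} (hs : 1 ≤ s) {U : Set (Euc n)} (hfin : volume U ≠ ⊤)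
    {u : Euc n → ℝ} (h : MemW s U u) : IntegrableOn u U := by
  have : IsFiniteMeasure (volume.restrict U) := ⟨by simpa using hfin.lt_top⟩
  exact h.1.integrable (by simpa using hs)

theorem MemW.integrableOn_weakGrad {s : ℝ} (hs : 1 ≤ s) {U : Set (Euc n)} (hU : IsOpen U)
    (hfin : volume U ≠ ⊤) {u : Euc n → ℝ} (h : MemW s U u) : IntegrableOn (weakGrad U u) U := by
  have : IsFiniteMeasure (volume.restrict U) := ⟨by simpa using hfin.lt_top⟩
  exact (h.memLp_weakGrad hU).integrable (by simpa using hs)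

/-- Poincaré's inequality in `W_0`. -/
theorem exists_poincare_memW0 (hn : 0 < n) {U : Set (Euc n)} (hU : IsOpen U)
    (hb : Bornology.IsBounded U) : ∃ C : ℝ≥0∞, C ≠ ⊤ ∧ ∀ (s : ℝ), 1 < s → ∀ w, MemW0 s U w →
      eLpNorm w (ENNReal.ofReal s) (volume.restrict U) ≤
        C * eLpNorm (weakGrad U w) (ENNReal.ofReal s) (volume.restrict U) := by
  obtain ⟨e, he⟩ := exists_norm_eq_one hn
  obtain ⟨R, hR⟩ := hb.subset_ball 0
  set R' := max R 0 with hR'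
  have hfin : volume U ≠ ⊤ := hb.measure_lt_top.ne
  -- The shift has the length of a diameter of a ball containing `U` and moves `U` off itself. Hence
  -- on `U` the shifted difference of the zero extension is `-w`, and the length of the shift is the
  -- Poincaré constant for every exponent.
  set h : Euc n := (2 * R') • e with hh
  have hout : ∀ y ∈ U, y + h ∉ U := fun y hy hyh => by
    have h1 : ‖y‖ < R := by simpa using hR hy
    have h2 : ‖y + h‖ < R := by simpa using hR hyh
    have h3 : ‖h‖ = 2 * R' := by
      rw [hh, norm_smul, he, mul_one, Real.norm_of_nonneg (by positivity)]
    have h4 : ‖h‖ ≤ ‖y + h‖ + ‖y‖ := by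
      have := norm_sub_le (y + h) y
      rwa [add_sub_cancel_left] at this
    have := le_max_left R 0
    linarith
  refine ⟨‖h‖ₑ, by simp, fun s hs w hw => ?_⟩
  have h1 := eLpNorm_shift_sub_le (s := s) hs.le MeasurableSet.univ (v := U.indicator w)
    (V := U.indicator (weakGrad U w)) (h := h)
    (integrableOn_univ.2 ((integrable_indicator_iff hU.measurableSet).2
      (hw.1.integrableOn hs.le hfin)))
    (integrableOn_univ.2 ((integrable_indicator_iff hU.measurableSet).2
      (hw.1.integrableOn_weakGrad hs.le hU hfin)))
    (hw.isWeakGrad_indicator hU hs) hU (fun _ _ _ _ => mem_univ _)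
  rw [Measure.restrict_univ, eLpNorm_indicator_eq_eLpNorm_restrict hU.measurableSet] at h1
  refine le_of_eq_of_le ?_ h1
  rw [← eLpNorm_neg]
  refine eLpNorm_congr_ae ((ae_restrict_iff' hU.measurableSet).2 (Filter.Eventually.of_forall
    fun y hy => ?_))
  simp [hy, hout y hy]

end Poincare

/-! ### Lipschitz boundaries are null sets. -/

section LipschitzBoundary

variable {n : ℕ} {A : Set (Euc n)}

/-- The local description of the boundary: inside a ball, the frontier lies on the graph. -/
theorem inner_eq_of_mem_frontier {x₀ e : Euc n} {ρ : ℝ} {K : ℝ≥0} {g : Euc n → ℝ} (hA : IsOpen A)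
    (hg : LipschitzWith K g)
    (h : ∀ y ∈ Metric.ball x₀ ρ, y ∈ A ↔ g (y - inner ℝ e y • e) < inner ℝ e y) {y : Euc n}
    (hy : y ∈ Metric.ball x₀ ρ) (hyA : y ∈ frontier A) :
    g (y - inner ℝ e y • e) = inner ℝ e y := by
  rw [hA.frontier_eq] at hyA
  refine le_antisymm ?_ ?_
  · by_contra hlt
    push Not at hlt
    have hc : Continuous fun y : Euc n => g (y - inner ℝ e y • e) := hg.continuous.comp (by fun_prop)
    have ho : IsOpen ({y | inner ℝ e y < g (y - inner ℝ e y • e)} ∩ Metric.ball x₀ ρ) :=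
      (isOpen_lt (by fun_prop) hc).inter Metric.isOpen_ball
    obtain ⟨z, hz, hzA⟩ := mem_closure_iff.1 hyA.1 _ ho ⟨hlt, hy⟩
    exact lt_asymm hz.1 ((h z hz.2).1 hzA)
  · by_contra hlt
    push Not at hlt
    exact hyA.2 ((h y hy).2 hlt)

/-- The frontier lies locally on a graph over the orthogonal complement of `e`. Distinct translates
of a graph along `e` are disjoint, and a set with infinitely many disjoint translates by a bounded
family of vectors has measure zero. -/
theorem volume_frontier_eq_zero (hA : IsOpen A) (hL : HasLipschitzBoundary A) :
    volume (frontier A) = 0 := by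
  refine measure_null_of_locally_null _ fun x₀ hx₀ => ?_
  obtain ⟨ρ, e, K, g, hρ, he, hg, h⟩ := hL x₀ hx₀
  refine ⟨frontier A ∩ Metric.ball x₀ ρ,
    inter_mem_nhdsWithin _ (Metric.ball_mem_nhds _ hρ), ?_⟩
  set S := {y : Euc n | g (y - inner ℝ e y • e) = inner ℝ e y}
  have hc : Continuous fun y : Euc n => g (y - inner ℝ e y • e) := hg.continuous.comp (by fun_prop)
  have hS : IsClosed S := isClosed_eq hc (by fun_prop)
  have hsub : frontier A ∩ Metric.ball x₀ ρ ⊆ S := fun y hy =>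
    inner_eq_of_mem_frontier hA hg h hy.2 hy.1
  refine measure_mono_null hsub ?_
  set u : ℕ → Euc n := fun k => ((k : ℝ) + 1)⁻¹ • e with hu
  have hbdd : Bornology.IsBounded (range u) := by
    refine isBounded_iff_forall_norm_le.2 ⟨1, ?_⟩
    rintro _ ⟨k, rfl⟩
    rw [hu]
    simp only [norm_smul, he, mul_one, norm_inv]
    refine inv_le_one_of_one_le₀ ?_
    rw [Real.norm_of_nonneg (by positivity)]
    linarith [Nat.cast_nonneg (α := ℝ) k]
  refine Measure.addHaar_eq_zero_of_disjoint_translates (volume : Measure (Euc n)) u hbdd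
    ?_ hS.measurableSet
  intro i j hij
  refine Set.disjoint_left.2 ?_
  rintro y hy₁ hy₂
  simp only [singleton_add, mem_image] at hy₁ hy₂
  obtain ⟨a, ha, rfl⟩ := hy₁
  obtain ⟨b, hb, hab⟩ := hy₂
  have hee : inner ℝ e e = (1 : ℝ) := by rw [real_inner_self_eq_norm_sq, he]; norm_num
  have hproj : ∀ (t : ℝ) (a : Euc n), inner ℝ e (t • e + a) = t + inner ℝ e a := fun t a => by
    rw [inner_add_right, inner_smul_right, hee, mul_one]
  have hp : a - inner ℝ e a • e = b - inner ℝ e b • e := by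
    have h1 := congrArg (fun y : Euc n => y - inner ℝ e y • e) hab
    simp only [hu, hproj, add_smul] at h1
    simpa using h1.symm
  have ha1 : g (a - inner ℝ e a • e) = inner ℝ e a := ha
  have hb1 : g (b - inner ℝ e b • e) = inner ℝ e b := hb
  rw [hp, hb1] at ha1
  have h2 := congrArg (fun y : Euc n => inner ℝ e y) hab
  simp only [hu, hproj] at h2
  have h3 : ((i : ℝ) + 1)⁻¹ = ((j : ℝ) + 1)⁻¹ := by linarith
  have h4 : (i : ℝ) = j := by
    have := inv_injective h3
    linarith
  exact hij (by exact_mod_cast h4)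

end LipschitzBoundary

/-! ### Poincaré's inequality on `Ω` minus a Lipschitz hole. -/

section ExteriorPoincare

variable {n : ℕ}

/-- A weakly differentiable function on `W` that vanishes off `Ω`, together with its gradient. -/
structure VanishingOff (Ω W : Set (Euc n)) (v : Euc n → ℝ) (V : Euc n → Euc n) : Prop where
  isWeakGrad : IsWeakGrad W v V
  integrableOn : IntegrableOn v W
  integrableOn_grad : IntegrableOn V W
  eq_zero : ∀ x, x ∉ Ω → v x = 0

/-- Functions that vanish off `Ω` are controlled on `S` by their gradients in `L^s(W)`. -/
def PoincareOn (s : ℝ) (Ω W S : Set (Euc n)) : Prop :=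
  ∃ C : ℝ≥0∞, C ≠ ⊤ ∧ ∀ v V, VanishingOff Ω W v V →
    eLpNorm v (ENNReal.ofReal s) (volume.restrict S) ≤
      C * eLpNorm V (ENNReal.ofReal s) (volume.restrict W)

namespace PoincareOn

variable {s : ℝ} {Ω W S S' : Set (Euc n)}

theorem mono (h : PoincareOn s Ω W S') (hs : S ⊆ S') : PoincareOn s Ω W S := by
  obtain ⟨C, hC, h⟩ := h
  exact ⟨C, hC, fun v V hv =>
    (eLpNorm_mono_measure _ (Measure.restrict_mono hs le_rfl)).trans (h v V hv)⟩

theorem union (hs : 1 ≤ s) (h : PoincareOn s Ω W S) (h' : PoincareOn s Ω W S') :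
    PoincareOn s Ω W (S ∪ S') := by
  obtain ⟨C, hC, h⟩ := h
  obtain ⟨C', hC', h'⟩ := h'
  refine ⟨C + C', by finiteness, fun v V hv => ?_⟩
  have e0 : ENNReal.ofReal s ≠ 0 := by simp; linarith
  rw [add_mul]
  refine le_trans ?_ (add_le_add (h v V hv) (h' v V hv))
  refine (eLpNorm_mono_measure _ (Measure.restrict_union_le S S')).trans ?_
  rw [eLpNorm_eq_lintegral_rpow_enorm_toReal e0 ENNReal.ofReal_ne_top,
    eLpNorm_eq_lintegral_rpow_enorm_toReal e0 ENNReal.ofReal_ne_top,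
    eLpNorm_eq_lintegral_rpow_enorm_toReal e0 ENNReal.ofReal_ne_top, lintegral_add_measure,
    ENNReal.toReal_ofReal (by linarith)]
  exact ENNReal.rpow_add_le_add_rpow _ _ (by positivity) (by rw [div_le_one (by linarith)]; exact hs)

theorem of_disjoint (hS : MeasurableSet S) (h : Disjoint S Ω) : PoincareOn s Ω W S := by
  refine ⟨0, by simp, fun v V hv => ?_⟩
  have : v =ᵐ[volume.restrict S] 0 :=
    (ae_restrict_iff' hS).2 (Filter.Eventually.of_forall fun x hx =>
      hv.eq_zero x (disjoint_left.1 h hx))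
  rw [eLpNorm_congr_ae this]
  simp

/-- Write `v(y) = v(y + h) - (v(y + h) - v(y))`. The first term is controlled on `S'`, the
difference by the gradient along segments that stay in `W`. -/
theorem translate (hs : 1 ≤ s) (hW : MeasurableSet W) (hS : IsOpen S) {h : Euc n}
    (hSW : ∀ y ∈ S, ∀ t ∈ Icc (0 : ℝ) 1, y + t • h ∈ W) (hS' : ∀ y ∈ S, y + h ∈ S')
    (hp : PoincareOn s Ω W S') : PoincareOn s Ω W S := by
  -- `S'` may be shrunk to the translate of `S` by `h`, which is open.
  wlog hm : MeasurableSet S' generalizing S'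
  · exact this (S' := (· - h) ⁻¹' S) (fun y hy => by simpa using hy)
      (hp.mono fun y hy => by simpa using hS' _ hy) ((hS.preimage (by fun_prop)).measurableSet)
  obtain ⟨C, hC, hp⟩ := hp
  refine ⟨C + ‖h‖ₑ, by finiteness, fun v V hv => ?_⟩
  have hs' : 1 ≤ ENNReal.ofReal s := by simpa using hs
  have hmp := measurePreserving_add_right (volume : Measure (Euc n)) h
  have h1 := eLpNorm_shift_sub_le hs hW hv.integrableOn hv.integrableOn_grad hv.isWeakGrad hS hSW
  have hSW0 : S ⊆ W := fun y hy => by simpa using hSW y hy 0 (by simp)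
  have hm1 : AEStronglyMeasurable v (volume.restrict S) :=
    hv.integrableOn.1.mono_measure (Measure.restrict_mono hSW0 le_rfl)
  have hmr := hmp.restrict_preimage (hW : MeasurableSet W)
  have hm2 : AEStronglyMeasurable (fun y => v (y + h)) (volume.restrict S) :=
    (hv.integrableOn.1.comp_measurePreserving hmr).mono_measure
      (Measure.restrict_mono (fun y hy => by simpa using hSW y hy 1 (by simp)) le_rfl)
  have h2 : eLpNorm (fun y => v (y + h)) (ENNReal.ofReal s) (volume.restrict S) ≤
      C * eLpNorm V (ENNReal.ofReal s) (volume.restrict W) := by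
    refine le_trans ?_ (hp v V hv)
    set T := S' ∩ W
    have hT : MeasurableSet T := hm.inter hW
    have hvT : AEStronglyMeasurable v (volume.restrict T) :=
      hv.integrableOn.1.mono_measure (Measure.restrict_mono inter_subset_right le_rfl)
    refine le_trans ?_ (eLpNorm_mono_measure v (Measure.restrict_mono
      (inter_subset_left : T ⊆ S') le_rfl))
    rw [← eLpNorm_comp_measurePreserving hvT (hmp.restrict_preimage hT)]
    refine eLpNorm_mono_measure _ (Measure.restrict_mono (fun y hy => ?_) le_rfl)
    exact ⟨hS' y hy, by simpa using hSW y hy 1 (by simp)⟩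
  have e : v = (fun y => v (y + h)) - fun y => v (y + h) - v y := by
    ext y; simp
  calc eLpNorm v (ENNReal.ofReal s) (volume.restrict S)
      = eLpNorm ((fun y => v (y + h)) - fun y => v (y + h) - v y) (ENNReal.ofReal s)
        (volume.restrict S) := by rw [← e]
    _ ≤ _ := (eLpNorm_sub_le hm2 (hm2.sub hm1) hs').trans (add_le_add h2 h1)
    _ = _ := by rw [add_mul]

theorem of_isCompact (hs : 1 ≤ s) {K : Set (Euc n)} (hK : IsCompact K) (T : Set (Euc n))
    (h : ∀ x ∈ K, ∃ r : ℝ, 0 < r ∧ PoincareOn s Ω W (Metric.ball x r ∩ T)) :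
    PoincareOn s Ω W (K ∩ T) := by
  refine hK.induction_on (p := fun S => PoincareOn s Ω W (S ∩ T)) ?_ ?_ ?_ ?_
  · exact ⟨0, by simp, fun v V _ => by simp⟩
  · exact fun S S' hSS' h => h.mono (inter_subset_inter_left _ hSS')
  · intro S S' h h'
    rw [union_inter_distrib_right]
    exact h.union hs h'
  · intro x hx
    obtain ⟨r, hr, h⟩ := h x hx
    exact ⟨_, mem_nhdsWithin_of_mem_nhds (Metric.ball_mem_nhds x hr), h⟩

/-- Poincaré's inequality propagates from nearby balls. -/
theorem ball_of_near (hs : 1 ≤ s) (hW : MeasurableSet W) {x y : Euc n} {r ρ : ℝ}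
    (hxW : Metric.ball x (2 * r) ⊆ W) (hy : y ∈ Metric.ball x r) (hρ : 0 < ρ)
    (h : PoincareOn s Ω W (Metric.ball y ρ)) : ∃ ρ', 0 < ρ' ∧ PoincareOn s Ω W (Metric.ball x ρ') := by
  have hr : 0 < r := Metric.pos_of_mem_ball hy
  refine ⟨min ρ r, by positivity, translate hs hW Metric.isOpen_ball (h := y - x) ?_ ?_ h⟩
  · intro z hz t ht
    refine hxW ?_
    rw [Metric.mem_ball, dist_eq_norm] at hz hy ⊢
    have h1 : ‖t • (y - x)‖ ≤ ‖y - x‖ := by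
      rw [norm_smul, Real.norm_of_nonneg ht.1]
      exact mul_le_of_le_one_left (norm_nonneg _) ht.2
    calc ‖z + t • (y - x) - x‖ = ‖(z - x) + t • (y - x)‖ := by congr 1; abel
      _ ≤ ‖z - x‖ + ‖t • (y - x)‖ := norm_add_le _ _
      _ < 2 * r := by have := min_le_right ρ r; linarith
  · intro z hz
    rw [Metric.mem_ball, dist_eq_norm] at hz ⊢
    calc ‖z + (y - x) - y‖ = ‖z - x‖ := by congr 1; abel
      _ < ρ := hz.trans_le (min_le_left _ _)

/-- The points with a good ball form an open set. By `ball_of_near` its complement in `W` is open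
too, so a preconnected set that contains one good point contains only good points. -/
theorem of_isPreconnected (hs : 1 ≤ s) (hW : IsOpen W) {S : Set (Euc n)} (hS : IsPreconnected S)
    (hSW : S ⊆ W) {x₀ : Euc n} (hx₀ : x₀ ∈ S)
    (h₀ : ∃ r, 0 < r ∧ PoincareOn s Ω W (Metric.ball x₀ r)) :
    ∀ x ∈ S, ∃ r, 0 < r ∧ PoincareOn s Ω W (Metric.ball x r) := by
  set G := {x | ∃ r, 0 < r ∧ PoincareOn s Ω W (Metric.ball x r)} with hG
  have hGo : IsOpen G := by
    rw [Metric.isOpen_iff]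
    rintro x ⟨r, hr, h⟩
    refine ⟨r, hr, fun y hy => ?_⟩
    obtain ⟨δ, hδ, hsub⟩ := Metric.isOpen_iff.1 Metric.isOpen_ball y hy
    exact ⟨δ, hδ, h.mono hsub⟩
  have hGc : IsOpen (W \ G) := by
    rw [Metric.isOpen_iff]
    rintro x ⟨hxW, hxG⟩
    obtain ⟨r, hr, hsub⟩ := Metric.isOpen_iff.1 hW x hxW
    refine ⟨r / 2, by positivity, fun y hy => ⟨hsub ?_, fun hyG => hxG ?_⟩⟩
    · exact Metric.ball_subset_ball (by linarith) hy
    · obtain ⟨ρ, hρ, h⟩ := hyG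
      exact ball_of_near hs hW.measurableSet (by rwa [mul_div_cancel₀ r two_ne_zero]) hy hρ h
  refine hS.subset_left_of_subset_union hGo hGc disjoint_sdiff_self_right ?_ ⟨x₀, hx₀, h₀⟩
  intro x hx
  by_cases hxG : x ∈ G
  · exact Or.inl hxG
  · exact Or.inr ⟨hSW hx, hxG⟩

end PoincareOn

theorem exists_norm_lt_of_ball (hn : 0 < n) (x : Euc n) {r : ℝ} (hr : 0 < r) :
    ∃ z ∈ Metric.ball x r, ‖x‖ < ‖z‖ := by
  obtain ⟨e, he, hxe⟩ : ∃ e : Euc n, ‖e‖ = 1 ∧ 0 ≤ inner ℝ x e := by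
    obtain ⟨e, he⟩ := exists_norm_eq_one hn
    rcases le_total 0 (inner ℝ x e) with h | h
    · exact ⟨e, he, h⟩
    · exact ⟨-e, by rwa [norm_neg], by rw [inner_neg_right]; linarith⟩
  refine ⟨x + (r / 2) • e, ?_, ?_⟩
  · rw [Metric.mem_ball, dist_eq_norm, add_sub_cancel_left, norm_smul, he,
      Real.norm_of_nonneg (by positivity)]
    linarith
  · have h1 : ‖x + (r / 2) • e‖ ^ 2 = ‖x‖ ^ 2 + 2 * (r / 2 * inner ℝ x e) + (r / 2) ^ 2 := by
      rw [norm_add_sq_real, inner_smul_right, norm_smul, he, Real.norm_of_nonneg (by positivity)]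
      ring
    have h2 : 0 ≤ r / 2 * inner ℝ x e := by positivity
    refine lt_of_pow_lt_pow_left₀ 2 (norm_nonneg _) ?_
    rw [h1]
    nlinarith [sq_pos_of_pos hr]

/-- Poincaré's inequality for functions on `Ω` minus a Lipschitz hole, which vanish on `∂Ω` only. -/
theorem poincareOn_diff (hn : 0 < n) {s : ℝ} (hs : 1 ≤ s) {Ω A : Set (Euc n)} (hΩ : IsOpen Ω)
    (hb : Bornology.IsBounded Ω) (hA : IsOpen A) (hAΩ : closure A ⊆ Ω)
    (hL : HasLipschitzBoundary A) (hB : IsConnected (Ω \ closure A)) :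
    PoincareOn s Ω (closure A)ᶜ (Ω \ closure A) := by
  set W := (closure A)ᶜ with hWdef
  set B := Ω \ closure A with hBdef
  have hW : IsOpen W := isClosed_closure.isOpen_compl
  have hBW : B ⊆ W := fun x hx => hx.2
  obtain ⟨b, hbB⟩ := hB.nonempty
  -- A point of `closure Ω` farthest from the origin has nearby balls that miss `Ω`, on which the
  -- functions vanish. The propagation starts there.
  obtain ⟨x₀, hx₀, hmax⟩ := hb.isCompact_closure.exists_isMaxOn ⟨b, subset_closure hbB.1⟩
    continuous_norm.continuousOn
  have hmax : ∀ z ∈ Ω, ‖z‖ ≤ ‖x₀‖ := fun z hz => hmax (subset_closure hz)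
  have hx₀Ω : x₀ ∉ Ω := fun h => by
    obtain ⟨r, hr, hsub⟩ := Metric.isOpen_iff.1 hΩ x₀ h
    obtain ⟨z, hz, hlt⟩ := exists_norm_lt_of_ball hn x₀ hr
    exact (hmax z (hsub hz)).not_gt hlt
  have hx₀W : x₀ ∈ W := fun h => hx₀Ω (hAΩ h)
  have hx₀B : x₀ ∈ closure B := by
    rw [mem_closure_iff] at hx₀ ⊢
    intro o ho hxo
    obtain ⟨z, hz, hzΩ⟩ := hx₀ (o ∩ W) (ho.inter hW) ⟨hxo, hx₀W⟩
    exact ⟨z, hz.1, hzΩ, hz.2⟩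
  have hgood₀ : ∃ r, 0 < r ∧ PoincareOn s Ω W (Metric.ball x₀ r) := by
    obtain ⟨r, hr, hsub⟩ := Metric.isOpen_iff.1 hW x₀ hx₀W
    obtain ⟨z, hz, hlt⟩ := exists_norm_lt_of_ball hn x₀ (half_pos hr)
    refine PoincareOn.ball_of_near hs hW.measurableSet (y := z) (r := r / 2) (ρ := ‖z‖ - ‖x₀‖)
      (by rwa [mul_div_cancel₀ r two_ne_zero]) hz (by linarith)
      (PoincareOn.of_disjoint Metric.isOpen_ball.measurableSet ?_)
    refine disjoint_left.2 fun y hy hyΩ => ?_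
    rw [Metric.mem_ball, dist_comm, dist_eq_norm] at hy
    have h1 := hmax y hyΩ
    have h2 := norm_le_norm_add_norm_sub' z y
    linarith
  -- The set lies between `B` and `closure B`, so it inherits connectedness; unlike `B`, it contains
  -- the starting point `x₀`.
  have hpre : IsPreconnected (closure B ∩ W) :=
    hB.isPreconnected.subset_closure (fun x hx => ⟨subset_closure hx, hBW hx⟩) inter_subset_left
  have hgood := PoincareOn.of_isPreconnected hs hW hpre inter_subset_right ⟨hx₀B, hx₀W⟩ hgood₀
  have hcompact : IsCompact (closure B) := (hb.subset sdiff_subset).isCompact_closure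
  have hfin : PoincareOn s Ω W (closure B ∩ B) := by
    refine PoincareOn.of_isCompact hs hcompact B fun x hx => ?_
    by_cases hxW : x ∈ W
    · obtain ⟨r, hr, h⟩ := hgood x ⟨hx, hxW⟩
      exact ⟨r, hr, h.mono inter_subset_left⟩
    -- The remaining points lie on `∂A`, where no ball is contained in `W`; the graph direction
    -- supplies segments that avoid `closure A`.
    have hxA : x ∈ closure A := by
      by_contra h
      exact hxW h
    have hxnA : x ∉ A := fun h => by
      obtain ⟨z, hzA, hzB⟩ := mem_closure_iff.1 hx A hA h
      exact hzB.2 (subset_closure hzA)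
    have hxf : x ∈ frontier A := by rw [hA.frontier_eq]; exact ⟨hxA, hxnA⟩
    obtain ⟨ρ₀, e, K, g, hρ₀, he, hg, hgr⟩ := hL x hxf
    obtain ⟨ρ₁, hρ₁, hsub⟩ := Metric.isOpen_iff.1 hΩ x (hAΩ hxA)
    set ρ := min ρ₀ ρ₁ with hρdef
    have hρ : 0 < ρ := by positivity
    have hball₀ : Metric.ball x ρ ⊆ Metric.ball x ρ₀ := Metric.ball_subset_ball (min_le_left _ _)
    have hball₁ : Metric.ball x ρ ⊆ Ω :=
      (Metric.ball_subset_ball (min_le_right _ _)).trans hsub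
    have hee : inner ℝ e e = (1 : ℝ) := by rw [real_inner_self_eq_norm_sq, he]; norm_num
    have hc : Continuous fun y : Euc n => g (y - inner ℝ e y • e) := hg.continuous.comp (by fun_prop)
    have hbelow : ∀ y ∈ Metric.ball x ρ, inner ℝ e y < g (y - inner ℝ e y • e) → y ∈ B := by
      intro y hy hlt
      refine ⟨hball₁ hy, fun hyA => ?_⟩
      obtain ⟨z, hz, hzA⟩ := mem_closure_iff.1 hyA
        ({y | inner ℝ e y < g (y - inner ℝ e y • e)} ∩ Metric.ball x ρ)
        ((isOpen_lt (by fun_prop) hc).inter Metric.isOpen_ball) ⟨hlt, hy⟩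
      exact lt_asymm hz.1 ((hgr z (hball₀ hz.2)).1 hzA)
    have habove : ∀ y ∈ Metric.ball x ρ, y ∈ B → inner ℝ e y ≤ g (y - inner ℝ e y • e) := by
      intro y hy hyB
      by_contra! hlt
      exact hyB.2 (subset_closure ((hgr y (hball₀ hy)).2 hlt))
    -- A shift below the graph, away from `A`. From the closed ball of radius `ρ / 2` it stays
    -- inside the ball of radius `ρ`.
    set h : Euc n := -(ρ / 4) • e with hh
    have hshift : ∀ (y : Euc n) (t : ℝ), y + t • h - inner ℝ e (y + t • h) • e =
        y - inner ℝ e y • e ∧ inner ℝ e (y + t • h) = inner ℝ e y - t * (ρ / 4) := fun y t => by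
      have h1 : inner ℝ e (y + t • h) = inner ℝ e y - t * (ρ / 4) := by
        rw [hh, inner_add_right, inner_smul_right, inner_smul_right, hee]; ring
      refine ⟨?_, h1⟩
      rw [h1, hh]
      module
    have hnear : ∀ y ∈ Metric.closedBall x (ρ / 2), ∀ t ∈ Icc (0 : ℝ) 1,
        y + t • h ∈ Metric.ball x ρ := fun y hy t ht => by
      rw [Metric.mem_closedBall, dist_eq_norm] at hy
      rw [Metric.mem_ball, dist_eq_norm]
      have h1 : ‖t • h‖ ≤ ρ / 4 := by
        rw [hh, norm_smul, norm_smul, he, Real.norm_of_nonneg ht.1, norm_neg,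
          Real.norm_of_nonneg (by positivity), mul_one]
        exact mul_le_of_le_one_left (by positivity) ht.2
      calc ‖y + t • h - x‖ = ‖(y - x) + t • h‖ := by congr 1; abel
        _ ≤ ‖y - x‖ + ‖t • h‖ := norm_add_le _ _
        _ < ρ := by linarith
    have hmoved : ∀ y ∈ Metric.closedBall x (ρ / 2), inner ℝ e y ≤ g (y - inner ℝ e y • e) →
        ∀ t ∈ Ioc (0 : ℝ) 1, y + t • h ∈ B := fun y hy hle t ht => by
      refine hbelow _ (hnear y hy t ⟨ht.1.le, ht.2⟩) ?_
      rw [(hshift y t).1, (hshift y t).2]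
      have : 0 < t * (ρ / 4) := mul_pos ht.1 (by positivity)
      linarith
    -- The part of the half ball on or below the graph is compact and its shift lies in `B`, where
    -- good balls are already known; finitely many of them give one constant.
    set K₀ := Metric.closedBall x (ρ / 2) ∩ {y | inner ℝ e y ≤ g (y - inner ℝ e y • e)} with hK₀
    have hK₀c : IsCompact K₀ := (isCompact_closedBall x (ρ / 2)).inter_right
      (isClosed_le (by fun_prop) hc)
    have hK₁c : IsCompact ((fun y => y + h) '' K₀) := hK₀c.image (by fun_prop)
    have hK₁ : PoincareOn s Ω W ((fun y => y + h) '' K₀ ∩ univ) := by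
      refine PoincareOn.of_isCompact hs hK₁c univ ?_
      rintro _ ⟨y, hy, rfl⟩
      have hyB : y + h ∈ B := by simpa using hmoved y hy.1 hy.2 1 (by simp)
      obtain ⟨r, hr, h⟩ := hgood (y + h) ⟨subset_closure hyB, hBW hyB⟩
      exact ⟨r, hr, h.mono inter_subset_left⟩
    have hBo : IsOpen B := hΩ.sdiff isClosed_closure
    have hsubK : ∀ y ∈ Metric.ball x (ρ / 2) ∩ B, y ∈ K₀ := fun y hy =>
      ⟨Metric.ball_subset_closedBall hy.1,
        habove y (Metric.ball_subset_ball (by linarith) hy.1) hy.2⟩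
    refine ⟨ρ / 2, by positivity, PoincareOn.translate hs hW.measurableSet
      (Metric.isOpen_ball.inter hBo) (h := h) ?_ ?_ hK₁⟩
    · intro y hy t ht
      rcases ht.1.eq_or_lt with h0 | h0
      · rw [← h0, zero_smul, add_zero]; exact hBW hy.2
      · exact hBW (hmoved y (hsubK y hy).1 (hsubK y hy).2 t ⟨h0, ht.2⟩)
    · exact fun y hy => ⟨mem_image_of_mem _ (hsubK y hy), mem_univ _⟩
  exact hfin.mono fun x hx => ⟨subset_closure hx, hx⟩

end ExteriorPoincare

/-! ### Abstract minimization over an affine space of fields. -/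

theorem tendsto_eLpNorm_of_integral_rpow {X F J : Type*} [MeasurableSpace X] {μ : Measure X}
    [NormedAddCommGroup F] {s : ℝ} (hs : 0 < s) {l : Filter J} {f : J → X → F}
    (hf : ∀ j, MemLp (f j) (ENNReal.ofReal s) μ)
    (h : Filter.Tendsto (fun j => ∫ x, ‖f j x‖ ^ s ∂μ) l (nhds 0)) :
    Filter.Tendsto (fun j => eLpNorm (f j) (ENNReal.ofReal s) μ) l (nhds 0) := by
  have h0 : ENNReal.ofReal s ≠ 0 := by simpa using hs
  have e : ∀ j, eLpNorm (f j) (ENNReal.ofReal s) μ =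
      ENNReal.ofReal ((∫ x, ‖f j x‖ ^ s ∂μ) ^ s⁻¹) := fun j => by
    rw [(hf j).eLpNorm_eq_integral_rpow_norm h0 ENNReal.ofReal_ne_top,
      ENNReal.toReal_ofReal hs.le]
  simp only [e]
  have := ENNReal.tendsto_ofReal (h.rpow_const (p := s⁻¹) (Or.inr (inv_nonneg.2 hs.le)))
  rwa [Real.zero_rpow (inv_ne_zero hs.ne'), ENNReal.ofReal_zero] at this

theorem matEnergy_congr {X F : Type*} [MeasurableSpace X] {μ : Measure X}
    [NormedAddCommGroup F] {σ : X → ℝ≥0 → ℝ≥0∞} {V W : X → F} (h : V =ᵐ[μ] W) :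
    matEnergy μ σ V = matEnergy μ σ W :=
  integral_congr_ae (h.mono fun x hx => by simp only [hx])

theorem matPower_congr {X F : Type*} [MeasurableSpace X] {μ : Measure X}
    [NormedAddCommGroup F] [InnerProductSpace ℝ F] {σ : X → ℝ≥0 → ℝ≥0∞} {V V' W W' : X → F}
    (h : V =ᵐ[μ] V') (h' : W =ᵐ[μ] W') : matPower μ σ V W = matPower μ σ V' W' := by
  refine integral_congr_ae ?_
  filter_upwards [h, h'] with x hx hx'
  rw [hx, hx']

/-- In the two subgradient inequalities based at the midpoint the powers cancel. Nonnegativity in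
each phase allows the gap of a single phase to be bounded by the total gap. -/
theorem PowerMaterial.matEnergy_midpoint_le {X F : Type*} [MeasurableSpace X] {μ : Measure X}
    [IsFiniteMeasure μ] [NormedAddCommGroup F] [InnerProductSpace ℝ F] {s C κ : ℝ}
    {σ : X → ℝ≥0 → ℝ≥0∞} (h : PowerMaterial μ F s C κ σ) {V W : X → F}
    (hV : MemLp V (ENNReal.ofReal s) μ) (hW : MemLp W (ENNReal.ofReal s) μ) :
    0 ≤ matEnergy μ σ V + matEnergy μ σ W - 2 * matEnergy μ σ ((1 / 2 : ℝ) • (V + W)) := by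
  have hm : MemLp ((1 / 2 : ℝ) • (V + W)) (ENNReal.ofReal s) μ := (hV.add hW).const_smul _
  have h₁ := h.matPower_sub_le hm hV
  have h₂ := h.matPower_sub_le hm hW
  have e : W - (1 / 2 : ℝ) • (V + W) = (-1 : ℝ) • (V - (1 / 2 : ℝ) • (V + W)) := by
    module
  rw [e, PowerMaterial.matPower_smul] at h₂
  linarith

/-- A space `T` of potentials with a field `G u` attached to each `u ∈ T`, linear and
`L^{s i}`-integrable for the measures `μ i`, and a subspace `Z ≤ T` whose fields form a complete
space. -/
structure FieldSpace {X Y F ι : Type*} [MeasurableSpace X] [NormedAddCommGroup F]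
    [NormedSpace ℝ F] [AddCommGroup Y] [Module ℝ Y] (μ : ι → Measure X) (s : ι → ℝ)
    (T Z : Submodule ℝ Y) (G : Y → X → F) : Prop where
  le : Z ≤ T
  memLp : ∀ i, ∀ u ∈ T, MemLp (G u) (ENNReal.ofReal (s i)) (μ i)
  add : ∀ i, ∀ u ∈ T, ∀ v ∈ T, G (u + v) =ᵐ[μ i] G u + G v
  smul : ∀ i, ∀ t : ℝ, ∀ u ∈ T, G (t • u) =ᵐ[μ i] t • G u
  -- Convergence is asked of the fields only; recovering a limiting potential is where the Poincaré
  -- inequality enters.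
  complete : ∀ v : ℕ → Y, (∀ k, v k ∈ Z) →
    (∀ i, Filter.Tendsto (fun z : ℕ × ℕ =>
      eLpNorm (G (v z.1) - G (v z.2)) (ENNReal.ofReal (s i)) (μ i)) Filter.atTop (nhds 0)) →
    ∃ w ∈ Z, ∀ i, Filter.Tendsto (fun k =>
      eLpNorm (G (v k) - G w) (ENNReal.ofReal (s i)) (μ i)) Filter.atTop (nhds 0)

/-- The total energy. -/
noncomputable def totalEnergy {X F ι : Type*} [MeasurableSpace X] [NormedAddCommGroup F]
    [Fintype ι] (μ : ι → Measure X) (σ : X → ℝ≥0 → ℝ≥0∞) (V : X → F) : ℝ :=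
  ∑ i, matEnergy (μ i) σ V

theorem totalEnergy_nonneg {X F ι : Type*} [MeasurableSpace X] [NormedAddCommGroup F] [Fintype ι]
    {μ : ι → Measure X} {σ : X → ℝ≥0 → ℝ≥0∞} (V : X → F) : 0 ≤ totalEnergy μ σ V :=
  Finset.sum_nonneg fun _ _ => matEnergy_nonneg _

/-- The total power. -/
noncomputable def totalPower {X F ι : Type*} [MeasurableSpace X] [NormedAddCommGroup F]
    [InnerProductSpace ℝ F] [Fintype ι] (μ : ι → Measure X) (σ : X → ℝ≥0 → ℝ≥0∞)
    (V W : X → F) : ℝ :=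
  ∑ i, matPower (μ i) σ V W

/-- `u` minimises the total energy in `g + Z`. -/
def IsFieldMinimizer {X Y F ι : Type*} [MeasurableSpace X] [NormedAddCommGroup F] [AddCommGroup Y]
    [Module ℝ Y] [Fintype ι] (μ : ι → Measure X) (σ : X → ℝ≥0 → ℝ≥0∞) (Z : Submodule ℝ Y)
    (G : Y → X → F) (g u : Y) : Prop :=
  u - g ∈ Z ∧ ∀ v, v - g ∈ Z → totalEnergy μ σ (G u) ≤ totalEnergy μ σ (G v)

namespace FieldSpace

variable {X Y F ι : Type*} [MeasurableSpace X] [NormedAddCommGroup F] [InnerProductSpace ℝ F]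
  [AddCommGroup Y] [Module ℝ Y] {μ : ι → Measure X}
  {s C κ : ι → ℝ} {T Z : Submodule ℝ Y} {G : Y → X → F} {σ : X → ℝ≥0 → ℝ≥0∞} {g u v w : Y}

theorem sub (hS : FieldSpace μ s T Z G) (i : ι) (hu : u ∈ T) (hv : v ∈ T) :
    G (u - v) =ᵐ[μ i] G u - G v := by
  have h := hS.add i u hu _ (T.smul_mem (-1) hv)
  rw [show u + (-1 : ℝ) • v = u - v by module] at h
  filter_upwards [h, hS.smul i (-1) v hv] with x hx hx'
  rw [hx, Pi.add_apply, hx', Pi.sub_apply, Pi.smul_apply]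
  module

theorem midpoint_sub_mem {g u v : Y} (hu : u - g ∈ Z) (hv : v - g ∈ Z) :
    (1 / 2 : ℝ) • (u + v) - g ∈ Z := by
  have e : (1 / 2 : ℝ) • (u + v) - g = (1 / 2 : ℝ) • ((u - g) + (v - g)) := by module
  rw [e]
  exact Z.smul_mem _ (Z.add_mem hu hv)

theorem mem_of_sub_mem (hS : FieldSpace μ s T Z G) (hg : g ∈ T) (hu : u - g ∈ Z) : u ∈ T := by
  simpa using T.add_mem (hS.le hu) hg

variable [Fintype ι]

theorem totalPower_congr_left {V V' W : X → F} (h : ∀ i, V =ᵐ[μ i] V') :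
    totalPower μ σ V W = totalPower μ σ V' W :=
  Finset.sum_congr rfl fun i _ => matPower_congr (h i) (by rfl)

theorem totalPower_congr {V W W' : X → F} (h : ∀ i, W =ᵐ[μ i] W') :
    totalPower μ σ V W = totalPower μ σ V W' :=
  Finset.sum_congr rfl fun i _ => matPower_congr (by rfl) (h i)

theorem totalPower_smul (hS : FieldSpace μ s T Z G) (V : X → F) (t : ℝ) (hv : v ∈ T) :
    totalPower μ σ V (G (t • v)) = t * totalPower μ σ V (G v) := by
  rw [totalPower_congr fun i => hS.smul i t v hv]
  simp only [totalPower, Finset.mul_sum]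
  exact Finset.sum_congr rfl fun i _ => PowerMaterial.matPower_smul _ _ _

variable [∀ i, IsFiniteMeasure (μ i)]

theorem totalPower_add (hS : FieldSpace μ s T Z G)
    (hm : ∀ i, PowerMaterial (μ i) F (s i) (C i) (κ i) σ) (hu : u ∈ T) (hv : v ∈ T) (hw : w ∈ T) :
    totalPower μ σ (G u) (G (v + w)) = totalPower μ σ (G u) (G v) + totalPower μ σ (G u) (G w) := by
  rw [totalPower_congr fun i => hS.add i v hv w hw]
  simp only [totalPower, ← Finset.sum_add_distrib]
  exact Finset.sum_congr rfl fun i _ =>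
    (hm i).matPower_add (hS.memLp i u hu) (hS.memLp i v hv) (hS.memLp i w hw)

theorem totalPower_sub_le (hS : FieldSpace μ s T Z G)
    (hm : ∀ i, PowerMaterial (μ i) F (s i) (C i) (κ i) σ) (hu : u ∈ T) (hv : v ∈ T) :
    totalPower μ σ (G u) (G (v - u)) ≤ totalEnergy μ σ (G v) - totalEnergy μ σ (G u) := by
  rw [totalPower_congr fun i => hS.sub i hv hu]
  simp only [totalPower, totalEnergy, ← Finset.sum_sub_distrib]
  exact Finset.sum_le_sum fun i _ => (hm i).matPower_sub_le (hS.memLp i u hu) (hS.memLp i v hv)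

theorem tendsto_totalPower (hS : FieldSpace μ s T Z G)
    (hm : ∀ i, PowerMaterial (μ i) F (s i) (C i) (κ i) σ) (hu : u ∈ T) (hv : v ∈ T) :
    Filter.Tendsto (fun ε : ℝ => totalPower μ σ (G (u + ε • v)) (G v)) (nhds 0)
      (nhds (totalPower μ σ (G u) (G v))) := by
  have e : ∀ ε : ℝ, totalPower μ σ (G (u + ε • v)) (G v) =
      totalPower μ σ (G u + ε • G v) (G v) := fun ε => by
    refine totalPower_congr_left fun i => ?_
    filter_upwards [hS.add i u hu _ (T.smul_mem ε hv), hS.smul i ε v hv] with x hx hx'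
    rw [hx, Pi.add_apply, hx', Pi.add_apply]
  simp only [e]
  exact tendsto_finsetSum _ fun i _ =>
    (hm i).tendsto_matPower (hS.memLp i u hu) (hS.memLp i v hv)

theorem exists_integral_sub_le (hS : FieldSpace μ s T Z G)
    (hm : ∀ i, PowerMaterial (μ i) F (s i) (C i) (κ i) σ) (i : ι) {δ : ℝ} (hδ : 0 < δ) :
    ∃ K : ℝ, 0 < K ∧ ∀ u ∈ T, ∀ v ∈ T, ∫ x, ‖G u x - G v x‖ ^ s i ∂μ i ≤
      δ * ((μ i).real univ + totalEnergy μ σ (G u) + totalEnergy μ σ (G v)) +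
        K * (totalEnergy μ σ (G u) + totalEnergy μ σ (G v) -
          2 * totalEnergy μ σ (G ((1 / 2 : ℝ) • (u + v)))) := by
  obtain ⟨K, hK, h⟩ := (hm i).exists_integral_norm_sub_le hδ
  refine ⟨K, hK, fun u hu v hv => (h _ _ (hS.memLp i u hu) (hS.memLp i v hv)).trans ?_⟩
  have e : totalEnergy μ σ (G ((1 / 2 : ℝ) • (u + v))) =
      totalEnergy μ σ ((1 / 2 : ℝ) • (G u + G v)) :=
    Finset.sum_congr rfl fun j _ => matEnergy_congr <| by
      filter_upwards [hS.smul j (1 / 2) _ (T.add_mem hu hv), hS.add j u hu v hv] with x hx hx'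
      rw [hx, Pi.smul_apply, hx', Pi.smul_apply]
  have l : ∀ w : Y, matEnergy (μ i) σ (G w) ≤ totalEnergy μ σ (G w) := fun w =>
    Finset.single_le_sum (f := fun j => matEnergy (μ j) σ (G w))
      (fun j _ => matEnergy_nonneg _) (Finset.mem_univ i)
  have l' : matEnergy (μ i) σ (G u) + matEnergy (μ i) σ (G v) -
      2 * matEnergy (μ i) σ ((1 / 2 : ℝ) • (G u + G v)) ≤ totalEnergy μ σ (G u) +
        totalEnergy μ σ (G v) - 2 * totalEnergy μ σ ((1 / 2 : ℝ) • (G u + G v)) := by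
    simp only [totalEnergy, Finset.mul_sum, ← Finset.sum_add_distrib, ← Finset.sum_sub_distrib]
    exact Finset.single_le_sum (f := fun j => matEnergy (μ j) σ (G u) + matEnergy (μ j) σ (G v) -
        2 * matEnergy (μ j) σ ((1 / 2 : ℝ) • (G u + G v)))
      (fun j _ => (hm j).matEnergy_midpoint_le (hS.memLp j u hu) (hS.memLp j v hv))
      (Finset.mem_univ i)
  rw [e]
  gcongr
  · exact l u
  · exact l v

/-- The midpoint of two almost minimizers is admissible, so its energy is at least the infimum and
the midpoint gap is small. Uniform convexity then makes a minimizing sequence Cauchy, and its limit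
is minimal by the subgradient inequality. -/
theorem exists_isFieldMinimizer (hS : FieldSpace μ s T Z G)
    (hm : ∀ i, PowerMaterial (μ i) F (s i) (C i) (κ i) σ) (hg : g ∈ T) :
    ∃ u, IsFieldMinimizer μ σ Z G g u := by
  set S : Set ℝ := (fun u => totalEnergy μ σ (G u)) '' {u | u - g ∈ Z} with hSdef
  have hne : S.Nonempty := ⟨_, g, by simp, rfl⟩
  have hbd : BddBelow S := ⟨0, by rintro _ ⟨u, _, rfl⟩; exact totalEnergy_nonneg _⟩
  set E := sInf S
  have hE : ∀ v, v - g ∈ Z → E ≤ totalEnergy μ σ (G v) := fun v hv => csInf_le hbd ⟨v, hv, rfl⟩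
  have hE0 : 0 ≤ E := le_csInf hne (by rintro _ ⟨u, _, rfl⟩; exact totalEnergy_nonneg _)
  have hseq : ∀ k : ℕ, ∃ u, u - g ∈ Z ∧ totalEnergy μ σ (G u) < E + 1 / ((k : ℝ) + 1) := by
    intro k
    obtain ⟨_, ⟨u, hu, rfl⟩, h⟩ := exists_lt_of_csInf_lt hne
      (show sInf S < E + 1 / ((k : ℝ) + 1) by
        have : 0 < 1 / ((k : ℝ) + 1) := by positivity
        linarith)
    exact ⟨u, hu, h⟩
  choose u hu hlt using hseq
  have huT : ∀ k, u k ∈ T := fun k => hS.mem_of_sub_mem hg (hu k)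
  have hlim : Filter.Tendsto (fun k : ℕ => 1 / ((k : ℝ) + 1)) Filter.atTop (nhds 0) :=
    tendsto_one_div_add_atTop_nhds_zero_nat
  have hcau : ∀ i, Filter.Tendsto (fun z : ℕ × ℕ =>
      eLpNorm (G (u z.1) - G (u z.2)) (ENNReal.ofReal (s i)) (μ i)) Filter.atTop (nhds 0) := by
    intro i
    refine tendsto_eLpNorm_of_integral_rpow (hm i).exponent_pos
      (fun z => (hS.memLp i _ (huT z.1)).sub (hS.memLp i _ (huT z.2))) ?_
    have hnn : ∀ z : ℕ × ℕ, 0 ≤ ∫ x, ‖(G (u z.1) - G (u z.2)) x‖ ^ s i ∂μ i := fun z =>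
      integral_nonneg fun x => by positivity
    rw [Metric.tendsto_nhds]
    intro ε hε
    -- `N` bounds the mass and the two energies, each at most `E + 1`. With `δ = ε / (2 N)` the
    -- remainder of uniform convexity is `ε / 2`, and the gap contributes a null sequence.
    set N := (μ i).real univ + (E + 1) + (E + 1) with hN
    have hN0 : 0 < N := by positivity
    obtain ⟨K, hK, h⟩ := hS.exists_integral_sub_le hm i (δ := ε / (2 * N)) (by positivity)
    have hz : Filter.Tendsto (fun z : ℕ × ℕ => ε / (2 * N) * N +
        K * (1 / ((z.1 : ℝ) + 1) + 1 / ((z.2 : ℝ) + 1))) Filter.atTop (nhds (ε / 2)) := by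
      have h₁ : Filter.Tendsto (fun z : ℕ × ℕ => 1 / ((z.1 : ℝ) + 1)) Filter.atTop (nhds 0) :=
        hlim.comp (Filter.prod_atTop_atTop_eq (α := ℕ) (β := ℕ) ▸ Filter.tendsto_fst)
      have h₂ : Filter.Tendsto (fun z : ℕ × ℕ => 1 / ((z.2 : ℝ) + 1)) Filter.atTop (nhds 0) :=
        hlim.comp (Filter.prod_atTop_atTop_eq (α := ℕ) (β := ℕ) ▸ Filter.tendsto_snd)
      have := ((h₁.add h₂).const_mul K).const_add (ε / (2 * N) * N)
      convert this using 2
      field_simp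
      ring
    filter_upwards [hz.eventually_lt_const (show ε / 2 < ε by linarith)] with z hz
    rw [Real.dist_0_eq_abs, abs_of_nonneg (hnn z)]
    refine lt_of_le_of_lt ?_ hz
    refine (h _ (huT z.1) _ (huT z.2)).trans ?_
    have a₁ := hlt z.1
    have a₂ := hlt z.2
    have b : ∀ k : ℕ, 1 / ((k : ℝ) + 1) ≤ 1 := fun k => by
      rw [div_le_one (by positivity)]; linarith [(k.cast_nonneg : (0 : ℝ) ≤ k)]
    have a₃ := hE _ (midpoint_sub_mem (hu z.1) (hu z.2))
    have b₁ := b z.1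
    have b₂ := b z.2
    gcongr
    · rw [hN]
      linarith
    · linarith
  obtain ⟨w, hw, hlimw⟩ := hS.complete (fun k => u k - g) hu fun i => by
    refine (hcau i).congr fun z => eLpNorm_congr_ae ?_
    filter_upwards [hS.sub i (huT z.1) hg, hS.sub i (huT z.2) hg] with x hx hx'
    simp [hx, hx']
  have hwT := hS.le hw
  have hT : w + g ∈ T := T.add_mem hwT hg
  have htend : ∀ i, Filter.Tendsto (fun k =>
      eLpNorm (G (u k - (w + g))) (ENNReal.ofReal (s i)) (μ i)) Filter.atTop (nhds 0) := fun i => by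
    refine (hlimw i).congr fun k => eLpNorm_congr_ae ?_
    have := hS.sub i (T.sub_mem (huT k) hg) hwT
    rw [show u k - g - w = u k - (w + g) by abel] at this
    exact this.symm
  refine ⟨w + g, by simpa using hw, fun v hv => le_trans ?_ (hE v hv)⟩
  -- Lower semicontinuity from convexity: the energy of the limit is at most that of `u k` minus the
  -- power of the limit field against the difference, and this power tends to `0`.
  have hP : Filter.Tendsto (fun k => totalPower μ σ (G (w + g)) (G (u k - (w + g))))
      Filter.atTop (nhds 0) := by
    rw [show (0 : ℝ) = ∑ _i : ι, 0 by simp]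
    refine tendsto_finsetSum _ fun i _ => ?_
    refine squeeze_zero_norm (fun k => (hm i).abs_matPower_le (hS.memLp i _ hT)
      (hS.memLp i _ (T.sub_mem (huT k) hT))) ?_
    have := ((ENNReal.tendsto_toReal ENNReal.zero_ne_top).comp (htend i)).const_mul
      (eLpNorm (fun x => vecFlux (σ x) (G (w + g) x)) (ENNReal.ofReal (s i).conjExponent)
        (μ i)).toReal
    simpa using this
  have hl : Filter.Tendsto (fun k : ℕ => E + 1 / ((k : ℝ) + 1) -
      totalPower μ σ (G (w + g)) (G (u k - (w + g)))) Filter.atTop (nhds E) := by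
    simpa using (hlim.const_add E).sub hP
  refine ge_of_tendsto' hl fun k => ?_
  have := hS.totalPower_sub_le hm hT (huT k)
  linarith [hlt k]

/-- Between two minimizers the midpoint gap is nonpositive, so uniform convexity leaves only the
remainder with arbitrarily small `δ`. -/
theorem ae_eq_of_isFieldMinimizer (hS : FieldSpace μ s T Z G)
    (hm : ∀ i, PowerMaterial (μ i) F (s i) (C i) (κ i) σ) (hg : g ∈ T)
    (hu : IsFieldMinimizer μ σ Z G g u) (hv : IsFieldMinimizer μ σ Z G g v) (i : ι) :
    G u =ᵐ[μ i] G v := by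
  have huT := hS.mem_of_sub_mem hg hu.1
  have hvT := hS.mem_of_sub_mem hg hv.1
  have hmid := hu.2 _ (midpoint_sub_mem hu.1 hv.1)
  have hmid' := hv.2 _ (midpoint_sub_mem hu.1 hv.1)
  have hd : MemLp (G u - G v) (ENNReal.ofReal (s i)) (μ i) :=
    (hS.memLp i u huT).sub (hS.memLp i v hvT)
  have h0 : ∫ x, ‖G u x - G v x‖ ^ s i ∂μ i ≤ 0 := by
    set N := (μ i).real univ + totalEnergy μ σ (G u) + totalEnergy μ σ (G v) + 1 with hN
    have e₁ : 0 ≤ totalEnergy μ σ (G u) := totalEnergy_nonneg _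
    have e₂ : 0 ≤ totalEnergy μ σ (G v) := totalEnergy_nonneg _
    have hN0 : 0 < N := by positivity
    refine le_of_forall_pos_le_add fun ε hε => ?_
    obtain ⟨K, hK, h⟩ := hS.exists_integral_sub_le hm i (δ := ε / N) (by positivity)
    refine (h u huT v hvT).trans ?_
    have h₁ : ε / N * ((μ i).real univ + totalEnergy μ σ (G u) + totalEnergy μ σ (G v)) ≤
        ε / N * N := by
      gcongr
      linarith
    rw [div_mul_cancel₀ _ hN0.ne'] at h₁
    have h₂ : K * (totalEnergy μ σ (G u) + totalEnergy μ σ (G v) -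
          2 * totalEnergy μ σ (G ((1 / 2 : ℝ) • (u + v)))) ≤ 0 :=
      mul_nonpos_of_nonneg_of_nonpos hK.le (by linarith)
    linarith
  have h1 : ∫ x, ‖G u x - G v x‖ ^ s i ∂μ i = 0 :=
    le_antisymm h0 (integral_nonneg fun x => by positivity)
  replace h1 := (integral_eq_zero_iff_of_nonneg (fun x => by positivity)
    ((hm i).integrable_norm_rpow hd)).1 h1
  filter_upwards [h1] with x hx
  have := (Real.rpow_eq_zero (norm_nonneg _) (hm i).exponent_pos.ne').1 hx
  exact sub_eq_zero.1 (norm_eq_zero.1 this)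

/-- Minimality of `u` against `u + ε v`, with the subgradient inequality at `u + ε v`, makes the
power of the perturbed field nonnegative for `ε > 0`; then `ε` tends to `0`. Applied to `-v` as
well, this gives the Euler–Lagrange equation. -/
theorem totalPower_nonneg_of_isFieldMinimizer (hS : FieldSpace μ s T Z G)
    (hm : ∀ i, PowerMaterial (μ i) F (s i) (C i) (κ i) σ) (hg : g ∈ T)
    (hu : IsFieldMinimizer μ σ Z G g u) (hv : v ∈ Z) : 0 ≤ totalPower μ σ (G u) (G v) := by
  have huT := hS.mem_of_sub_mem hg hu.1
  have hvT := hS.le hv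
  refine ge_of_tendsto ((hS.tendsto_totalPower hm huT hvT).mono_left
    (nhdsWithin_le_nhds (s := Ioi 0))) ?_
  filter_upwards [self_mem_nhdsWithin] with ε (hε : 0 < ε)
  have h₁ := hu.2 (u + ε • v) (by
    rw [show u + ε • v - g = (u - g) + ε • v by abel]
    exact Z.add_mem hu.1 (Z.smul_mem _ hv))
  have h₂ := hS.totalPower_sub_le hm (T.add_mem huT (T.smul_mem ε hvT)) huT
  rw [show u - (u + ε • v) = (-ε) • v by module, hS.totalPower_smul _ _ hvT] at h₂
  have h₃ : 0 ≤ ε * totalPower μ σ (G (u + ε • v)) (G v) := by linarith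
  exact nonneg_of_mul_nonneg_right h₃ hε

/-- The Euler–Lagrange equation. -/
theorem totalPower_eq_zero (hS : FieldSpace μ s T Z G)
    (hm : ∀ i, PowerMaterial (μ i) F (s i) (C i) (κ i) σ) (hg : g ∈ T)
    (hu : IsFieldMinimizer μ σ Z G g u) (hv : v ∈ Z) : totalPower μ σ (G u) (G v) = 0 := by
  have h₁ := hS.totalPower_nonneg_of_isFieldMinimizer hm hg hu hv
  have h₂ := hS.totalPower_nonneg_of_isFieldMinimizer hm hg hu (Z.smul_mem (-1) hv)
  rw [hS.totalPower_smul _ _ (hS.le hv)] at h₂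
  linarith

theorem totalPower_eq_of_sub_mem (hS : FieldSpace μ s T Z G)
    (hm : ∀ i, PowerMaterial (μ i) F (s i) (C i) (κ i) σ) (hg : g ∈ T)
    (hu : IsFieldMinimizer μ σ Z G g u) (hw : w ∈ T) (hv : v - w ∈ Z) :
    totalPower μ σ (G u) (G v) = totalPower μ σ (G u) (G w) := by
  have := hS.totalPower_add hm (hS.mem_of_sub_mem hg hu.1) (hS.le hv) hw
  rwa [sub_add_cancel, hS.totalPower_eq_zero hm hg hu hv, zero_add] at this

/-- The derivative of the minimal energy with respect to the data. -/
theorem hasDerivAt_totalEnergy (hS : FieldSpace μ s T Z G)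
    (hm : ∀ i, PowerMaterial (μ i) F (s i) (C i) (κ i) σ) (hg : g ∈ T) (hv : v ∈ T)
    {u : ℝ → Y} (hu : ∀ ε, IsFieldMinimizer μ σ Z G (g + ε • v) (u ε)) :
    HasDerivAt (fun ε => totalEnergy μ σ (G (u ε))) (totalPower μ σ (G (u 0)) (G v)) 0 := by
  have hu0 : IsFieldMinimizer μ σ Z G g (u 0) := by simpa using hu 0
  have h0T := hS.mem_of_sub_mem hg hu0.1
  have huT : ∀ ε, u ε ∈ T := fun ε =>
    hS.mem_of_sub_mem (T.add_mem hg (T.smul_mem ε hv)) (hu ε).1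
  set L := totalPower μ σ (G (u 0)) (G v)
  -- From below: the subgradient inequality at `u 0`. As `u ε - u 0 - ε v` lies in `Z`, the
  -- Euler–Lagrange equation turns the power into `ε * L`.
  have hlow : ∀ ε : ℝ, 0 ≤ totalEnergy μ σ (G (u ε)) - totalEnergy μ σ (G (u 0)) - ε * L := by
    intro ε
    have h₁ := hS.totalPower_sub_le hm h0T (huT ε)
    have h₂ : totalPower μ σ (G (u 0)) (G (u ε - u 0)) = totalPower μ σ (G (u 0)) (G (ε • v)) := by
      refine hS.totalPower_eq_of_sub_mem hm hg hu0 (T.smul_mem ε hv) ?_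
      rw [show u ε - u 0 - ε • v = (u ε - (g + ε • v)) - (u 0 - g) by abel]
      exact Z.sub_mem (hu ε).1 hu0.1
    rw [h₂, hS.totalPower_smul _ _ hv] at h₁
    linarith
  -- From above: `u 0 + ε v` is a competitor for the perturbed data, and the subgradient inequality
  -- is based at this competitor.
  have hup : ∀ ε : ℝ, totalEnergy μ σ (G (u ε)) - totalEnergy μ σ (G (u 0)) - ε * L ≤
      ε * (totalPower μ σ (G (u 0 + ε • v)) (G v) - L) := by
    intro ε
    have h₁ := (hu ε).2 (u 0 + ε • v) (by
      rw [show u 0 + ε • v - (g + ε • v) = u 0 - g by abel]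
      exact hu0.1)
    have h₂ := hS.totalPower_sub_le hm (T.add_mem h0T (T.smul_mem ε hv)) h0T
    rw [show u 0 - (u 0 + ε • v) = (-ε) • v by module, hS.totalPower_smul _ _ hv] at h₂
    linarith
  rw [hasDerivAt_iff_isLittleO, Asymptotics.isLittleO_iff]
  intro c hc
  have ht := (hS.tendsto_totalPower hm h0T hv).eventually (Metric.ball_mem_nhds L hc)
  filter_upwards [ht] with ε hε
  rw [Real.dist_eq] at hε
  simp only [sub_zero, smul_eq_mul, Real.norm_eq_abs]
  rw [abs_of_nonneg (hlow ε)]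
  calc _ ≤ ε * (totalPower μ σ (G (u 0 + ε • v)) (G v) - L) := hup ε
    _ ≤ |ε * (totalPower μ σ (G (u 0 + ε • v)) (G v) - L)| := le_abs_self _
    _ = |totalPower μ σ (G (u 0 + ε • v)) (G v) - L| * |ε| := by rw [abs_mul, mul_comm]
    _ ≤ c * |ε| := by gcongr

end FieldSpace

/-! ### Boundary cutoffs and zero boundary values. -/

/-- A smooth function, bounded with its gradient, which is `1` off a compact subset of `Ω` and
vanishes near the points of `Ω` outside of `D`. -/
structure IsBoundaryCutoff {n : ℕ} (Ω D : Set (Euc n)) (c : ℝ) (χ : Euc n → ℝ) : Prop where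
  contDiff : ContDiff ℝ ∞ χ
  abs_le : ∀ x, |χ x| ≤ c
  norm_gradient_le : ∀ x, ‖gradient χ x‖ ≤ c
  subset : tsupport χ ∩ Ω ⊆ D
  hasCompactSupport : HasCompactSupport (1 - χ)
  support_subset : tsupport (1 - χ) ⊆ Ω

section

variable {n : ℕ} {Ω D U : Set (Euc n)} {χ u : Euc n → ℝ} {V : Euc n → Euc n} {s c : ℝ}

theorem exists_isBoundaryCutoff (hΩ : IsOpen Ω) {K : Set (Euc n)} (hK : IsCompact K)
    (hKΩ : K ⊆ Ω) : ∃ c χ, IsBoundaryCutoff Ω (Ω \ K) c χ := by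
  obtain ⟨θ, h₁, h₂, h₃, h₄⟩ := exists_smooth_cutoff hK hΩ hKΩ
  have hd : Disjoint (tsupport (1 - θ)) K := by
    rw [Set.disjoint_left]
    intro x hx hxK
    refine (notMem_tsupport_iff_eventuallyEq.2 ?_) hx
    filter_upwards [h₄.filter_mono (nhds_le_nhdsSet hxK)] with y hy
    simp [hy]
  have hs : ContDiff ℝ ∞ (1 - θ) := contDiff_const.sub h₁
  obtain ⟨c₁, hc₁⟩ := h₂.exists_bound_of_continuous h₁.continuous
  obtain ⟨c₂, hc₂⟩ := (hasCompactSupport_gradient h₂).exists_bound_of_continuous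
    (continuous_gradient h₁ (by simp))
  have e : (1 : Euc n → ℝ) - (1 - θ) = θ := by simp
  refine ⟨max (1 + c₁) c₂, 1 - θ, ⟨hs, fun x => ?_, fun x => ?_, ?_, by rwa [e], by rwa [e]⟩⟩
  · refine le_trans ?_ (le_max_left _ _)
    have := abs_sub (1 : ℝ) (θ x)
    rw [abs_one] at this
    have h' := hc₁ x
    rw [Real.norm_eq_abs] at h'
    simp only [Pi.sub_apply, Pi.one_apply]
    linarith
  · refine le_trans ?_ (le_max_right _ _)
    rw [gradient_sub (by fun_prop) (h₁.differentiable (by simp) x)]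
    have : gradient (1 : Euc n → ℝ) x = 0 := gradient_fun_const x (1 : ℝ)
    rw [this, zero_sub, norm_neg]
    exact hc₂ x
  · rintro x ⟨hx, hxΩ⟩
    exact ⟨hxΩ, Set.disjoint_left.1 hd hx⟩

theorem gradient_eq_zero_of_notMem {x : Euc n} (hx : x ∉ tsupport χ) : gradient χ x = 0 :=
  image_eq_zero_of_notMem_tsupport fun h => hx (tsupport_gradient_subset χ h)

/-- The product of a weakly differentiable function with a smooth function is weakly
differentiable on larger sets, as long as these meet the support of the smooth function in the
original set. -/
theorem IsWeakGrad.mul_smooth_extend (hD : IsOpen D) (h : IsWeakGrad D u V)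
    (hχ : ContDiff ℝ ∞ χ) (hs : tsupport χ ∩ Ω ⊆ D) :
    IsWeakGrad Ω (χ * u) (fun x => χ x • V x + u x • gradient χ x) := by
  have hm := h.mul_smooth hD hχ
  have hloc : ∀ {G : Type} [NormedAddCommGroup G] (f : Euc n → G), LocallyIntegrableOn f D →
      (∀ x, x ∉ tsupport χ → f x = 0) → LocallyIntegrableOn f Ω := by
    intro G _ f hf h0 x hx
    by_cases hxs : x ∈ tsupport χ
    · have := hf x (hs ⟨hxs, hx⟩)
      rw [(hD.nhdsWithin_eq (hs ⟨hxs, hx⟩))] at this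
      exact this.filter_mono nhdsWithin_le_nhds
    · refine ⟨(tsupport χ)ᶜ, mem_nhdsWithin_of_mem_nhds
        ((isClosed_tsupport χ).isOpen_compl.mem_nhds hxs), ?_⟩
      exact integrableOn_zero.congr_fun (fun y hy => (h0 y hy).symm)
        (isClosed_tsupport χ).isOpen_compl.measurableSet
  refine .of_integral (hloc _ hm.1 fun x hx => ?_) (hloc _ hm.2 fun x hx => ?_) fun η a b d => ?_
  · simp [image_eq_zero_of_notMem_tsupport hx]
  · simp [image_eq_zero_of_notMem_tsupport hx, gradient_eq_zero_of_notMem hx]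
  -- The supports of `χ` and `η` meet in a compact subset of `D`. With `θ = 1` near it, `θ * η` is a
  -- test function on `D` that gives the same integrals as `η`.
  obtain ⟨θ, h₁, h₂, h₃, h₄⟩ := exists_smooth_cutoff
    (b.isCompact.inter_left (isClosed_tsupport χ)) hD
    (fun x hx => hs ⟨hx.1, d hx.2⟩)
  have key : ∀ x, x ∈ tsupport χ → x ∈ tsupport η →
      θ x = 1 ∧ gradient (θ * η) x = gradient η x := by
    intro x hx hx'
    have hev := h₄.filter_mono (nhds_le_nhdsSet (show x ∈ tsupport χ ∩ tsupport η from ⟨hx, hx'⟩))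
    refine ⟨hev.self_of_nhds, ?_⟩
    have : θ * η =ᶠ[nhds x] η := hev.mono fun y hy => by simp [hy]
    rw [gradient, gradient, this.fderiv_eq]
  have e := hm.integral_smul_gradient (h₁.mul a) h₂.mul_right
    ((closure_mono (Function.support_mul_subset_left _ _)).trans h₃)
  change ∫ x, (χ * u) x • gradient (θ * η) x = _ at e
  have e₁ : ∀ x, (χ * u) x • gradient (θ * η) x = (χ * u) x • gradient η x := fun x => by
    by_cases hx : x ∈ tsupport χ
    · by_cases hx' : x ∈ tsupport η
      · rw [(key x hx hx').2]
      · rw [gradient_eq_zero_of_notMem hx', gradient_eq_zero_of_notMem (χ := θ * η) fun h => hx'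
          ((closure_mono (Function.support_mul_subset_right _ _)) h)]
    · simp [image_eq_zero_of_notMem_tsupport hx]
  have e₂ : ∀ x, (θ * η) x • (χ x • V x + u x • gradient χ x) =
      η x • (χ x • V x + u x • gradient χ x) := fun x => by
    by_cases hx : x ∈ tsupport χ
    · by_cases hx' : x ∈ tsupport η
      · simp [(key x hx hx').1]
      · simp [image_eq_zero_of_notMem_tsupport hx']
    · simp [image_eq_zero_of_notMem_tsupport hx, gradient_eq_zero_of_notMem hx]
  simp_rw [e₁] at e
  rw [e]
  congr 1
  exact integral_congr_ae (.of_forall e₂)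

theorem ae_eq_indicator_of_eq_zero {G : Type*} [NormedAddCommGroup G] {f : Euc n → G}
    (hΩ : MeasurableSet Ω) (h : ∀ x, x ∈ Ω → x ∉ D → f x = 0) :
    D.indicator f =ᵐ[volume.restrict Ω] f :=
  (ae_restrict_iff' hΩ).2 <| .of_forall fun x hx => by
    by_cases hxD : x ∈ D
    · simp [hxD]
    · simp [hxD, h x hx hxD]

theorem eLpNorm_restrict_eq_of_eq_zero {G : Type*} [NormedAddCommGroup G] {f : Euc n → G}
    {p : ℝ≥0∞} (hD : MeasurableSet D) (hΩ : MeasurableSet Ω) (hDΩ : D ⊆ Ω)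
    (h : ∀ x, x ∈ Ω → x ∉ D → f x = 0) :
    eLpNorm f p (volume.restrict Ω) = eLpNorm f p (volume.restrict D) := by
  rw [← eLpNorm_congr_ae (ae_eq_indicator_of_eq_zero hΩ h), eLpNorm_indicator_eq_eLpNorm_restrict hD,
    Measure.restrict_restrict hD, inter_eq_left.2 hDΩ]

theorem memLp_restrict_iff_of_eq_zero {G : Type*} [NormedAddCommGroup G] {f : Euc n → G}
    {p : ℝ≥0∞} (hD : MeasurableSet D) (hΩ : MeasurableSet Ω) (hDΩ : D ⊆ Ω)
    (h : ∀ x, x ∈ Ω → x ∉ D → f x = 0) :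
    MemLp f p (volume.restrict Ω) ↔ MemLp f p (volume.restrict D) := by
  rw [← memLp_congr_ae (ae_eq_indicator_of_eq_zero hΩ h), memLp_indicator_iff_restrict hD,
    Measure.restrict_restrict hD, inter_eq_left.2 hDΩ]

namespace IsBoundaryCutoff

theorem mono {D' : Set (Euc n)} (h : IsBoundaryCutoff Ω D c χ) (hD : D ⊆ D') :
    IsBoundaryCutoff Ω D' c χ :=
  { h with subset := h.subset.trans hD }

theorem eq_one (x : Euc n) (hx : x ∉ tsupport (1 - χ)) : χ x = 1 := by
  have := image_eq_zero_of_notMem_tsupport hx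
  simp only [Pi.sub_apply, Pi.one_apply] at this
  linarith

theorem mem_of_notMem (h : IsBoundaryCutoff Ω D c χ) {x : Euc n} (hx : x ∈ Ω)
    (hx' : x ∉ tsupport (1 - χ)) : x ∈ D :=
  h.subset ⟨subset_tsupport _ (by simp [eq_one x hx']), hx⟩

theorem memW (h : IsBoundaryCutoff Ω D c χ) (hD : IsOpen D) (hΩ : IsOpen Ω) (hDΩ : D ⊆ Ω)
    (hu : MemW s D u) : MemW s Ω (χ * u) := by
  have h0 : ∀ x, x ∈ Ω → x ∉ D → χ x = 0 ∧ gradient χ x = 0 := fun x hx hxD =>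
    have hx' : x ∉ tsupport χ := fun hs => hxD (h.subset ⟨hs, hx⟩)
    ⟨image_eq_zero_of_notMem_tsupport hx', gradient_eq_zero_of_notMem hx'⟩
  have hg := hu.memLp_weakGrad hD
  have m : ∀ {G : Type} [NormedAddCommGroup G] [NormedSpace ℝ G] {a : Euc n → ℝ} {f : Euc n → G},
      Continuous a → (∀ x, |a x| ≤ c) → MemLp f (ENNReal.ofReal s) (volume.restrict D) →
      MemLp (fun x => a x • f x) (ENNReal.ofReal s) (volume.restrict D) := fun ha hb hf =>
    hf.of_le_mul (ha.aestronglyMeasurable.smul hf.1) (.of_forall fun x => by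
      rw [norm_smul, Real.norm_eq_abs]
      gcongr
      exact hb x)
  refine ⟨?_, _, hu.isWeakGrad.mul_smooth_extend hD h.contDiff h.subset, ?_⟩
  · rw [memLp_restrict_iff_of_eq_zero hD.measurableSet hΩ.measurableSet hDΩ
      fun x hx hxD => by simp [(h0 x hx hxD).1]]
    exact m h.contDiff.continuous h.abs_le hu.1
  · rw [memLp_restrict_iff_of_eq_zero hD.measurableSet hΩ.measurableSet hDΩ
      fun x hx hxD => by simp [h0 x hx hxD]]
    refine (m h.contDiff.continuous h.abs_le hg).add ?_
    refine hu.1.of_le_mul (c := c) (hu.1.1.smul (continuous_gradient h.contDiff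
      (by simp)).aestronglyMeasurable) (.of_forall fun x => ?_)
    rw [norm_smul, mul_comm]
    gcongr
    exact h.norm_gradient_le x

theorem eLpNorm_mul_le (h : IsBoundaryCutoff Ω D c χ) (hD : IsOpen D) (hΩ : IsOpen Ω) (hDΩ : D ⊆ Ω)
    (u : Euc n → ℝ) (p : ℝ≥0∞) :
    eLpNorm (χ * u) p (volume.restrict Ω) ≤
      ENNReal.ofReal c * eLpNorm u p (volume.restrict D) := by
  rw [eLpNorm_restrict_eq_of_eq_zero hD.measurableSet hΩ.measurableSet hDΩ fun x hx hxD => by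
    simp [image_eq_zero_of_notMem_tsupport fun hs => hxD (h.subset ⟨hs, hx⟩)]]
  refine eLpNorm_le_mul_eLpNorm_of_ae_le_mul (.of_forall fun x => ?_) _
  rw [Pi.mul_apply, norm_mul, Real.norm_eq_abs]
  gcongr
  exact h.abs_le x

theorem eLpNorm_weakGrad_le (h : IsBoundaryCutoff Ω D c χ) (hs : 1 ≤ s) (hD : IsOpen D)
    (hΩ : IsOpen Ω) (hDΩ : D ⊆ Ω) (hu : MemW s D u) :
    eLpNorm (weakGrad Ω (χ * u)) (ENNReal.ofReal s) (volume.restrict Ω) ≤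
      ENNReal.ofReal c * (eLpNorm u (ENNReal.ofReal s) (volume.restrict D) +
        eLpNorm (weakGrad D u) (ENNReal.ofReal s) (volume.restrict D)) := by
  have hg := hu.memLp_weakGrad hD
  rw [eLpNorm_congr_ae ((hu.isWeakGrad.mul_smooth_extend hD h.contDiff
      h.subset).weakGrad_ae_eq hΩ), eLpNorm_restrict_eq_of_eq_zero hD.measurableSet
      hΩ.measurableSet hDΩ fun x hx hxD => by
    have hx' : x ∉ tsupport χ := fun hs => hxD (h.subset ⟨hs, hx⟩)
    simp [image_eq_zero_of_notMem_tsupport hx', gradient_eq_zero_of_notMem hx']]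
  refine (eLpNorm_add_le (h.contDiff.continuous.aestronglyMeasurable.smul hg.1)
    (hu.1.1.smul (continuous_gradient h.contDiff (by simp)).aestronglyMeasurable)
    (by simpa using hs)).trans ?_
  rw [mul_add, add_comm]
  gcongr
  · refine eLpNorm_le_mul_eLpNorm_of_ae_le_mul (.of_forall fun x => ?_) _
    rw [Pi.smul_apply', norm_smul, mul_comm]
    gcongr
    exact h.norm_gradient_le x
  · refine eLpNorm_le_mul_eLpNorm_of_ae_le_mul (.of_forall fun x => ?_) _
    rw [Pi.smul_apply', norm_smul, Real.norm_eq_abs]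
    gcongr
    exact h.abs_le x

/-- The part of a Sobolev function that is cut off has zero boundary values. -/
theorem memW0_sub (h : IsBoundaryCutoff Ω D c χ) (hs : 1 ≤ s) (hΩ : IsOpen Ω) (hDΩ : D ⊆ Ω)
    (hu : MemW s Ω u) : MemW0 s Ω (u - χ * u) := by
  refine .of_ae_eq_zero hΩ hs (hu.sub hΩ ((h.mono hDΩ).memW hΩ hΩ subset_rfl hu))
    h.hasCompactSupport h.support_subset ?_
  refine (ae_restrict_iff' (hΩ.measurableSet.diff (isClosed_tsupport _).measurableSet)).2
    (.of_forall fun x hx => ?_)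
  simp [eq_one x hx.2]

/-- The removed part `u - χ u` has compact support in `Ω` and hence lies in `W_0`. The condition on
`χ u` still has a meaning when `u` is given on `B` only. -/
theorem memW0_mul_iff (h : IsBoundaryCutoff Ω D c χ) (hs : 1 ≤ s) (hΩ : IsOpen Ω) (hDΩ : D ⊆ Ω)
    (hu : MemW s Ω u) : MemW0 s Ω (χ * u) ↔ MemW0 s Ω u := by
  have := h.memW0_sub hs hΩ hDΩ hu
  refine ⟨fun h' => ?_, fun h' => ?_⟩
  · simpa using this.add hΩ hs h'
  · simpa using h'.sub hΩ hs this

end IsBoundaryCutoff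

end

/-! ### A common description of the four regimes. -/

namespace Conductor

variable {n : ℕ}

/-- The region occupied by an inner material with `q`-growth. -/
def inner (M : Conductor n) : Regime → Set (Euc n)
  | .twoPhase => M.A
  | _ => ∅

/-- The region in which potentials are locally constant. -/
def rigid (M : Conductor n) : Regime → Set (Euc n)
  | .perfect => M.A
  | _ => ∅

/-- The exponent of integrability of the potentials. -/
noncomputable def exponent (M : Conductor n) : Regime → ℝ
  | .twoPhase => min M.p M.q
  | _ => M.p

/-- The regions of finite conductivity. -/
def phase (M : Conductor n) (c : Regime) : Bool → Set (Euc n)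
  | true => M.B
  | false => M.inner c

/-- The growth exponents in these regions. -/
def phaseExponent (M : Conductor n) : Bool → ℝ
  | true => M.p
  | false => M.q

/-- The measures on the regions of finite conductivity. -/
noncomputable def phaseMeasure (M : Conductor n) (c : Regime) (b : Bool) : Measure (Euc n) :=
  volume.restrict (M.phase c b)

/-- The standing assumptions on the geometry and on the exponents. -/
structure Admissible (M : Conductor n) (c : Regime) : Prop extends M.Geometry where
  pos : 0 < n
  one_lt_p : 1 < M.p
  one_lt_q : 1 < M.q
  eq_empty : c = .homogeneous → M.A = ∅

namespace Admissible

variable {M : Conductor n} {c : Regime}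

theorem isOpen_B (h : M.Admissible c) : IsOpen M.B := h.isOpen.sdiff isClosed_closure

theorem B_subset : M.B ⊆ M.Ω := sdiff_subset

theorem A_subset (h : M.Admissible c) : M.A ⊆ M.Ω := subset_closure.trans h.inner_subset

theorem isCompact_closure (h : M.Admissible c) : IsCompact (closure M.A) :=
  Metric.isCompact_of_isClosed_isBounded isClosed_closure (h.isBounded.subset h.inner_subset)

theorem isOpen_domain (h : M.Admissible c) : IsOpen (M.domain c) := by
  cases c <;> first | exact h.isOpen | exact h.isOpen_B

theorem domain_subset : M.domain c ⊆ M.Ω := by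
  cases c <;> first | exact subset_rfl | exact B_subset

theorem B_subset_domain : M.B ⊆ M.domain c := by
  cases c <;> first | exact subset_rfl | exact B_subset

theorem isOpen_inner (h : M.Admissible c) : IsOpen (M.inner c) := by
  cases c <;> first | exact h.inner_isOpen | exact isOpen_empty

theorem isOpen_rigid (h : M.Admissible c) : IsOpen (M.rigid c) := by
  cases c <;> first | exact h.inner_isOpen | exact isOpen_empty

theorem inner_subset_domain (h : M.Admissible c) : M.inner c ⊆ M.domain c := by
  cases c <;> first | exact h.A_subset | exact empty_subset _

theorem rigid_subset_domain (h : M.Admissible c) : M.rigid c ⊆ M.domain c := by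
  cases c <;> first | exact h.A_subset | exact empty_subset _

theorem rigid_subset_A : M.rigid c ⊆ M.A := by
  cases c <;> first | exact subset_rfl | exact empty_subset _

theorem inner_subset_A : M.inner c ⊆ M.A := by
  cases c <;> first | exact subset_rfl | exact empty_subset _

theorem volume_ne_top (h : M.Admissible c) : volume M.Ω ≠ ⊤ := h.isBounded.measure_lt_top.ne

theorem volume_domain_ne_top (h : M.Admissible c) : volume (M.domain c) ≠ ⊤ :=
  ((measure_mono domain_subset).trans_lt h.volume_ne_top.lt_top).ne

theorem isFiniteMeasure (h : M.Admissible c) {S : Set (Euc n)} (hS : S ⊆ M.domain c) :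
    IsFiniteMeasure (volume.restrict S) :=
  ⟨by simpa using (measure_mono hS).trans_lt h.volume_domain_ne_top.lt_top⟩

theorem phase_subset_domain (h : M.Admissible c) (b : Bool) : M.phase c b ⊆ M.domain c := by
  cases b
  · exact h.inner_subset_domain
  · exact B_subset_domain

theorem isOpen_phase (h : M.Admissible c) (b : Bool) : IsOpen (M.phase c b) := by
  cases b
  · exact h.isOpen_inner
  · exact h.isOpen_B

theorem isFiniteMeasure_phaseMeasure (h : M.Admissible c) (b : Bool) :
    IsFiniteMeasure (M.phaseMeasure c b) :=
  h.isFiniteMeasure (h.phase_subset_domain b)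

theorem one_lt_exponent (h : M.Admissible c) : 1 < M.exponent c := by
  cases c <;> first | exact h.one_lt_p | exact lt_min h.one_lt_p h.one_lt_q

theorem exponent_le_p : M.exponent c ≤ M.p := by
  cases c <;> first | exact le_rfl | exact min_le_left _ _

theorem exponent_le_q (hi : M.inner c ≠ ∅) : M.exponent c ≤ M.q := by
  cases c <;> first | exact absurd rfl hi | exact min_le_right _ _

theorem volume_frontier (h : M.Admissible c) : volume (frontier M.A) = 0 :=
  volume_frontier_eq_zero h.inner_isOpen h.inner_lipschitz

/-- The pieces miss at most `∂A`, a null set because `A` has Lipschitz boundary. -/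
theorem domain_ae_eq (h : M.Admissible c) :
    M.domain c =ᵐ[volume] (M.B ∪ M.inner c ∪ M.rigid c : Set (Euc n)) := by
  have key : M.Ω =ᵐ[volume] (M.B ∪ M.A : Set (Euc n)) := by
    filter_upwards [measure_eq_zero_iff_ae_notMem.1 h.volume_frontier] with x hx
    rw [h.inner_isOpen.frontier_eq] at hx
    refine propext ⟨fun hxΩ => ?_, fun hx' => hx'.elim (fun a => B_subset a) fun a => h.A_subset a⟩
    by_cases hA : x ∈ closure M.A
    · exact .inr (not_not.1 fun hn => hx ⟨hA, hn⟩)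
    · exact .inl ⟨hxΩ, hA⟩
  cases c
  · have hA := h.eq_empty rfl
    simpa [inner, rigid, domain, hA] using key
  · simpa [inner, rigid, domain] using key
  · simp only [inner, rigid, domain, union_empty]
    exact .rfl
  · simpa [inner, rigid, domain] using key

theorem disjoint_B_A : Disjoint M.B M.A :=
  Set.disjoint_left.2 fun _ hx hA => hx.2 (subset_closure hA)

theorem restrict_energyRegion (h : M.Admissible c) :
    (volume.restrict (M.energyRegion c) : Measure (Euc n)) =
      M.phaseMeasure c true + M.phaseMeasure c false := by
  have e : M.energyRegion c =ᵐ[volume] (M.B ∪ M.inner c : Set (Euc n)) := by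
    cases c
    · simpa [energyRegion, inner, rigid, domain] using h.domain_ae_eq
    · simpa [energyRegion, inner, rigid, domain] using h.domain_ae_eq
    · simp only [energyRegion, inner, union_empty]
      exact .rfl
    · simp only [energyRegion, inner, union_empty]
      exact .rfl
  rw [Measure.restrict_congr_set e, Measure.restrict_union (disjoint_B_A.mono_right inner_subset_A)
    h.isOpen_inner.measurableSet]
  rfl

/-- Norms on the domain are controlled by those on the regions of finite conductivity. -/
theorem exists_eLpNorm_le (h : M.Admissible c) :
    ∃ C : ℝ≥0∞, C ≠ ⊤ ∧ ∀ V : Euc n → Euc n, AEStronglyMeasurable V (volume.restrict (M.domain c)) →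
      (∀ᵐ x ∂volume.restrict (M.rigid c), V x = 0) →
      eLpNorm V (ENNReal.ofReal (M.exponent c)) (volume.restrict (M.domain c)) ≤
        C * ∑ b, eLpNorm V (ENNReal.ofReal (M.phaseExponent b)) (M.phaseMeasure c b) := by
  have hm := h.one_lt_exponent
  have hu : ∀ (S S' : Set (Euc n)) (V : Euc n → Euc n),
      eLpNorm V (ENNReal.ofReal (M.exponent c)) (volume.restrict (S ∪ S')) ≤
        eLpNorm V (ENNReal.ofReal (M.exponent c)) (volume.restrict S) +
          eLpNorm V (ENNReal.ofReal (M.exponent c)) (volume.restrict S') := by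
    intro S S' V
    have e0 : ENNReal.ofReal (M.exponent c) ≠ 0 := by simp; linarith
    refine (eLpNorm_mono_measure _ (Measure.restrict_union_le S S')).trans ?_
    simp only [eLpNorm_eq_lintegral_rpow_enorm_toReal e0 ENNReal.ofReal_ne_top,
      lintegral_add_measure, ENNReal.toReal_ofReal (zero_le_one.trans hm.le)]
    exact ENNReal.rpow_add_le_add_rpow _ _ (by positivity)
      (by rw [div_le_one (by linarith)]; exact hm.le)
  have hb : ∀ b, ∃ C : ℝ≥0∞, C ≠ ⊤ ∧ ∀ V : Euc n → Euc n,
      AEStronglyMeasurable V (volume.restrict (M.domain c)) →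
      eLpNorm V (ENNReal.ofReal (M.exponent c)) (M.phaseMeasure c b) ≤
        C * eLpNorm V (ENNReal.ofReal (M.phaseExponent b)) (M.phaseMeasure c b) := by
    intro b
    have := h.isFiniteMeasure_phaseMeasure b
    have main : M.exponent c ≤ M.phaseExponent b → ∃ C : ℝ≥0∞, C ≠ ⊤ ∧ ∀ V : Euc n → Euc n,
        AEStronglyMeasurable V (volume.restrict (M.domain c)) →
        eLpNorm V (ENNReal.ofReal (M.exponent c)) (M.phaseMeasure c b) ≤
          C * eLpNorm V (ENNReal.ofReal (M.phaseExponent b)) (M.phaseMeasure c b) := by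
      intro hle
      refine ⟨(M.phaseMeasure c b) univ ^ (1 / (ENNReal.ofReal (M.exponent c)).toReal -
        1 / (ENNReal.ofReal (M.phaseExponent b)).toReal), ?_, fun V hV => ?_⟩
      rotate_left
      · rw [mul_comm]
        exact eLpNorm_le_eLpNorm_mul_rpow_measure_univ (ENNReal.ofReal_le_ofReal hle)
          (hV.mono_measure (Measure.restrict_mono_set _ (h.phase_subset_domain b)))
      · refine ENNReal.rpow_ne_top_of_nonneg ?_ (measure_ne_top _ _)
        rw [ENNReal.toReal_ofReal (by linarith), ENNReal.toReal_ofReal (by linarith), sub_nonneg]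
        exact one_div_le_one_div_of_le (by linarith) hle
    cases b
    · by_cases hi : M.inner c = ∅
      · refine ⟨0, by simp, fun V hV => ?_⟩
        simp [phaseMeasure, phase, hi]
      · exact main (exponent_le_q hi)
    · exact main exponent_le_p
  choose C hC hle using hb
  refine ⟨∑ b, C b, by simp [hC], fun V hV hr => ?_⟩
  rw [Measure.restrict_congr_set h.domain_ae_eq]
  refine (hu _ _ V).trans ?_
  have hz : eLpNorm V (ENNReal.ofReal (M.exponent c)) (volume.restrict (M.rigid c)) = 0 := by
    rw [eLpNorm_congr_ae (g := 0) hr]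
    simp
  rw [hz, add_zero]
  refine (hu _ _ V).trans ?_
  have h₁ := hle true V hV
  have h₂ := hle false V hV
  simp only [Fintype.sum_bool]
  refine (add_le_add h₁ h₂).trans ?_
  rw [mul_add]
  gcongr
  · exact le_self_add
  · exact le_add_self

end Admissible

/-- The trial functions of finite energy. -/
structure Regular (M : Conductor n) (c : Regime) (u : Euc n → ℝ) : Prop where
  memW : MemW (M.exponent c) (M.domain c) u
  memLp : ∀ b, MemLp (weakGrad (M.domain c) u) (ENNReal.ofReal (M.phaseExponent b))
    (M.phaseMeasure c b)
  weakGrad_eq_zero : ∀ᵐ x ∂volume.restrict (M.rigid c), weakGrad (M.domain c) u x = 0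

namespace Admissible

variable {M : Conductor n} {c : Regime} {k : ℝ} {χ u v g : Euc n → ℝ}

theorem ae_of_domain {P : Euc n → Prop} {S : Set (Euc n)} (hS : S ⊆ M.domain c)
    (hP : ∀ᵐ x ∂volume.restrict (M.domain c), P x) : ∀ᵐ x ∂volume.restrict S, P x :=
  ae_mono (Measure.restrict_mono_set _ hS) hP

theorem regular_add (h : M.Admissible c) (hu : M.Regular c u) (hv : M.Regular c v) :
    M.Regular c (u + v) := by
  have e := MemW.weakGrad_add h.isOpen_domain hu.memW hv.memW
  refine ⟨hu.memW.add h.isOpen_domain hv.memW, fun b => ?_, ?_⟩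
  · exact (memLp_congr_ae (ae_of_domain (h.phase_subset_domain b) e)).2
      ((hu.memLp b).add (hv.memLp b))
  · filter_upwards [hu.weakGrad_eq_zero, hv.weakGrad_eq_zero,
      ae_of_domain h.rigid_subset_domain e] with x h₁ h₂ h₃
    simp [h₃, h₁, h₂]

theorem regular_smul (h : M.Admissible c) (hu : M.Regular c u) (t : ℝ) :
    M.Regular c (t • u) := by
  have e := MemW.weakGrad_smul h.isOpen_domain hu.memW t
  refine ⟨hu.memW.smul h.isOpen_domain t, fun b => ?_, ?_⟩
  · exact (memLp_congr_ae (ae_of_domain (h.phase_subset_domain b) e)).2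
      ((hu.memLp b).const_smul t)
  · filter_upwards [hu.weakGrad_eq_zero, ae_of_domain h.rigid_subset_domain e] with x h₁ h₃
    simp [h₃, h₁]

theorem regular_zero (h : M.Admissible c) : M.Regular c 0 := by
  have e : weakGrad (M.domain c) (0 : Euc n → ℝ) =ᵐ[volume.restrict (M.domain c)] 0 :=
    IsWeakGrad.zero.weakGrad_ae_eq h.isOpen_domain
  refine ⟨.zero, fun b => ?_, ae_of_domain h.rigid_subset_domain e⟩
  exact (memLp_congr_ae (ae_of_domain (h.phase_subset_domain b) e)).2 MemLp.zero

/-- The space of trial functions of finite energy. -/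
def regularSpace (h : M.Admissible c) : Submodule ℝ (Euc n → ℝ) where
  carrier := {u | M.Regular c u}
  add_mem' := h.regular_add
  zero_mem' := h.regular_zero
  smul_mem' t _ hu := h.regular_smul hu t

/-- The space of trial functions of finite energy with zero boundary values. -/
def zeroSpace (h : M.Admissible c) (χ : Euc n → ℝ) : Submodule ℝ (Euc n → ℝ) where
  -- The factor `χ` expresses vanishing on `∂Ω` alone, also in the insulating regime, where
  -- potentials live on `B` and are free on `∂A`.
  carrier := {u | M.Regular c u ∧ MemW0 (M.exponent c) M.Ω (χ * u)}
  add_mem' {u v} hu hv := ⟨h.regular_add hu.1 hv.1, by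
    rw [mul_add]
    exact hu.2.add h.isOpen h.one_lt_exponent.le hv.2⟩
  zero_mem' := ⟨h.regular_zero, by simpa using MemW0.zero h.isOpen _⟩
  smul_mem' t u hu := ⟨h.regular_smul hu.1 t, by
    rw [mul_smul_comm]
    exact hu.2.smul h.isOpen t⟩

theorem mem_zeroSpace {h : M.Admissible c} :
    u ∈ h.zeroSpace χ ↔ M.Regular c u ∧ MemW0 (M.exponent c) M.Ω (χ * u) := Iff.rfl

theorem cutoff_mono (hχ : IsBoundaryCutoff M.Ω M.B k χ) :
    IsBoundaryCutoff M.Ω (M.domain c) k χ := hχ.mono B_subset_domain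

end Admissible
end Conductor

/-! ### Completeness of the space of potentials; boundary conditions and liftings. -/

/-- The Poincaré inequality for functions on `Ω \ closure A` that vanish at the boundary of `Ω`. -/
theorem exists_poincare_diff {n : ℕ} (hn : 0 < n) {s : ℝ} (hs : 1 < s) {Ω A : Set (Euc n)}
    (hΩ : IsOpen Ω) (hb : Bornology.IsBounded Ω) (hA : IsOpen A) (hAΩ : closure A ⊆ Ω)
    (hL : HasLipschitzBoundary A) (hB : IsConnected (Ω \ closure A)) {k : ℝ} {χ : Euc n → ℝ}
    (hχ : IsBoundaryCutoff Ω (Ω \ closure A) k χ) :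
    ∃ C : ℝ≥0∞, C ≠ ⊤ ∧ ∀ v, MemW s (Ω \ closure A) v → MemW0 s Ω (χ * v) →
      eLpNorm v (ENNReal.ofReal s) (volume.restrict (Ω \ closure A)) ≤
        C * eLpNorm (weakGrad (Ω \ closure A) v) (ENNReal.ofReal s)
          (volume.restrict (Ω \ closure A)) := by
  obtain ⟨C, hC, hP⟩ := poincareOn_diff hn hs.le hΩ hb hA hAΩ hL hB
  set B := Ω \ closure A with hBdef
  have hBo : IsOpen B := hΩ.sdiff isClosed_closure
  have hfin : volume B ≠ ⊤ := (hb.subset sdiff_subset).measure_lt_top.ne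
  have hBs : B ⊆ (closure A)ᶜ := fun x hx => hx.2
  have hWm : MeasurableSet (closure A)ᶜ := isClosed_closure.isOpen_compl.measurableSet
  refine ⟨C, hC, fun v hv hv0 => ?_⟩
  have hV : VanishingOff Ω (closure A)ᶜ (B.indicator v) (B.indicator (weakGrad B v)) := by
    refine ⟨?_, ?_, ?_, fun x hx => indicator_of_notMem (fun h => hx h.1) _⟩
    -- Split `v = χ v + (1 - χ) v`. The first part extends by zero across `∂Ω` because it lies in
    -- `W_0`, the second because it is cut off before reaching `∂Ω`.
    · have h₁ := (hv0.isWeakGrad_indicator hΩ hs).mono (subset_univ (closure A)ᶜ)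
      have hθ : ContDiff ℝ ∞ (1 - χ) := contDiff_const.sub hχ.contDiff
      have h₂ := hv.isWeakGrad.mul_smooth_extend (Ω := (closure A)ᶜ) hBo hθ
        (fun x hx => ⟨hχ.support_subset hx.1, hx.2⟩)
      refine (h₁.add h₂).congr ?_ ?_
      · refine (ae_restrict_iff' hWm).2 (.of_forall fun x hx => ?_)
        by_cases hxΩ : x ∈ Ω
        · have hxB : x ∈ B := ⟨hxΩ, hx⟩
          simp only [Pi.add_apply, indicator_of_mem hxΩ, indicator_of_mem hxB, Pi.mul_apply,
            Pi.sub_apply, Pi.one_apply]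
          ring
        · have hxB : x ∉ B := fun h => hxΩ h.1
          have hx0 := image_eq_zero_of_notMem_tsupport fun h => hxΩ (hχ.support_subset h)
          simp only [Pi.add_apply, indicator_of_notMem hxΩ, indicator_of_notMem hxB,
            Pi.mul_apply, hx0]
          ring
      · have e₁ := (hv.isWeakGrad.mul_smooth_extend (Ω := Ω) hBo hχ.contDiff
          hχ.subset).weakGrad_ae_eq hΩ
        rw [Filter.EventuallyEq, ae_restrict_iff' hΩ.measurableSet] at e₁
        refine (ae_restrict_iff' hWm).2 ?_
        filter_upwards [e₁] with x e₁ hx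
        by_cases hxΩ : x ∈ Ω
        · have hxB : x ∈ B := ⟨hxΩ, hx⟩
          have hg : gradient (1 - χ) x = - gradient χ x := by
            rw [gradient_sub (by fun_prop) (hχ.contDiff.differentiable (by simp) x),
              show gradient (1 : Euc n → ℝ) x = 0 from gradient_fun_const x (1 : ℝ), zero_sub]
          simp only [Pi.add_apply, indicator_of_mem hxΩ, indicator_of_mem hxB, e₁ hxΩ, hg,
            Pi.sub_apply, Pi.one_apply]
          module
        · have hxB : x ∉ B := fun h => hxΩ h.1
          have hx' : x ∉ tsupport (1 - χ) := fun h => hxΩ (hχ.support_subset h)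
          have hx0 := image_eq_zero_of_notMem_tsupport hx'
          simp only [Pi.add_apply, indicator_of_notMem hxΩ, indicator_of_notMem hxB, hx0,
            gradient_eq_zero_of_notMem hx', zero_smul, smul_zero, add_zero]
    · exact ((integrable_indicator_iff hBo.measurableSet).2
        (hv.integrableOn hs.le hfin)).integrableOn
    · exact ((integrable_indicator_iff hBo.measurableSet).2
        (hv.integrableOn_weakGrad hs.le hBo hfin)).integrableOn
  have := hP _ _ hV
  rw [eLpNorm_indicator_eq_eLpNorm_restrict hBo.measurableSet,
    eLpNorm_indicator_eq_eLpNorm_restrict hBo.measurableSet,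
    Measure.restrict_restrict hBo.measurableSet, Measure.restrict_restrict hBo.measurableSet,
    inter_self, inter_eq_left.2 hBs] at this
  exact this

theorem weakGrad_ae_eq_zero_of_eq_zero {n : ℕ} {D S : Set (Euc n)} (hS : IsOpen S) (hSD : S ⊆ D)
    {u : Euc n → ℝ} (hu : ∃ V, IsWeakGrad D u V) (h0 : ∀ x ∈ S, u x = 0) :
    ∀ᵐ x ∂volume.restrict S, weakGrad D u x = 0 := by
  have h₁ : IsWeakGrad S u 0 := IsWeakGrad.zero.congr
    ((ae_restrict_iff' hS.measurableSet).2 (.of_forall fun x hx => (h0 x hx).symm)) (by rfl)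
  exact ((isWeakGrad_weakGrad hu).mono hSD).unique hS h₁

theorem MemW.of_eq_zero {n : ℕ} {s : ℝ} {S : Set (Euc n)} (hS : IsOpen S) {u : Euc n → ℝ}
    (h0 : ∀ x ∈ S, u x = 0) : MemW s S u :=
  MemW.zero.congr hS
    ((ae_restrict_iff' hS.measurableSet).2 (.of_forall fun x hx => (h0 x hx).symm))

/-- Being of zero boundary values is preserved under convergence. -/
theorem IsBoundaryCutoff.memW0_of_tendsto {n : ℕ} {Ω D : Set (Euc n)} {k s : ℝ} {χ : Euc n → ℝ}
    (h : IsBoundaryCutoff Ω D k χ) (hs : 1 ≤ s) (hD : IsOpen D) (hΩ : IsOpen Ω) (hDΩ : D ⊆ Ω)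
    {v : ℕ → Euc n → ℝ} {w : Euc n → ℝ} (hv : ∀ j, MemW s D (v j))
    (hv0 : ∀ j, MemW0 s Ω (χ * v j)) (hw : MemW s D w)
    (ht : Filter.Tendsto (fun j => eLpNorm (v j - w) (ENNReal.ofReal s) (volume.restrict D))
      Filter.atTop (nhds 0))
    (ht' : Filter.Tendsto (fun j => eLpNorm (weakGrad D (v j) - weakGrad D w) (ENNReal.ofReal s)
      (volume.restrict D)) Filter.atTop (nhds 0)) : MemW0 s Ω (χ * w) := by
  refine .of_approx hΩ hs (h.memW hD hΩ hDΩ hw) fun δ hδ => ?_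
  have h₁ : Filter.Tendsto (fun j => ENNReal.ofReal k *
      (eLpNorm (v j - w) (ENNReal.ofReal s) (volume.restrict D) +
        eLpNorm (weakGrad D (v j) - weakGrad D w) (ENNReal.ofReal s) (volume.restrict D)))
      Filter.atTop (nhds 0) := by
    have := ENNReal.Tendsto.const_mul (a := ENNReal.ofReal k) (ht.add ht')
      (Or.inr ENNReal.ofReal_ne_top)
    simpa using this
  obtain ⟨j, hj⟩ := (h₁.eventually_lt_const hδ).exists
  refine ⟨χ * v j, hv0 j, ?_, ?_⟩
  · rw [← mul_sub]
    refine (h.eLpNorm_mul_le hD hΩ hDΩ _ _).trans (le_trans ?_ hj.le)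
    rw [eLpNorm_sub_comm]
    gcongr
    exact le_self_add
  · have e := MemW.weakGrad_sub hΩ (h.memW hD hΩ hDΩ hw) (h.memW hD hΩ hDΩ (hv j))
    rw [← mul_sub] at e
    rw [← eLpNorm_congr_ae e]
    refine (h.eLpNorm_weakGrad_le hs hD hΩ hDΩ (hw.sub hD (hv j))).trans (le_trans ?_ hj.le)
    rw [eLpNorm_congr_ae (MemW.weakGrad_sub hD hw (hv j)), eLpNorm_sub_comm w,
      eLpNorm_sub_comm (weakGrad D w)]

namespace Conductor.Admissible

variable {n : ℕ} {M : Conductor n} {c : Regime} {k : ℝ} {χ u v w g : Euc n → ℝ}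

/-- Three regimes have potentials on all of `Ω`, in `W_0` after removing the cutoff. The insulating
regime needs the inequality on `B` with no condition on `∂A`. -/
theorem exists_poincare (h : M.Admissible c) (hχ : IsBoundaryCutoff M.Ω M.B k χ) :
    ∃ C : ℝ≥0∞, C ≠ ⊤ ∧ ∀ v, MemW (M.exponent c) (M.domain c) v →
      MemW0 (M.exponent c) M.Ω (χ * v) →
      eLpNorm v (ENNReal.ofReal (M.exponent c)) (volume.restrict (M.domain c)) ≤
        C * eLpNorm (weakGrad (M.domain c) v) (ENNReal.ofReal (M.exponent c))
          (volume.restrict (M.domain c)) := by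
  have key : M.domain c = M.Ω → ∃ C : ℝ≥0∞, C ≠ ⊤ ∧ ∀ v, MemW (M.exponent c) (M.domain c) v →
      MemW0 (M.exponent c) M.Ω (χ * v) →
      eLpNorm v (ENNReal.ofReal (M.exponent c)) (volume.restrict (M.domain c)) ≤
        C * eLpNorm (weakGrad (M.domain c) v) (ENNReal.ofReal (M.exponent c))
          (volume.restrict (M.domain c)) := by
    intro hD
    obtain ⟨C, hC, hP⟩ := exists_poincare_memW0 h.pos h.isOpen h.isBounded
    rw [hD]
    exact ⟨C, hC, fun v hv hv0 => hP _ h.one_lt_exponent _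
      ((hχ.memW0_mul_iff h.one_lt_exponent.le h.isOpen B_subset hv).1 hv0)⟩
  cases c
  · exact key rfl
  · exact key rfl
  · exact exists_poincare_diff h.pos h.one_lt_p h.isOpen h.isBounded h.inner_isOpen h.inner_subset
      h.inner_lipschitz h.outer_isConnected hχ
  · exact key rfl

theorem disjoint_rigid_phase (b : Bool) : Disjoint (M.rigid c) (M.phase c b) := by
  cases b
  · cases c <;> simp [phase, Conductor.inner, rigid]
  · exact (disjoint_B_A.mono_right rigid_subset_A).symm

theorem disjoint_phase : Disjoint (M.phase c true) (M.phase c false) :=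
  disjoint_B_A.mono_right inner_subset_A

/-- A field on the domain with prescribed values in the regions of finite conductivity. -/
noncomputable def glue (M : Conductor n) (c : Regime) (V : Bool → Euc n → Euc n) : Euc n → Euc n :=
  (M.phase c true).indicator (V true) + (M.phase c false).indicator (V false)

theorem glue_apply {V : Bool → Euc n → Euc n} {x : Euc n} {b : Bool} (hx : x ∈ M.phase c b) :
    glue M c V x = V b x := by
  cases b
  · simp [glue, hx, Set.disjoint_right.1 disjoint_phase hx]
  · simp [glue, hx, Set.disjoint_left.1 disjoint_phase hx]

theorem glue_ae_eq (h : M.Admissible c) (V : Bool → Euc n → Euc n) (b : Bool) :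
    glue M c V =ᵐ[M.phaseMeasure c b] V b :=
  (ae_restrict_iff' (h.isOpen_phase b).measurableSet).2 (.of_forall fun _ hx => glue_apply hx)

theorem glue_ae_eq_zero (h : M.Admissible c) (V : Bool → Euc n → Euc n) :
    ∀ᵐ x ∂volume.restrict (M.rigid c), glue M c V x = 0 :=
  (ae_restrict_iff' h.isOpen_rigid.measurableSet).2 (.of_forall fun x hx => by
    simp [glue, Set.disjoint_left.1 (disjoint_rigid_phase (M := M) (c := c) true) hx,
      Set.disjoint_left.1 (disjoint_rigid_phase (M := M) (c := c) false) hx])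

theorem aestronglyMeasurable_glue (h : M.Admissible c) {V : Bool → Euc n → Euc n}
    (hV : ∀ b, AEStronglyMeasurable (V b) (M.phaseMeasure c b)) :
    AEStronglyMeasurable (glue M c V) :=
  ((aestronglyMeasurable_indicator_iff (h.isOpen_phase true).measurableSet).2 (hV true)).add
    ((aestronglyMeasurable_indicator_iff (h.isOpen_phase false).measurableSet).2 (hV false))

/-- Fields that are Cauchy in each phase are Cauchy on the domain with the smaller exponent, since
they vanish on the rigid part; by Poincaré the potentials are Cauchy too. The limits in the phases,
glued together, are the weak gradient of the limiting potential. -/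
theorem complete (h : M.Admissible c) (hχ : IsBoundaryCutoff M.Ω M.B k χ) (v : ℕ → Euc n → ℝ)
    (hv : ∀ j, v j ∈ h.zeroSpace χ)
    (hc : ∀ b, Filter.Tendsto (fun z : ℕ × ℕ =>
      eLpNorm (weakGrad (M.domain c) (v z.1) - weakGrad (M.domain c) (v z.2))
        (ENNReal.ofReal (M.phaseExponent b)) (M.phaseMeasure c b)) Filter.atTop (nhds 0)) :
    ∃ w ∈ h.zeroSpace χ, ∀ b, Filter.Tendsto (fun j =>
      eLpNorm (weakGrad (M.domain c) (v j) - weakGrad (M.domain c) w)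
        (ENNReal.ofReal (M.phaseExponent b)) (M.phaseMeasure c b)) Filter.atTop (nhds 0) := by
  have hD := h.isOpen_domain
  have hm := h.one_lt_exponent
  have hm' : 1 ≤ ENNReal.ofReal (M.exponent c) := by simpa using hm.le
  have hs : ∀ b, 1 ≤ ENNReal.ofReal (M.phaseExponent b) := by
    intro b
    cases b
    · simpa [phaseExponent] using h.one_lt_q.le
    · simpa [phaseExponent] using h.one_lt_p.le
  obtain ⟨C, hC, hle⟩ := h.exists_eLpNorm_le
  obtain ⟨C', hC', hP⟩ := h.exists_poincare hχ
  have hg : ∀ j, MemLp (weakGrad (M.domain c) (v j)) (ENNReal.ofReal (M.exponent c))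
      (volume.restrict (M.domain c)) := fun j => (hv j).1.memW.memLp_weakGrad hD
  have hcD : Filter.Tendsto (fun z : ℕ × ℕ =>
      eLpNorm (weakGrad (M.domain c) (v z.1) - weakGrad (M.domain c) (v z.2))
        (ENNReal.ofReal (M.exponent c)) (volume.restrict (M.domain c))) Filter.atTop (nhds 0) := by
    have ht : Filter.Tendsto (fun z : ℕ × ℕ => C * ∑ b,
        eLpNorm (weakGrad (M.domain c) (v z.1) - weakGrad (M.domain c) (v z.2))
          (ENNReal.ofReal (M.phaseExponent b)) (M.phaseMeasure c b)) Filter.atTop (nhds 0) := by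
      have := ENNReal.Tendsto.const_mul (a := C) (tendsto_finsetSum Finset.univ fun b _ => hc b)
        (Or.inr hC)
      simpa using this
    refine tendsto_of_tendsto_of_tendsto_of_le_of_le tendsto_const_nhds ht (fun _ => zero_le)
      fun z => hle _ ((hg z.1).1.sub (hg z.2).1) ?_
    filter_upwards [(hv z.1).1.weakGrad_eq_zero, (hv z.2).1.weakGrad_eq_zero] with x h₁ h₂
    simp [h₁, h₂]
  have hcv : Filter.Tendsto (fun z : ℕ × ℕ => eLpNorm (v z.1 - v z.2)
      (ENNReal.ofReal (M.exponent c)) (volume.restrict (M.domain c))) Filter.atTop (nhds 0) := by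
    have ht := ENNReal.Tendsto.const_mul (a := C') hcD (Or.inr hC')
    rw [mul_zero] at ht
    refine tendsto_of_tendsto_of_tendsto_of_le_of_le tendsto_const_nhds ht (fun _ => zero_le)
      fun z => ?_
    have hz := (h.zeroSpace χ).sub_mem (hv z.1) (hv z.2)
    refine (hP _ hz.1.memW hz.2).trans ?_
    rw [eLpNorm_congr_ae (MemW.weakGrad_sub hD (hv z.1).1.memW (hv z.2).1.memW)]
  obtain ⟨w, hw, htw⟩ := exists_eLpNorm_tendsto hm' (fun j => (hv j).1.memW.1) hcv
  have hV : ∀ b, ∃ V, MemLp V (ENNReal.ofReal (M.phaseExponent b)) (M.phaseMeasure c b) ∧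
      Filter.Tendsto (fun j => eLpNorm (weakGrad (M.domain c) (v j) - V)
        (ENNReal.ofReal (M.phaseExponent b)) (M.phaseMeasure c b)) Filter.atTop (nhds 0) :=
    fun b => exists_eLpNorm_tendsto (hs b) (fun j => (hv j).1.memLp b) (hc b)
  choose V hVm hVt using hV
  set W := glue M c V
  have hWa : ∀ b, W =ᵐ[M.phaseMeasure c b] V b := h.glue_ae_eq V
  have hWmeas : AEStronglyMeasurable W (volume.restrict (M.domain c)) :=
    (h.aestronglyMeasurable_glue fun b => (hVm b).1).restrict
  have hW0 : ∀ᵐ x ∂volume.restrict (M.rigid c), W x = 0 := h.glue_ae_eq_zero V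
  have hWb : ∀ b, MemLp W (ENNReal.ofReal (M.phaseExponent b)) (M.phaseMeasure c b) := fun b =>
    (memLp_congr_ae (hWa b)).2 (hVm b)
  have hW : MemLp W (ENNReal.ofReal (M.exponent c)) (volume.restrict (M.domain c)) := by
    refine ⟨hWmeas, (hle W hWmeas hW0).trans_lt (ENNReal.mul_lt_top hC.lt_top ?_)⟩
    exact ENNReal.sum_lt_top.2 fun b _ => (hWb b).2
  have htb : ∀ b, Filter.Tendsto (fun j => eLpNorm (weakGrad (M.domain c) (v j) - W)
        (ENNReal.ofReal (M.phaseExponent b)) (M.phaseMeasure c b)) Filter.atTop (nhds 0) :=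
    fun b => (hVt b).congr fun j => eLpNorm_congr_ae <| by
      filter_upwards [hWa b] with x hx
      simp [hx]
  have htW : Filter.Tendsto (fun j => eLpNorm (weakGrad (M.domain c) (v j) - W)
      (ENNReal.ofReal (M.exponent c)) (volume.restrict (M.domain c))) Filter.atTop (nhds 0) := by
    have ht : Filter.Tendsto (fun j => C * ∑ b, eLpNorm (weakGrad (M.domain c) (v j) - W)
          (ENNReal.ofReal (M.phaseExponent b)) (M.phaseMeasure c b)) Filter.atTop (nhds 0) := by
      have := ENNReal.Tendsto.const_mul (a := C) (tendsto_finsetSum Finset.univ fun b _ => htb b)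
        (Or.inr hC)
      simpa using this
    refine tendsto_of_tendsto_of_tendsto_of_le_of_le tendsto_const_nhds ht (fun _ => zero_le)
      fun j => hle _ ((hg j).1.sub hWmeas) ?_
    filter_upwards [(hv j).1.weakGrad_eq_zero, hW0] with x h₁ h₂
    simp [h₁, h₂]
  have hgrad : IsWeakGrad (M.domain c) w W := IsWeakGrad.of_tendsto hm
    (fun j => (hv j).1.memW.isWeakGrad) (fun j => (hv j).1.memW.1) hg hw hW htw htW
  have hae := hgrad.weakGrad_ae_eq hD
  have hwW : MemW (M.exponent c) (M.domain c) w := ⟨hw, W, hgrad, hW⟩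
  refine ⟨w, ⟨⟨hwW, fun b => ?_, ?_⟩, ?_⟩, fun b => ?_⟩
  · exact (memLp_congr_ae (ae_of_domain (h.phase_subset_domain b) hae)).2 (hWb b)
  · filter_upwards [hW0, ae_of_domain h.rigid_subset_domain hae] with x h₁ h₂
    rw [h₂, h₁]
  · refine (cutoff_mono hχ).memW0_of_tendsto hm.le hD h.isOpen domain_subset
      (fun j => (hv j).1.memW) (fun j => (hv j).2) hwW htw (htW.congr fun j => eLpNorm_congr_ae ?_)
    filter_upwards [hae] with x hx
    simp [hx]
  · refine (htb b).congr fun j => eLpNorm_congr_ae ?_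
    filter_upwards [ae_of_domain (h.phase_subset_domain b) hae] with x hx
    simp only [Pi.sub_apply]
    rw [hx]

theorem fieldSpace (h : M.Admissible c) (hχ : IsBoundaryCutoff M.Ω M.B k χ) :
    FieldSpace (M.phaseMeasure c) M.phaseExponent h.regularSpace (h.zeroSpace χ)
      (weakGrad (M.domain c)) where
  le _ hu := hu.1
  memLp b _ hu := hu.memLp b
  add b _ hu _ hv := ae_of_domain (h.phase_subset_domain b)
    (MemW.weakGrad_add h.isOpen_domain hu.memW hv.memW)
  smul b t _ hu := ae_of_domain (h.phase_subset_domain b)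
    (MemW.weakGrad_smul h.isOpen_domain hu.memW t)
  complete := h.complete hχ

theorem ae_eq_zero_of_weakGrad (h : M.Admissible c) (hχ : IsBoundaryCutoff M.Ω M.B k χ)
    (hv : v ∈ h.zeroSpace χ) (hv0 : ∀ b, weakGrad (M.domain c) v =ᵐ[M.phaseMeasure c b] 0) :
    v =ᵐ[volume.restrict (M.domain c)] 0 := by
  obtain ⟨C, hC, hle⟩ := h.exists_eLpNorm_le
  obtain ⟨C', hC', hP⟩ := h.exists_poincare hχ
  have h₁ := hle _ (hv.1.memW.memLp_weakGrad h.isOpen_domain).1 hv.1.weakGrad_eq_zero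
  have h₂ : ∑ b, eLpNorm (weakGrad (M.domain c) v) (ENNReal.ofReal (M.phaseExponent b))
      (M.phaseMeasure c b) = 0 := Finset.sum_eq_zero fun b _ => by
    rw [eLpNorm_congr_ae (hv0 b)]
    simp
  rw [h₂, mul_zero, nonpos_iff_eq_zero] at h₁
  have h₃ := hP v hv.1.memW hv.2
  rw [h₁, mul_zero, nonpos_iff_eq_zero] at h₃
  exact (eLpNorm_eq_zero_iff hv.1.memW.1.1 (by simpa using zero_lt_one.trans h.one_lt_exponent)).1 h₃

theorem memW_exponent (h : M.Admissible c) (hg : MemW M.p M.Ω g) :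
    MemW (M.exponent c) M.Ω g :=
  hg.mono_exponent h.isOpen h.volume_ne_top exponent_le_p

theorem memW_domain (h : M.Admissible c) (hg : MemW M.p M.Ω g) :
    MemW (M.exponent c) (M.domain c) g :=
  (h.memW_exponent hg).mono h.isOpen domain_subset

/-- On a set of finite measure the spaces are nested, so the union of the two is the larger one, and
in particular a vector space. -/
theorem memW_min_iff (h : M.Admissible c) :
    MemW (min M.p M.q) M.Ω u ↔ MemW M.p M.Ω u ∨ MemW M.q M.Ω u := by
  refine ⟨fun hu => ?_, fun hu => hu.elim
    (fun a => a.mono_exponent h.isOpen h.volume_ne_top (min_le_left _ _))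
    fun a => a.mono_exponent h.isOpen h.volume_ne_top (min_le_right _ _)⟩
  rcases min_choice M.p M.q with e | e <;> rw [e] at hu
  · exact .inl hu
  · exact .inr hu

theorem memW0_min_iff (h : M.Admissible c) :
    MemW0 (min M.p M.q) M.Ω u ↔ MemW0 M.p M.Ω u ∨ MemW0 M.q M.Ω u := by
  have h1 : 1 ≤ min M.p M.q := le_min h.one_lt_p.le h.one_lt_q.le
  refine ⟨fun hu => ?_, fun hu => hu.elim
    (fun a => a.mono_exponent h.isOpen h.volume_ne_top h1 (min_le_left _ _))
    fun a => a.mono_exponent h.isOpen h.volume_ne_top h1 (min_le_right _ _)⟩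
  rcases min_choice M.p M.q with e | e <;> rw [e] at hu
  · exact .inl hu
  · exact .inr hu

/-- On `Ω` the factor `χ` does not affect membership in `W_0`. In the insulating regime `χ(u - g)`
and the function `w` of the definition agree off a compact subset of `Ω`, so they differ by an
element of `W_0`; conversely `χ(u - g)` itself can serve as `w`. -/
theorem eqOnBoundary_iff (h : M.Admissible c) (hχ : IsBoundaryCutoff M.Ω M.B k χ)
    (hu : MemW (M.exponent c) (M.domain c) u) (hg : MemW M.p M.Ω g) :
    M.EqOnBoundary c u g ↔ MemW0 (M.exponent c) M.Ω (χ * (u - g)) := by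
  have hd := hu.sub h.isOpen_domain (h.memW_domain hg)
  cases c
  · exact (hχ.memW0_mul_iff h.one_lt_exponent.le h.isOpen B_subset hd).symm
  · exact h.memW0_min_iff.symm.trans
      (hχ.memW0_mul_iff h.one_lt_exponent.le h.isOpen B_subset hd).symm
  · constructor
    · rintro ⟨w, hw, K, hK, hKΩ, he⟩
      have h₁ : MemW0 M.p M.Ω (χ * (u - g) - w) := by
        refine .of_ae_eq_zero h.isOpen h.one_lt_p.le
          ((hχ.memW h.isOpen_B h.isOpen B_subset hd).sub h.isOpen hw.1)
          (hK.union hχ.hasCompactSupport) (union_subset hKΩ hχ.support_subset) ?_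
        have hs : M.Ω \ (K ∪ tsupport (1 - χ)) ⊆ M.B \ K := fun x hx =>
          ⟨hχ.mem_of_notMem hx.1 fun hx' => hx.2 (.inr hx'), fun hx' => hx.2 (.inl hx')⟩
        have hmeas : MeasurableSet (M.Ω \ (K ∪ tsupport (1 - χ))) :=
          h.isOpen.measurableSet.diff (hK.measurableSet.union (isClosed_tsupport _).measurableSet)
        filter_upwards [ae_mono (Measure.restrict_mono_set _ hs) he, ae_restrict_mem hmeas]
          with x hx hxm
        simp [IsBoundaryCutoff.eq_one x fun hx' => hxm.2 (.inr hx'), hx]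
      simpa [exponent] using h₁.add h.isOpen h.one_lt_p.le hw
    · intro hw
      refine ⟨_, hw, _, hχ.hasCompactSupport, hχ.support_subset, ?_⟩
      filter_upwards [ae_restrict_mem
        (h.isOpen_B.measurableSet.diff (isClosed_tsupport (1 - χ)).measurableSet)] with x hx
      simp [IsBoundaryCutoff.eq_one x hx.2]
  · exact (hχ.memW0_mul_iff h.one_lt_exponent.le h.isOpen B_subset hd).symm

theorem trial_iff (h : M.Admissible c) :
    M.Trial c u ↔ MemW (M.exponent c) (M.domain c) u ∧
      ∀ᵐ x ∂volume.restrict (M.rigid c), weakGrad (M.domain c) u x = 0 := by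
  cases c
  · simp [Trial, exponent, domain, rigid]
  · simp [Trial, exponent, domain, rigid, h.memW_min_iff]
  · simp [Trial, exponent, domain, rigid]
  · rfl

theorem regular_of_test (h : M.Admissible c) (hu : M.Test c u) : M.Regular c u := by
  have key : MemW (M.exponent c) (M.domain c) u → MemW M.p M.B u →
      (M.inner c ≠ ∅ → MemW M.q M.A u) →
      (∀ᵐ x ∂volume.restrict (M.rigid c), weakGrad (M.domain c) u x = 0) → M.Regular c u := by
    intro h₁ h₂ h₃ h₄
    refine ⟨h₁, fun b => ?_, h₄⟩
    cases b
    · by_cases hi : M.inner c = ∅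
      · simp [phaseMeasure, phase, hi]
      · have h₅ := (h₃ hi).mono h.inner_isOpen (inner_subset_A (c := c))
        exact (memLp_congr_ae (weakGrad_mono_ae_eq h.isOpen_inner h.inner_subset_domain
          ⟨_, h₁.isWeakGrad⟩)).1 (h₅.memLp_weakGrad h.isOpen_inner)
    · exact (memLp_congr_ae (weakGrad_mono_ae_eq h.isOpen_B B_subset_domain
        ⟨_, h₁.isWeakGrad⟩)).1 (h₂.memLp_weakGrad h.isOpen_B)
  cases c
  · exact key hu (hu.mono h.isOpen B_subset) (by simp [Conductor.inner]) (by simp [rigid])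
  · exact key (h.memW_min_iff.2 hu.1) hu.2.1 (fun _ => hu.2.2) (by simp [rigid])
  · exact key hu hu (by simp [Conductor.inner]) (by simp [rigid])
  · exact key hu.1 (hu.1.mono h.isOpen B_subset) (by simp [Conductor.inner]) hu.2

theorem cutoff_eq_zero (h : M.Admissible c) (hχ : IsBoundaryCutoff M.Ω M.B k χ) (x : Euc n)
    (hx : x ∈ M.A) : (χ * g) x = 0 := by
  have : x ∉ tsupport χ := fun hs =>
    Set.disjoint_left.1 disjoint_B_A (hχ.subset ⟨hs, h.A_subset hx⟩) hx
  simp [image_eq_zero_of_notMem_tsupport this]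

theorem memW_cutoff (h : M.Admissible c) (hχ : IsBoundaryCutoff M.Ω M.B k χ)
    (hg : MemW M.p M.Ω g) : MemW M.p M.Ω (χ * g) :=
  (hχ.mono B_subset).memW h.isOpen h.isOpen subset_rfl hg

/-- Since `χ g` vanishes on `A`, it meets the integrability or rigidity condition there trivially.
It is the lifting of the boundary datum used in all regimes. -/
theorem test_cutoff (h : M.Admissible c) (hχ : IsBoundaryCutoff M.Ω M.B k χ)
    (hg : MemW M.p M.Ω g) : M.Test c (χ * g) := by
  have h₁ := h.memW_cutoff hχ hg
  cases c
  · exact h₁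
  · exact ⟨.inl h₁, h₁.mono h.isOpen B_subset, .of_eq_zero h.inner_isOpen (h.cutoff_eq_zero hχ)⟩
  · exact h₁.mono h.isOpen B_subset
  · exact ⟨h₁, weakGrad_ae_eq_zero_of_eq_zero h.inner_isOpen h.A_subset ⟨_, h₁.isWeakGrad⟩
      (h.cutoff_eq_zero hχ)⟩

theorem eqOnBoundary_cutoff (h : M.Admissible c) (hχ : IsBoundaryCutoff M.Ω M.B k χ)
    (hg : MemW M.p M.Ω g) : M.EqOnBoundary c (χ * g) g := by
  have hw := h.memW_cutoff hχ hg
  rw [h.eqOnBoundary_iff hχ (h.memW_domain hw) hg]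
  rw [hχ.memW0_mul_iff h.one_lt_exponent.le h.isOpen B_subset
    (h.memW_exponent (hw.sub h.isOpen hg))]
  have := (hχ.memW0_sub h.one_lt_exponent.le h.isOpen B_subset (h.memW_exponent hg)).smul
    h.isOpen (-1)
  simpa using this

theorem weakGrad_cutoff_inner (h : M.Admissible c) (hχ : IsBoundaryCutoff M.Ω M.B k χ)
    (hg : MemW M.p M.Ω g) : weakGrad (M.domain c) (χ * g) =ᵐ[M.phaseMeasure c false] 0 :=
  weakGrad_ae_eq_zero_of_eq_zero h.isOpen_inner h.inner_subset_domain
    ⟨_, (h.memW_domain (h.memW_cutoff hχ hg)).isWeakGrad⟩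
    fun x hx => h.cutoff_eq_zero hχ x (inner_subset_A hx)

theorem eLpNorm_weakGrad_cutoff_le (h : M.Admissible c) (hχ : IsBoundaryCutoff M.Ω M.B k χ)
    (hg : MemW M.p M.Ω g) :
    eLpNorm (weakGrad (M.domain c) (χ * g)) (ENNReal.ofReal M.p) (M.phaseMeasure c true) ≤
      ENNReal.ofReal k * (eLpNorm g (ENNReal.ofReal M.p) (volume.restrict M.Ω) +
        eLpNorm (weakGrad M.Ω g) (ENNReal.ofReal M.p) (volume.restrict M.Ω)) := by
  have e : weakGrad (M.domain c) (χ * g) =ᵐ[volume.restrict (M.domain c)] weakGrad M.Ω (χ * g) :=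
    weakGrad_mono_ae_eq h.isOpen_domain domain_subset ⟨_, (h.memW_cutoff hχ hg).isWeakGrad⟩
  rw [phaseMeasure, eLpNorm_congr_ae (ae_of_domain (h.phase_subset_domain true) e)]
  refine (eLpNorm_mono_measure _ (Measure.restrict_mono_set _ B_subset)).trans ?_
  exact (hχ.mono B_subset).eLpNorm_weakGrad_le h.one_lt_p.le h.isOpen h.isOpen subset_rfl hg

end Conductor.Admissible

/-! ### Minimizers, the Dirichlet-to-Neumann operator and the derivative. -/

namespace Conductor.Admissible

variable {n : ℕ} {M : Conductor n} {c : Regime} {k : ℝ} {χ u v w f g φ ψ : Euc n → ℝ}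
  {C κ : Bool → ℝ}

theorem exists_powerMaterial (h : M.Admissible c)
    (h₁ : IsCaratheodoryOn M.B M.σ ∧ IsCaratheodoryOn M.A M.σ) (h₂ : HasGrowth M.p M.B M.σ)
    (h₃ : IsStronglyMonotone M.p M.B M.σ) (hc : M.InnerMaterial c) :
    ∃ C κ : Bool → ℝ, ∀ b,
      PowerMaterial (M.phaseMeasure c b) (Euc n) (M.phaseExponent b) (C b) (κ b) M.σ := by
  have hb : ∀ b, ∃ C κ : ℝ,
      PowerMaterial (M.phaseMeasure c b) (Euc n) (M.phaseExponent b) C κ M.σ := by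
    intro b
    cases b
    · by_cases hi : M.inner c = ∅
      -- An empty phase carries the zero measure, for which the assumptions hold vacuously with any
      -- constants.
      · have hμ : (volume.restrict (∅ : Set (Euc n)) : Measure (Euc n)) = 0 :=
          Measure.restrict_empty
        have := _root_.exists_powerMaterial (U := ∅) (σ := M.σ) h.pos h.one_lt_q
          ⟨fun E => by simp [hμ], by simp [hμ]⟩
          ⟨1, 1, 1, one_pos, le_rfl, one_pos, by simp [hμ]⟩ ⟨1, one_pos, by simp [hμ]⟩
        simpa [phaseMeasure, phase, phaseExponent, hi] using this
      · cases c
        · exact absurd rfl hi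
        · exact _root_.exists_powerMaterial h.pos h.one_lt_q h₁.2 hc.1 hc.2
        · exact absurd rfl hi
        · exact absurd rfl hi
    · exact _root_.exists_powerMaterial h.pos h.one_lt_p h₁.1 h₂ h₃
  choose C κ hm using hb
  exact ⟨C, κ, hm⟩

theorem energy_eq_sum (h : M.Admissible c) (u : Euc n → ℝ) : M.energy c u =
    ∑ b, ∫⁻ x, lawEnergy (M.σ x) ‖weakGrad (M.domain c) u x‖₊ ∂M.phaseMeasure c b := by
  rw [energy, h.restrict_energyRegion, lintegral_add_measure, Fintype.sum_bool]
  rfl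

theorem energy_eq (h : M.Admissible c) (hm : ∀ b,
      PowerMaterial (M.phaseMeasure c b) (Euc n) (M.phaseExponent b) (C b) (κ b) M.σ)
    (hu : M.Regular c u) : M.energy c u =
      ENNReal.ofReal (totalEnergy (M.phaseMeasure c) M.σ (weakGrad (M.domain c) u)) := by
  have := h.isFiniteMeasure_phaseMeasure
  rw [h.energy_eq_sum, totalEnergy, ENNReal.ofReal_sum_of_nonneg fun b _ => matEnergy_nonneg _]
  exact Finset.sum_congr rfl fun b _ => (hm b).lintegral_lawEnergy (hu.memLp b)

theorem regular_of_energy_ne_top (h : M.Admissible c) (hm : ∀ b,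
      PowerMaterial (M.phaseMeasure c b) (Euc n) (M.phaseExponent b) (C b) (κ b) M.σ)
    (hu : M.Trial c u) (he : M.energy c u ≠ ⊤) : M.Regular c u := by
  have := h.isFiniteMeasure_phaseMeasure
  rw [h.trial_iff] at hu
  rw [h.energy_eq_sum, ENNReal.sum_ne_top] at he
  exact ⟨hu.1, fun b => (hm b).memLp_of_lintegral_ne_top
    ((hu.1.memLp_weakGrad h.isOpen_domain).1.mono_measure
      (Measure.restrict_mono_set _ (h.phase_subset_domain b))) (he b (Finset.mem_univ b)), hu.2⟩

theorem integrableOn_powerDensity (h : M.Admissible c) (hm : ∀ b,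
      PowerMaterial (M.phaseMeasure c b) (Euc n) (M.phaseExponent b) (C b) (κ b) M.σ)
    (hu : M.Regular c u) (hv : M.Regular c v) :
    IntegrableOn (M.powerDensity c u v) (M.energyRegion c) := by
  have := h.isFiniteMeasure_phaseMeasure
  rw [IntegrableOn, h.restrict_energyRegion]
  exact ((hm true).integrable_inner_vecFlux (hu.memLp true) (hv.memLp true)).add_measure
    ((hm false).integrable_inner_vecFlux (hu.memLp false) (hv.memLp false))

theorem integral_powerDensity (h : M.Admissible c) (hm : ∀ b,
      PowerMaterial (M.phaseMeasure c b) (Euc n) (M.phaseExponent b) (C b) (κ b) M.σ)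
    (hu : M.Regular c u) (hv : M.Regular c v) :
    ∫ x in M.energyRegion c, M.powerDensity c u v x =
      totalPower (M.phaseMeasure c) M.σ (weakGrad (M.domain c) u) (weakGrad (M.domain c) v) := by
  have := h.isFiniteMeasure_phaseMeasure
  have i₁ := (hm true).integrable_inner_vecFlux (hu.memLp true) (hv.memLp true)
  have i₂ := (hm false).integrable_inner_vecFlux (hu.memLp false) (hv.memLp false)
  rw [h.restrict_energyRegion, totalPower, Fintype.sum_bool]
  exact integral_add_measure i₁ i₂

theorem regular_cutoff (h : M.Admissible c) (hχ : IsBoundaryCutoff M.Ω M.B k χ)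
    (hg : MemW M.p M.Ω g) : M.Regular c (χ * g) :=
  h.regular_of_test (h.test_cutoff hχ hg)

/-- The functions `χ(u - g)` and `χ(u - χ g)` differ by `χ(χ g - g)`, which lies in `W_0` because `χ
g` has the boundary values `g`. -/
theorem eqOnBoundary_iff_sub_mem (h : M.Admissible c) (hχ : IsBoundaryCutoff M.Ω M.B k χ)
    (hu : M.Regular c u) (hg : MemW M.p M.Ω g) :
    M.EqOnBoundary c u g ↔ u - χ * g ∈ h.zeroSpace χ := by
  have hl := h.regular_cutoff hχ hg
  have h₁ := (h.eqOnBoundary_iff hχ hl.memW hg).1 (h.eqOnBoundary_cutoff hχ hg)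
  have hd : M.Regular c (u - χ * g) := h.regularSpace.sub_mem hu hl
  rw [h.eqOnBoundary_iff hχ hu.memW hg, mem_zeroSpace]
  have e : χ * (u - g) = χ * (u - χ * g) + χ * (χ * g - g) := by ring
  refine ⟨fun h' => ⟨hd, ?_⟩, fun h' => ?_⟩
  · rw [← add_sub_cancel_right (χ * (u - χ * g)) (χ * (χ * g - g)), ← e]
    exact h'.sub h.isOpen h.one_lt_exponent.le h₁
  · rw [e]
    exact h'.2.add h.isOpen h.one_lt_exponent.le h₁

theorem regular_of_sub_mem (h : M.Admissible c) (hχ : IsBoundaryCutoff M.Ω M.B k χ)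
    (hg : MemW M.p M.Ω g) (hu : u - χ * g ∈ h.zeroSpace χ) : M.Regular c u :=
  (h.fieldSpace hχ).mem_of_sub_mem (h.regular_cutoff hχ hg) hu

/-- The solutions are the minimizers of the energy in an affine space. -/
theorem isSolution_iff (h : M.Admissible c) (hm : ∀ b,
      PowerMaterial (M.phaseMeasure c b) (Euc n) (M.phaseExponent b) (C b) (κ b) M.σ)
    (hχ : IsBoundaryCutoff M.Ω M.B k χ) (hg : MemW M.p M.Ω g) :
    M.IsSolution c g u ↔ IsFieldMinimizer (M.phaseMeasure c) M.σ (h.zeroSpace χ)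
      (weakGrad (M.domain c)) (χ * g) u := by
  have hl := h.regular_cutoff hχ hg
  constructor
  · rintro ⟨⟨hu, hub⟩, hmin⟩
    -- The lifting `χ g` is a competitor of finite energy. Hence solutions have finite energy and,
    -- by coercivity, lie in the affine space; trial functions of infinite energy play no role.
    have hlt : M.energy c u ≠ ⊤ := by
      refine ((hmin _ (h.trial_iff.2 ⟨hl.memW, hl.weakGrad_eq_zero⟩)
        (h.eqOnBoundary_cutoff hχ hg)).trans_lt ?_).ne
      rw [h.energy_eq hm hl]
      exact ENNReal.ofReal_lt_top
    have hur := h.regular_of_energy_ne_top hm hu hlt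
    refine ⟨(h.eqOnBoundary_iff_sub_mem hχ hur hg).1 hub, fun v hv => ?_⟩
    have hvr := h.regular_of_sub_mem hχ hg hv
    have := hmin v (h.trial_iff.2 ⟨hvr.memW, hvr.weakGrad_eq_zero⟩)
      ((h.eqOnBoundary_iff_sub_mem hχ hvr hg).2 hv)
    rwa [h.energy_eq hm hur, h.energy_eq hm hvr,
      ENNReal.ofReal_le_ofReal_iff (totalEnergy_nonneg _)] at this
  · rintro ⟨hu, hmin⟩
    have hur := h.regular_of_sub_mem hχ hg hu
    refine ⟨⟨h.trial_iff.2 ⟨hur.memW, hur.weakGrad_eq_zero⟩,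
      (h.eqOnBoundary_iff_sub_mem hχ hur hg).2 hu⟩, fun v hv hvb => ?_⟩
    by_cases hlt : M.energy c v = ⊤
    · simp [hlt]
    have hvr := h.regular_of_energy_ne_top hm hv hlt
    rw [h.energy_eq hm hur, h.energy_eq hm hvr]
    exact ENNReal.ofReal_le_ofReal (hmin v ((h.eqOnBoundary_iff_sub_mem hχ hvr hg).1 hvb))

theorem isSolution_potential (h : M.Admissible c) (hm : ∀ b,
      PowerMaterial (M.phaseMeasure c b) (Euc n) (M.phaseExponent b) (C b) (κ b) M.σ)
    (hχ : IsBoundaryCutoff M.Ω M.B k χ) (hg : MemW M.p M.Ω g) :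
    M.IsSolution c g (M.potential c g) := by
  have := h.isFiniteMeasure_phaseMeasure
  obtain ⟨u, hu⟩ := (h.fieldSpace hχ).exists_isFieldMinimizer hm (h.regular_cutoff hχ hg)
  exact Classical.epsilon_spec (p := M.IsSolution c g) ⟨u, (h.isSolution_iff hm hχ hg).2 hu⟩

theorem isFieldMinimizer_potential (h : M.Admissible c) (hm : ∀ b,
      PowerMaterial (M.phaseMeasure c b) (Euc n) (M.phaseExponent b) (C b) (κ b) M.σ)
    (hχ : IsBoundaryCutoff M.Ω M.B k χ) (hg : MemW M.p M.Ω g) :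
    IsFieldMinimizer (M.phaseMeasure c) M.σ (h.zeroSpace χ)
      (weakGrad (M.domain c)) (χ * g) (M.potential c g) :=
  (h.isSolution_iff hm hχ hg).1 (h.isSolution_potential hm hχ hg)

theorem regular_potential (h : M.Admissible c) (hm : ∀ b,
      PowerMaterial (M.phaseMeasure c b) (Euc n) (M.phaseExponent b) (C b) (κ b) M.σ)
    (hχ : IsBoundaryCutoff M.Ω M.B k χ) (hg : MemW M.p M.Ω g) :
    M.Regular c (M.potential c g) :=
  h.regular_of_sub_mem hχ hg (h.isFieldMinimizer_potential hm hχ hg).1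

theorem ae_eq_of_isSolution (h : M.Admissible c) (hm : ∀ b,
      PowerMaterial (M.phaseMeasure c b) (Euc n) (M.phaseExponent b) (C b) (κ b) M.σ)
    (hχ : IsBoundaryCutoff M.Ω M.B k χ) (hg : MemW M.p M.Ω g) (hu : M.IsSolution c g u)
    (hv : M.IsSolution c g v) : u =ᵐ[volume.restrict (M.domain c)] v := by
  have := h.isFiniteMeasure_phaseMeasure
  have hS := h.fieldSpace hχ
  have hu' := (h.isSolution_iff hm hχ hg).1 hu
  have hv' := (h.isSolution_iff hm hχ hg).1 hv
  have hz : u - v ∈ h.zeroSpace χ := by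
    simpa using (h.zeroSpace χ).sub_mem hu'.1 hv'.1
  have h0 := h.ae_eq_zero_of_weakGrad hχ hz fun b => by
    filter_upwards [hS.sub b (h.regular_of_sub_mem hχ hg hu'.1) (h.regular_of_sub_mem hχ hg hv'.1),
      hS.ae_eq_of_isFieldMinimizer hm (h.regular_cutoff hχ hg) hu' hv' b] with x h₁ h₂
    simp [h₁, h₂]
  filter_upwards [h0] with x hx
  exact sub_eq_zero.1 hx

/-- The virtual power only depends on the boundary values of the test function. -/
theorem totalPower_potential_eq (h : M.Admissible c) (hm : ∀ b,
      PowerMaterial (M.phaseMeasure c b) (Euc n) (M.phaseExponent b) (C b) (κ b) M.σ)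
    (hχ : IsBoundaryCutoff M.Ω M.B k χ) (hf : MemW M.p M.Ω f) (hφ : MemW M.p M.Ω φ)
    (hψ : M.Test c ψ) (hb : M.EqOnBoundary c ψ φ) :
    ∫ x in M.energyRegion c, M.powerDensity c (M.potential c f) ψ x =
      totalPower (M.phaseMeasure c) M.σ (weakGrad (M.domain c) (M.potential c f))
        (weakGrad (M.domain c) (χ * φ)) := by
  have := h.isFiniteMeasure_phaseMeasure
  have hψr := h.regular_of_test hψ
  rw [h.integral_powerDensity hm (h.regular_potential hm hχ hf) hψr]
  exact (h.fieldSpace hχ).totalPower_eq_of_sub_mem hm (h.regular_cutoff hχ hf)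
    (h.isFieldMinimizer_potential hm hχ hf) (h.regular_cutoff hχ hφ)
    ((h.eqOnBoundary_iff_sub_mem hχ hψr hφ).1 hb)

theorem dtn_eq (h : M.Admissible c) (hm : ∀ b,
      PowerMaterial (M.phaseMeasure c b) (Euc n) (M.phaseExponent b) (C b) (κ b) M.σ)
    (hχ : IsBoundaryCutoff M.Ω M.B k χ) (hf : MemW M.p M.Ω f) (hφ : MemW M.p M.Ω φ) :
    M.dtn c f φ = totalPower (M.phaseMeasure c) M.σ (weakGrad (M.domain c) (M.potential c f))
        (weakGrad (M.domain c) (χ * φ)) := by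
  obtain ⟨h₁, h₂⟩ := Classical.epsilon_spec (p := fun ψ => M.Test c ψ ∧ M.EqOnBoundary c ψ φ)
    ⟨_, h.test_cutoff hχ hφ, h.eqOnBoundary_cutoff hχ hφ⟩
  exact h.totalPower_potential_eq hm hχ hf hφ h₁ h₂

theorem exists_abs_dtn_le (h : M.Admissible c) (hm : ∀ b,
      PowerMaterial (M.phaseMeasure c b) (Euc n) (M.phaseExponent b) (C b) (κ b) M.σ)
    (hχ : IsBoundaryCutoff M.Ω M.B k χ) (hf : MemW M.p M.Ω f) :
    ∃ K : ℝ, ∀ φ, MemW M.p M.Ω φ → |M.dtn c f φ| ≤ K * normW M.p M.Ω φ := by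
  have := h.isFiniteMeasure_phaseMeasure
  set V := weakGrad (M.domain c) (M.potential c f)
  set a := (eLpNorm (fun x => vecFlux (M.σ x) (V x)) (ENNReal.ofReal M.p.conjExponent)
    (M.phaseMeasure c true)).toReal
  refine ⟨a * (ENNReal.ofReal k).toReal, fun φ hφ => ?_⟩
  have hl := h.regular_cutoff hχ hφ
  -- The lifting `χ φ` vanishes in the inner phase, so only `B` contributes and the norm of
  -- `W^{1,p}(Ω)` suffices, even when `q > p`.
  have hz : matPower (M.phaseMeasure c false) M.σ V (weakGrad (M.domain c) (χ * φ)) = 0 := by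
    rw [matPower_congr (by rfl) (h.weakGrad_cutoff_inner hχ hφ)]
    simp [matPower]
  rw [h.dtn_eq hm hχ hf hφ, totalPower, Fintype.sum_bool, hz, add_zero]
  refine ((hm true).abs_matPower_le ((h.regular_potential hm hχ hf).memLp true)
    (hl.memLp true)).trans ?_
  rw [mul_assoc]
  refine mul_le_mul_of_nonneg_left ?_ ENNReal.toReal_nonneg
  have t₁ := hφ.1.2.ne
  have t₂ := (hφ.memLp_weakGrad h.isOpen).2.ne
  rw [normW, ← ENNReal.toReal_add t₁ t₂, ← ENNReal.toReal_mul]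
  exact ENNReal.toReal_mono (by finiteness) (h.eLpNorm_weakGrad_cutoff_le hχ hφ)

theorem isGateauxDerivAt_energy (h : M.Admissible c) (hm : ∀ b,
      PowerMaterial (M.phaseMeasure c b) (Euc n) (M.phaseExponent b) (C b) (κ b) M.σ)
    (hχ : IsBoundaryCutoff M.Ω M.B k χ) (hf : MemW M.p M.Ω f) :
    IsGateauxDerivAt M.p M.Ω (fun g => (M.energy c (M.potential c g)).toReal) f (M.dtn c f) := by
  have := h.isFiniteMeasure_phaseMeasure
  have hS := h.fieldSpace hχ
  have hu := h.regular_potential hm hχ hf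
  refine ⟨fun φ₁ φ₂ h₁ h₂ => ?_, fun t φ hφ => ?_, h.exists_abs_dtn_le hm hχ hf, fun φ hφ => ?_⟩
  · rw [h.dtn_eq hm hχ hf h₁, h.dtn_eq hm hχ hf h₂, h.dtn_eq hm hχ hf (h₁.add h.isOpen h₂), mul_add]
    exact hS.totalPower_add hm hu (h.regular_cutoff hχ h₁) (h.regular_cutoff hχ h₂)
  · rw [h.dtn_eq hm hχ hf hφ, h.dtn_eq hm hχ hf (hφ.smul h.isOpen t), mul_smul_comm]
    exact hS.totalPower_smul _ t (h.regular_cutoff hχ hφ)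
  · have hd := hS.hasDerivAt_totalEnergy hm (h.regular_cutoff hχ hf) (h.regular_cutoff hχ hφ)
      (u := fun ε => M.potential c (f + ε • φ)) fun ε => by
        have := h.isFieldMinimizer_potential hm hχ (hf.add h.isOpen (hφ.smul h.isOpen ε))
        rwa [mul_add, mul_smul_comm] at this
    simp only [zero_smul, add_zero] at hd
    rw [← h.dtn_eq hm hχ hf hφ] at hd
    convert hd using 2 with ε
    rw [h.energy_eq hm (h.regular_potential hm hχ (hf.add h.isOpen (hφ.smul h.isOpen ε))),
      ENNReal.toReal_ofReal (totalEnergy_nonneg _)]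

end Conductor.Admissible

theorem proposition4p1 {n : ℕ} (hn : 2 ≤ n) (M : Conductor n) (hM : M.Geometry)
    (hp : 1 < M.p) (hq : 1 < M.q)
    (hP1 : IsCaratheodoryOn M.B M.σ ∧ IsCaratheodoryOn M.A M.σ)
    (hP2 : HasGrowth M.p M.B M.σ)
    (hP3 : IsStronglyMonotone M.p M.B M.σ)
    (c : Regime) (hc : M.InnerMaterial c) :
    -- each boundary datum has a unique solution, of finite energy
    (∀ g : EuclideanSpace ℝ (Fin n) → ℝ, MemW M.p M.Ω g →
      M.IsSolution c g (M.potential c g) ∧ M.energy c (M.potential c g) < ⊤ ∧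
        ∀ u : EuclideanSpace ℝ (Fin n) → ℝ, M.IsSolution c g u →
          u =ᵐ[MeasureTheory.volume.restrict (M.domain c)] M.potential c g) ∧
    ∀ f : EuclideanSpace ℝ (Fin n) → ℝ, MemW M.p M.Ω f →
      -- the derivative of the energy of the solution is the Dirichlet-to-Neumann operator
      IsGateauxDerivAt M.p M.Ω (fun g => (M.energy c (M.potential c g)).toReal) f (M.dtn c f) ∧
      -- the latter is given by the weak formula, for any test function with the boundary values φ
      ∀ φ : EuclideanSpace ℝ (Fin n) → ℝ, MemW M.p M.Ω φ →
        (∃ ψ : EuclideanSpace ℝ (Fin n) → ℝ, M.Test c ψ ∧ M.EqOnBoundary c ψ φ) ∧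
        ∀ ψ : EuclideanSpace ℝ (Fin n) → ℝ, M.Test c ψ → M.EqOnBoundary c ψ φ →
          MeasureTheory.IntegrableOn (M.powerDensity c (M.potential c f) ψ)
            (M.energyRegion c) ∧
          M.dtn c f φ = ∫ x in M.energyRegion c, M.powerDensity c (M.potential c f) ψ x := by
  have h : M.Admissible c :=
    { hM with
      pos := by lia
      one_lt_p := hp
      one_lt_q := hq
      eq_empty := by
        rintro rfl
        exact hc }
  obtain ⟨C, κ, hm⟩ := h.exists_powerMaterial hP1 hP2 hP3 hc
  -- As `closure A` is a compact subset of `Ω`, one cutoff serves all boundary data.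
  obtain ⟨k, χ, hχ⟩ := exists_isBoundaryCutoff h.isOpen h.isCompact_closure h.inner_subset
  refine ⟨fun g hg => ⟨h.isSolution_potential hm hχ hg, ?_, fun u hu =>
    h.ae_eq_of_isSolution hm hχ hg hu (h.isSolution_potential hm hχ hg)⟩, fun f hf =>
    ⟨h.isGateauxDerivAt_energy hm hχ hf, fun φ hφ =>
      ⟨⟨_, h.test_cutoff hχ hφ, h.eqOnBoundary_cutoff hχ hφ⟩, fun ψ hψ hb => ⟨?_, ?_⟩⟩⟩⟩
  · rw [h.energy_eq hm (h.regular_potential hm hχ hg)]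
    exact ENNReal.ofReal_lt_top
  · exact h.integrableOn_powerDensity hm (h.regular_potential hm hχ hf) (h.regular_of_test hψ)
  · rw [h.dtn_eq hm hχ hf hφ, h.totalPower_potential_eq hm hχ hf hφ hψ hb]
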